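/- **Setting.** A *1-linkoid universe* $U$ is the plane graph of a connected 1-linkoid diagram on $S^2$ (one immersed interval and any number of immersed circles, over/under information forgotten): a connected graph on the oriented sphere, up to orientation preserving homeomorphism, with $n\ge 0$ four-valent vertices (crossings) and two univalent vertices, the *tail* and the *head*. The region containing the tail is starred and drawn as the exterior region. By Euler's formula there are $n$ other regions. $U$ is *trivial* if $n=0$ and *knot-type* if the head lies in the starred region too. **States, clock moves, trails.** A *(clock) state* places one marker at a corner of each crossing so that each unstarred region contains exactly one marker and the starred region none. A *clock move* takes a state to a state by a quarter turn, all in one sense, either of two markers that thereby exchange their regions (turning over a common boundary edge, which may have a knotted portion on it), or of one marker that stays in its region (turning over the edge leading to the head, which may have a knotted portion on it). A state is *clocked* if it admits no counterclockwise move, and *counter-clocked* if it admits no clockwise move. Smoothing every crossing in the direction of its marker, so that the marked corner is joined with the opposite one, gives the curve determined by the state. A *trail* is a smoothing of all crossings whose curve is a single simple path from tail to head running once through each edge. A trail is (counter-)clocked if it is determined by a (counter-)clocked state. **Shelling.** The *composition* $U_1\oplus U_2$ splices the head of $U_1$ to the tail of $U_2$. The *insertion* $U_1\oplus[U_2]$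 replaces an interval of an edge of $U_1$ by a knot-type $U_2$. A universe is *simple* if it is neither a composition nor an insertion of non-trivial universes. A *curl* is a knot-type universe with one crossing. The *shelling algorithm* works recursively. - The trivial universe gets no markers. - For $U_1\oplus U_2$ and $U_1\oplus[U_2]$ both parts are shelled separately. - On a curl the marker is placed inside the loop, in the unstarred region. - If $U$ is simple, non-trivial and not a curl, smooth every crossing on the boundary of the exterior region, other than the one next to the tail and (when the head is exterior) the one next to the head, so as to separate it from the exterior region. The boundary circle becomes the top-line and the bottom-line of a shell, and the rest is a universe $M$, the mid-line. It begins at the crossing next to the tail, and ends at the head if the head is interior and otherwise at the crossing next to the head. With the tail on the left, a marker is placed at the right-hand side of each site between top-line and mid-line, and at the left-hand side of each site between bottom-line and mid-line. In both cases this is the non-exterior corner reached from an exterior corner of that crossing by a clockwise quarter turn, and this also fixes the markers at the crossings next to the exterior endpoints and where top-line and bottom-line meet without a crossing. Then $M$ is shelled. The *reversed* algorithm swaps left and right, i.e. clockwise and counterclockwise. **Theorem (Uniqueness of Extreme States).** Every 1-linkoid universe $U$ has exactly one clocked state and exactly one counter-clocked state. The shelling algorithm can be carried out on $U$. However the decompositions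 in it are chosen, it produces the clocked state, and the reversed algorithm produces the counter-clocked state. Consequently $U$ has exactly one clocked trail and exactly one counter-clocked trail, namely those determined by the states that the shelling algorithm and its reversed version produce. -/

import Mathlib

universe u v

/-- The half-edges (darts) of the underlying plane graph of a 1-linkoid universe with set of
crossings `C`: one at the tail, one at the head, and four at every crossing `c`, numbered
`half c 0, …, half c 3` in counterclockwise cyclic order around `c`. A dart is regarded as
pointing away from its vertex. -/
inductive Dart (C : Type u) : Type u
  | tail : Dart C
  | head : Dart C
  | half (c : C) (i : ZMod 4) : Dart C

namespace Dart

/-- The next dart counterclockwise around the same vertex. -/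
def turn (C : Type u) : Equiv.Perm (Dart C) where
  toFun
    | tail => tail
    | head => head
    | half c i => half c (i + 1)
  invFun
    | tail => tail
    | head => head
    | half c i => half c (i - 1)
  left_inv d := by cases d <;> simp
  right_inv d := by cases d <;> simp

/-- The dart reached by going straight ahead through a crossing. -/
def opposite {C : Type u} : Dart C → Dart C
  | tail => tail
  | head => head
  | half c i => half c (i + 2)

/-- The map of darts induced by a map of crossings; it keeps tail, head and numbering. -/
def map {C : Type u} {C' : Type v} (f : C → C') : Dart C → Dart C'
  | tail => tail
  | head => head
  | half c i => half (f c) i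

end Dart

/-- The permutation of darts whose cycles are the regions (faces): follow the dart `d` along its
edge, keeping the region on the left of `d`, and continue with the next dart that has this region
on its left. -/
def facePerm {C : Type u} (edge : Equiv.Perm (Dart C)) : Equiv.Perm (Dart C) :=
  (Dart.turn C)⁻¹ * edge

/-- A connected 1-linkoid universe in the oriented sphere, up to orientation preserving
homeomorphism, given as a rotation system: `edge` matches the two darts of every edge.
The graph is connected and it is drawn on the sphere, i.e. its Euler characteristic is `2`; with
`n` crossings there are `n + 2` vertices and `(4 * n + 2) / 2 = 2 * n + 1` edges. Closed (knot)
components are allowed. -/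
structure LinkoidUniverse (C : Type u) where
  edge : Equiv.Perm (Dart C)
  edge_edge : ∀ d, edge (edge d) = d
  edge_ne : ∀ d, edge d ≠ d
  connected : ∀ d, Relation.ReflTransGen (fun a b => b = edge a ∨ b = Dart.turn C a) Dart.tail d
  euler : ((Nat.card C : ℤ) + 2) - (2 * (Nat.card C : ℤ) + 1)
    + (Nat.card (Quotient (Equiv.Perm.SameCycle.setoid (facePerm edge))) : ℤ) = 2

/-- The two senses of rotation in the plane. -/
inductive Sense : Type
  | clockwise : Sense
  | counterclockwise : Sense

/-- Rotating by 90 degrees shifts the (counterclockwise) numbering of the corners by `∓ 1`. -/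
def Sense.step : Sense → ZMod 4
  | clockwise => -1
  | counterclockwise => 1

/-- The four corners at a crossing `c` are numbered so that the corner `i` lies between
`half c i` and `half c (i + 1)`. A marking chooses one corner at every crossing. -/
abbrev Marking (C : Type u) : Type u := C → ZMod 4

/-- The smoothing of all crossings in the direction of the markers: at `c` the marked corner
`s c` is joined with the opposite corner `s c + 2`, so that the four ends are reconnected as
`s c ↔ s c + 3` and `s c + 1 ↔ s c + 2`. The smoothing is recorded as the involution of
darts that exchanges reconnected ends. -/
def smoothing {C : Type u} (s : Marking C) : Dart C → Dart C
  | Dart.tail => Dart.tail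
  | Dart.head => Dart.head
  | Dart.half c i => Dart.half c (2 * s c + 3 - i)

namespace LinkoidUniverse

variable {C : Type u} (U : LinkoidUniverse C)

/-- The regions of the sphere minus the universe. -/
abbrev Region : Type u := Quotient (Equiv.Perm.SameCycle.setoid (facePerm U.edge))

/-- The region on the left of a dart. -/
def region (d : Dart C) : U.Region :=
  Quotient.mk (Equiv.Perm.SameCycle.setoid (facePerm U.edge)) d

/-- The starred region, which contains the tail. In the standard planar representation it is the
exterior (unbounded) region. -/
def star : U.Region := U.region Dart.tail

/-- The region in which the corner `i` of the crossing `c` lies. -/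
def corner (c : C) (i : ZMod 4) : U.Region := U.region (Dart.half c i)

/-! ### States, clock moves, trails -/

/-- A clock state: one marker at every crossing, such that the starred region has no marker and
every other region has exactly one. -/
def IsState (s : Marking C) : Prop :=
  (∀ c, U.corner c (s c) ≠ U.star) ∧ ∀ R : U.Region, R ≠ U.star → ∃! c, U.corner c (s c) = R

/-- Two markers, at `c₁` and `c₂`, are rotated by 90 degrees and thereby exchange their regions.
The half-edges that the markers sweep over separate the same two regions, so they belong to one
common boundary edge, possibly one with a knotted portion inserted in it. -/
def IsDoubleMove (t : Sense) (s s' : Marking C) : Prop :=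
  ∃ c₁ c₂ : C, c₁ ≠ c₂ ∧
    s' c₁ = s c₁ + t.step ∧ s' c₂ = s c₂ + t.step ∧ (∀ c, c ≠ c₁ → c ≠ c₂ → s' c = s c) ∧
    U.corner c₁ (s' c₁) = U.corner c₂ (s c₂) ∧ U.corner c₂ (s' c₂) = U.corner c₁ (s c₁)

/-- One marker is rotated by 90 degrees inside its region. The half-edge that it sweeps over has
the same region on both sides, so on the sphere it is a bridge between the tail and the head: it is
the edge that leads to the head, possibly one with a knotted portion on it. -/
def IsHeadMove (t : Sense) (s s' : Marking C) : Prop :=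
  ∃ c : C, s' c = s c + t.step ∧ (∀ x, x ≠ c → s' x = s x) ∧
    U.corner c (s' c) = U.corner c (s c)

/-- A clock move from the state `s` to the state `s'`, in the sense of rotation `t`. -/
def IsClockMove (t : Sense) (s s' : Marking C) : Prop :=
  U.IsState s ∧ U.IsState s' ∧ (U.IsDoubleMove t s s' ∨ U.IsHeadMove t s s')

/-- A clocked state: a state that admits clock moves only in the clockwise direction. -/
def IsClocked (s : Marking C) : Prop :=
  U.IsState s ∧ ∀ s', ¬ U.IsClockMove Sense.counterclockwise s s'

/-- A counter-clocked state: a state that admits clock moves only in the counterclockwise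
direction. -/
def IsCounterClocked (s : Marking C) : Prop :=
  U.IsState s ∧ ∀ s', ¬ U.IsClockMove Sense.clockwise s s'

/-- A trail: a smoothing of all crossings for which the resulting curve is connected. Both
`U.edge` and the smoothing are involutions, so this curve is then a simple path from the tail
to the head that runs through every edge exactly once. -/
def IsTrail (j : Dart C → Dart C) : Prop :=
  (∃ m : Marking C, j = smoothing m) ∧
    ∀ d, Relation.ReflTransGen (fun a b => b = U.edge a ∨ b = j a) Dart.tail d

/-- A clocked trail: a trail determined by a clocked state. -/
def IsClockedTrail (j : Dart C → Dart C) : Prop :=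
  U.IsTrail j ∧ ∃ s, U.IsClocked s ∧ j = smoothing s

/-- A counter-clocked trail: a trail determined by a counter-clocked state. -/
def IsCounterClockedTrail (j : Dart C → Dart C) : Prop :=
  U.IsTrail j ∧ ∃ s, U.IsCounterClocked s ∧ j = smoothing s

/-! ### Composition, insertion, simple universes -/

/-- The two endpoints lie in the same region. -/
def IsKnotType : Prop := U.region Dart.head = U.star

/-- A curl: one crossing, and endpoints in the same region. -/
def IsCurl : Prop := Nat.card C = 1 ∧ U.IsKnotType

/-- `U` is the composition of `U₁`, with the crossings in `S`, and `U₂`, with the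
other crossings: the head of `U₁` is spliced to the tail of `U₂`. -/
def IsComposition (S : Set C) (U₁ : LinkoidUniverse S) (U₂ : LinkoidUniverse ↥(Sᶜ)) : Prop :=
  (∀ d : Dart S, d ≠ Dart.head → U₁.edge d ≠ Dart.head →
    U.edge (d.map Subtype.val) = (U₁.edge d).map Subtype.val) ∧
  (∀ d : Dart ↥(Sᶜ), d ≠ Dart.tail → U₂.edge d ≠ Dart.tail →
    U.edge (d.map Subtype.val) = (U₂.edge d).map Subtype.val) ∧
  U.edge ((U₁.edge Dart.head).map Subtype.val) = (U₂.edge Dart.tail).map Subtype.val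

/-- `U` is the insertion of the knot-type universe `U₂` (the rider), with the crossings outside
`S`, into the edge `{e, U₁.edge e}` of `U₁` (the carrier), with the crossings in `S`. -/
def IsInsertion (S : Set C) (U₁ : LinkoidUniverse S) (e : Dart S)
    (U₂ : LinkoidUniverse ↥(Sᶜ)) : Prop :=
  U₂.IsKnotType ∧
  (∀ d : Dart S, d ≠ e → d ≠ U₁.edge e →
    U.edge (d.map Subtype.val) = (U₁.edge d).map Subtype.val) ∧
  (∀ d : Dart ↥(Sᶜ), d ≠ Dart.tail → d ≠ Dart.head → U₂.edge d ≠ Dart.tail →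
    U₂.edge d ≠ Dart.head → U.edge (d.map Subtype.val) = (U₂.edge d).map Subtype.val) ∧
  U.edge (e.map Subtype.val) = (U₂.edge Dart.tail).map Subtype.val ∧
  U.edge ((U₁.edge e).map Subtype.val) = (U₂.edge Dart.head).map Subtype.val

/-- A prime universe: not a composition of two non-trivial universes (the trivial universe has no
crossings). -/
def IsPrime : Prop :=
  ¬ ∃ (S : Set C) (U₁ : LinkoidUniverse S) (U₂ : LinkoidUniverse ↥(Sᶜ)),
    S.Nonempty ∧ Sᶜ.Nonempty ∧ U.IsComposition S U₁ U₂

/-- The universe has a (non-trivial) rider on a (non-trivial) carrier. -/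
def HasRider : Prop :=
  ∃ (S : Set C) (U₁ : LinkoidUniverse S) (e : Dart S) (U₂ : LinkoidUniverse ↥(Sᶜ)),
    S.Nonempty ∧ Sᶜ.Nonempty ∧ U.IsInsertion S U₁ e U₂

/-- A simple universe: prime and without riders. -/
def IsSimple : Prop := U.IsPrime ∧ ¬ U.HasRider

/-! ### Derivation -/

/-- The crossings that lie on the boundary of the starred region. -/
def IsBoundaryCrossing (c : C) : Prop := ∃ i, U.corner c i = U.star

/-- The dart belongs to an edge that is not incident to the starred region. -/
def IsInterior (d : Dart C) : Prop := U.region d ≠ U.star ∧ U.region (U.edge d) ≠ U.star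

/-- `U.Runs d d'`: starting from `d` along its edge, and passing smoothed boundary crossings, one
arrives at `d'`. The smoothing at a boundary crossing separates it from the starred region,
so it reconnects the two interior half-edges `half c i` and `half c j` with each other. (The
crossing next to an endpoint that lies in the starred region has only one interior half-edge; there
the run stops.) -/
inductive Runs : Dart C → Dart C → Prop
  | along (d : Dart C) : Runs d (U.edge d)
  | pass (d : Dart C) (c : C) (i j : ZMod 4) : Runs d (Dart.half c i) →
      U.IsBoundaryCrossing c → i ≠ j → U.IsInterior (Dart.half c i) →
      U.IsInterior (Dart.half c j) → Runs d (U.edge (Dart.half c j))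

open Classical in
/-- The darts of the mid-line, as darts of `U`. The mid-line begins at the crossing next to the
tail, with the dart opposite to the tail edge. If the head is in the starred region the mid-line
likewise ends at the crossing next to the head, and otherwise at the head itself. -/
noncomputable def midlineDart : Dart {c : C // ¬ U.IsBoundaryCrossing c} → Dart C
  | Dart.tail => (U.edge Dart.tail).opposite
  | Dart.head =>
      if U.region Dart.head = U.star then (U.edge Dart.head).opposite else Dart.head
  | Dart.half c i => Dart.half c.1 i

/-- `M` is the mid-line of the shell that is the derivation of the simple universe `U`: all boundary
crossings not next to an endpoint in the starred region are smoothed, the boundary cycle becomes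
the circle of the shell (its top-line and bottom-line), and the rest is the universe `M`, whose
edges are the runs of `U`. -/
def IsMidline (M : LinkoidUniverse {c : C // ¬ U.IsBoundaryCrossing c}) : Prop :=
  ∀ d, U.Runs (U.midlineDart d) (U.midlineDart (M.edge d))

end LinkoidUniverse

/-! ### The shelling algorithm -/

/-- Shell compositions underlying a universe, as produced by repeated derivation: the empty shell, a
curl, the shell of a simple universe with a shell composition on its mid-line, and the
compound cases `D (U₁ ⊕ U₂) = D U₁ ⊕ D U₂` and `D (U₁ ⊕ [U₂]) = D U₁ ⊕ [D U₂]`. -/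
inductive ShellComposition : {C : Type u} → LinkoidUniverse C → Type (u + 1)
  | empty {C : Type u} (U : LinkoidUniverse C) : IsEmpty C → ShellComposition U
  | curl {C : Type u} (U : LinkoidUniverse C) : U.IsCurl → ShellComposition U
  | shell {C : Type u} (U : LinkoidUniverse C)
      (M : LinkoidUniverse {c : C // ¬ U.IsBoundaryCrossing c}) :
      Nonempty C → U.IsSimple → ¬ U.IsCurl → U.IsMidline M →
      ShellComposition M → ShellComposition U
  | composite {C : Type u} (U : LinkoidUniverse C) (S : Set C) (U₁ : LinkoidUniverse S)
      (U₂ : LinkoidUniverse ↥(Sᶜ)) :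
      S.Nonempty → Sᶜ.Nonempty → U.IsComposition S U₁ U₂ →
      ShellComposition U₁ → ShellComposition U₂ → ShellComposition U
  | rider {C : Type u} (U : LinkoidUniverse C) (S : Set C) (U₁ : LinkoidUniverse S) (e : Dart S)
      (U₂ : LinkoidUniverse ↥(Sᶜ)) :
      S.Nonempty → Sᶜ.Nonempty → U.IsInsertion S U₁ e U₂ →
      ShellComposition U₁ → ShellComposition U₂ → ShellComposition U

/-- The placement rule at a site `c` on the boundary of a simple universe that is not a curl.

With the tail on the left, the rule for `t = clockwise` is: right-hand side of a site between
top-line and mid-line, left-hand side of a site between bottom-line and mid-line. In both cases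
this is the corner reached from an exterior corner at `c` by a quarter turn clockwise that does not
lie in the exterior region itself. (Top: from north to east; bottom: from south to west. Where the
loop of a shell with inner head passes from the top-line to the bottom-line the two
readings agree: from east to south. At the crossing next to the tail it is the
north-east corner, and at the one next to an exterior head the south-west corner.) For
`t = counterclockwise` left and right are swapped. -/
def LinkoidUniverse.SiteRule {C : Type u} (U : LinkoidUniverse C) (t : Sense) (c : C)
    (i : ZMod 4) : Prop :=
  U.corner c i ≠ U.star ∧ U.corner c (i - t.step) = U.star

/-- The marking `s` is placed by the shelling algorithm on the given shell composition. The marker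
at a curl lies inside, i.e. in the bounded region enclosed by the loop. -/
def ShellComposition.Places (t : Sense) : {C : Type u} → {U : LinkoidUniverse C} →
    ShellComposition U → Marking C → Prop
  | _, _, .empty _ _, _ => True
  | _, U, .curl _ _, s => ∀ c, U.corner c (s c) ≠ U.star
  | _, U, .shell _ _ _ _ _ _ D, s =>
      (∀ c, U.IsBoundaryCrossing c → U.SiteRule t c (s c)) ∧ D.Places t fun c => s c.1
  | _, _, .composite _ _ _ _ _ _ _ D₁ D₂, s =>
      (D₁.Places t fun c => s c.1) ∧ D₂.Places t fun c => s c.1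
  | _, _, .rider _ _ _ _ _ _ _ _ D₁ D₂, s =>
      (D₁.Places t fun c => s c.1) ∧ D₂.Places t fun c => s c.1

/-!
The proof is combinatorial and works with darts throughout. What it uses of the topology of the sphere
is linear algebra: the Euler characteristic bounds the number of faces of every connected map, and,
where the bound is attained, a function on the edges with sum zero around every face comes from a
function on the vertices (`euler_inequality_and_exactness`, `orbit_euler_inequality`). The second fact
replaces the Jordan curve theorem: `exists_potential` cuts the sphere along a closed curve that
crosses edges, and `exists_height` along one that passes through crossings.

*Uniqueness.* Two states are compared by a height of the edges that jumps at the markers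
(`exists_height_of_states`). At an extreme level of a nonconstant height the markers of one state could
move on cyclically in one sense, each into the region of the next, and those of the other state in
the opposite sense. Such a cyclic exchange contains a genuine clock move (`exists_exchange_of_cycle`):
by Euler's inequality, the part of the universe at the extreme level is attached at no more than
two crossings, and these exchange their regions. So two different states cannot both be clocked.

*Trails.* If smoothing a state disconnected the curve, there would be a closed chain of
crossings along which two components touch, with markers on one side of it. The side of the tail would
then have more faces than Euler's inequality permits (`not_exists_marker_cycle`).

*Existence.* It remains to see that the shelling algorithm can be carried out and that the markers which
it places form a state without moves in the wrong sense. The unstarred regions of the parts of a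
composition or insertion are regions of the whole (`IsPiece`), so extreme states of the parts fit
together (`isExtreme_of_pieces`).

In a simple universe, a region shares at most one edge with the starred region
(`IsSimple.eq_of_adjacent_star`), and a boundary crossing meets the starred region in one corner, or
in two at the edge of an exterior endpoint (`IsSimple.star_corners`). Otherwise a closed curve would
meet the universe in two edges and cut off a factor or a rider (`exists_composition_of_bridge`,
`IsPrime.hasRider_of_two_cut`). Following the smoothed boundary crossings pairs the remaining
half-edges, which gives the edges of the mid-line (`IsRun`). The mid-line is connected because the
simple universe cannot be separated along edges at the starred region (`IsSimple.midline_connected`).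
The regions that do not border on the starred one serve as labels of its faces; they are numerous
enough to show that the mid-line is planar and that these are exactly its unstarred regions
(`IsSimple.card_deep`, `IsMidline.isPiece`). The markers at the boundary lie in the other, bordering
regions, one in each, and a move back would bring them into the starred region
(`IsMidline.isExtreme`).
-/

/-! ### The Euler inequality and vanishing cohomology -/

section EulerInequality

variable {D P Q R : Type*} [Fintype D] [Fintype P] [Fintype Q] [Fintype R]

open Module in
/-- The linear algebra behind Euler's formula. Two permutations `x`, `y` act transitively on `D`;
the fibres of `p`, `q`, `r` are unions of orbits of `x`, of `y` and of `y * x⁻¹`. The differences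
`g (r (x d)) - g (r d)` are orthogonal to the functions that factor through `p` or `q`, so counting
dimensions gives an inequality (the genus is nonnegative). If it is an equality (genus `0`), these
differences fill the orthogonal complement, that is, the first cohomology vanishes. -/
theorem euler_inequality_and_exactness [Nonempty D] (x y : Equiv.Perm D) {p : D → P} {q : D → Q}
    {r : D → R} (hp : Function.Surjective p) (hq : Function.Surjective q)
    (hr : Function.Surjective r) (hpx : ∀ d, p (x d) = p d) (hqy : ∀ d, q (y d) = q d)
    (hrxy : ∀ d, r (x d) = r (y d))
    (hconn : ∀ g : D → ℚ, (∀ d, g (x d) = g d) → (∀ d, g (y d) = g d) → ∀ d d', g d = g d') :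
    Fintype.card P + Fintype.card Q + Fintype.card R ≤ Fintype.card D + 2 ∧
    (Fintype.card D + 2 ≤ Fintype.card P + Fintype.card Q + Fintype.card R → ∀ w : D → ℚ,
      (∀ a : P → ℚ, ∑ d, a (p d) * w d = 0) → (∀ a : Q → ℚ, ∑ d, a (q d) * w d = 0) →
      ∃ g : R → ℚ, ∀ d, w d = g (r (x d)) - g (r d)) := by
  classical
  let X := LinearMap.range (LinearMap.funLeft ℚ ℚ p)
  let Y := LinearMap.range (LinearMap.funLeft ℚ ℚ q)
  let Θ : (R → ℚ) →ₗ[ℚ] (D → ℚ) := LinearMap.funLeft ℚ ℚ (r ∘ x) - LinearMap.funLeft ℚ ℚ r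
  let K : Submodule ℚ (D → ℚ) := Submodule.span ℚ {fun _ => 1}
  have hK : finrank ℚ K ≤ 1 := by
    simpa using finrank_span_le_card (R := ℚ) ({fun _ => 1} : Set (D → ℚ))
  have memK : ∀ f : D → ℚ, (∀ d d', f d = f d') → f ∈ K := fun f hf => by
    obtain ⟨d₀⟩ := ‹Nonempty D›
    refine Submodule.mem_span_singleton.2 ⟨f d₀, ?_⟩
    funext d
    simp [hf d d₀]
  have hX : finrank ℚ X = Fintype.card P := by
    rw [LinearMap.finrank_range_of_inj (LinearMap.funLeft_injective_of_surjective _ _ _ hp)]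
    simp
  have hY : finrank ℚ Y = Fintype.card Q := by
    rw [LinearMap.finrank_range_of_inj (LinearMap.funLeft_injective_of_surjective _ _ _ hq)]
    simp
  have hXY : finrank ℚ ↥(X ⊓ Y) ≤ 1 := by
    refine (Submodule.finrank_mono ?_).trans hK
    rintro f ⟨⟨a, rfl⟩, b, hb⟩
    refine memK _ (hconn _ (fun d => ?_) (fun d => ?_))
    · simp [LinearMap.funLeft_apply, hpx]
    · rw [← hb]
      simp [LinearMap.funLeft_apply, hqy]
  have hsum := Submodule.finrank_sup_add_finrank_inf_eq X Y
  have hker : finrank ℚ (LinearMap.ker Θ) ≤ 1 := by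
    have hinj := LinearMap.funLeft_injective_of_surjective ℚ ℚ r hr
    rw [(Submodule.equivMapOfInjective _ hinj (LinearMap.ker Θ)).finrank_eq]
    refine (Submodule.finrank_mono ?_).trans hK
    rintro _ ⟨g, hg, rfl⟩
    have hg' : ∀ d, g (r (x d)) = g (r d) := fun d => by
      have := congrFun (LinearMap.mem_ker.1 hg) d
      simpa [Θ, LinearMap.funLeft_apply, sub_eq_zero] using this
    refine memK _ (hconn _ hg' fun d => ?_)
    simp only [LinearMap.funLeft_apply]
    rw [← hrxy, hg']
  have hΘ := LinearMap.finrank_range_add_finrank_ker Θ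
  have hR : finrank ℚ (R → ℚ) = Fintype.card R := by simp
  have hD : finrank ℚ (D → ℚ) = Fintype.card D := by simp
  have orthX : ∀ g : R → ℚ, ∀ a : P → ℚ, ∑ d, a (p d) * (g (r (x d)) - g (r d)) = 0 := by
    intro g a
    simp only [mul_sub, Finset.sum_sub_distrib]
    rw [← Equiv.sum_comp x (fun d => a (p d) * g (r d))]
    simp [hpx]
  have orthY : ∀ g : R → ℚ, ∀ a : Q → ℚ, ∑ d, a (q d) * (g (r (x d)) - g (r d)) = 0 := by
    intro g a
    simp only [mul_sub, Finset.sum_sub_distrib]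
    rw [← Equiv.sum_comp y (fun d => a (q d) * g (r d))]
    simp [hqy, hrxy]
  -- A vector of `X ⊔ Y` that is orthogonal to `X` and `Y` is orthogonal to itself.
  have hzero : ∀ f ∈ X ⊔ Y, (∀ a : P → ℚ, ∑ d, a (p d) * f d = 0) →
      (∀ a : Q → ℚ, ∑ d, a (q d) * f d = 0) → f = 0 := by
    intro f hf h₁ h₂
    obtain ⟨_, ⟨a, rfl⟩, _, ⟨b, rfl⟩, hab⟩ := Submodule.mem_sup.1 hf
    have h : ∑ d, f d * f d = 0 := by
      have h3 : ∀ d, f d * f d = a (p d) * f d + b (q d) * f d := fun d => by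
        rw [← add_mul]
        congr 1
        rw [← hab]
        rfl
      rw [Finset.sum_congr rfl fun d _ => h3 d, Finset.sum_add_distrib, h₁, h₂, add_zero]
    funext d
    have := (Finset.sum_eq_zero_iff_of_nonneg fun d _ => mul_self_nonneg (f d)).1 h d
      (Finset.mem_univ d)
    simpa using this
  have hdisj : (X ⊔ Y) ⊓ LinearMap.range Θ = ⊥ := by
    rw [eq_bot_iff]
    rintro f ⟨hf, g, rfl⟩
    exact hzero _ hf (orthX g) (orthY g)
  have htot := Submodule.finrank_sup_add_finrank_inf_eq (X ⊔ Y) (LinearMap.range Θ)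
  rw [hdisj, finrank_bot] at htot
  have hle := Submodule.finrank_le ((X ⊔ Y) ⊔ LinearMap.range Θ)
  refine ⟨by omega, fun hcard w hw₁ hw₂ => ?_⟩
  have htop : (X ⊔ Y) ⊔ LinearMap.range Θ = ⊤ := Submodule.eq_top_of_finrank_eq (by omega)
  obtain ⟨f, hf, _, ⟨g, rfl⟩, hfg⟩ := Submodule.mem_sup.1 (htop ▸ Submodule.mem_top : w ∈ _)
  have hf' : ∀ d, f d = w d - (g (r (x d)) - g (r d)) := fun d => by
    rw [← hfg]
    simp [Θ, LinearMap.funLeft_apply]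
  have hf0 : f = 0 := by
    refine hzero f hf (fun a => ?_) (fun a => ?_)
    · simp only [hf', mul_sub (a _) (w _), Finset.sum_sub_distrib, hw₁, orthX, sub_zero]
    · simp only [hf', mul_sub (a _) (w _), Finset.sum_sub_distrib, hw₂, orthY, sub_zero]
  refine ⟨g, fun d => ?_⟩
  have := hf' d
  rw [hf0, Pi.zero_apply] at this
  linarith

end EulerInequality

/-- The orbits of a fixed-point free involution come in pairs. -/
theorem exists_orbits_of_involution {D : Type*} [Fintype D] (α : D → D) (hα : ∀ d, α (α d) = d)
    (hne : ∀ d, α d ≠ d) :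
    ∃ (Q : Finset (Finset D)) (q : D → Q), Function.Surjective q ∧ (∀ d, q (α d) = q d) ∧
      (∀ d d', q d = q d' → d' = d ∨ d' = α d) ∧ 2 * Fintype.card Q = Fintype.card D := by
  classical
  let f : D → Finset D := fun d => {d, α d}
  have hf : ∀ d, f (α d) = f d := fun d => by simp [f, hα, Finset.pair_comm]
  have hff : ∀ d d', f d = f d' → d' = d ∨ d' = α d := fun d d' h => by
    have : d' ∈ f d := by rw [h]; simp [f]
    simpa [f] using this
  refine ⟨Finset.univ.image f, fun d => ⟨f d, Finset.mem_image_of_mem f (Finset.mem_univ d)⟩,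
    ?_, fun d => Subtype.ext (hf d), fun d d' h => hff d d' (congrArg Subtype.val h), ?_⟩
  · rintro ⟨s, hs⟩
    obtain ⟨d, -, rfl⟩ := Finset.mem_image.1 hs
    exact ⟨d, rfl⟩
  · have h := Finset.card_eq_sum_card_image f (Finset.univ : Finset D)
    rw [Finset.sum_congr rfl (g := fun _ => 2)] at h
    · rw [Finset.sum_const, smul_eq_mul] at h
      rw [Fintype.card_coe, ← Finset.card_univ, h, mul_comm]
    · intro s hs
      obtain ⟨d, -, rfl⟩ := Finset.mem_image.1 hs
      have : (Finset.univ.filter fun a => f a = f d) = {d, α d} := by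
        ext a
        simp only [Finset.mem_filter, Finset.mem_univ, true_and, Finset.mem_insert,
          Finset.mem_singleton]
        exact ⟨fun h => hff d a h.symm, by rintro (rfl | rfl) <;> simp [hf]⟩
      rw [this, Finset.card_pair (hne d).symm]

/-- `V - E + F ≤ 2` for an orbit `T` of the group generated by `x` (rotation at the vertices) and a
fixed-point free involution `α` (edges); `p` is constant on vertices and `l` on faces. -/
theorem orbit_euler_inequality {D P L : Type*} [Finite D] [DecidableEq P] [DecidableEq L]
    (x α : D → D) (hx : Function.Injective x) (hα : ∀ d, α (α d) = d) (hne : ∀ d, α d ≠ d)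
    (T : Finset D) (d₀ : D)
    (hT : ∀ d, d ∈ T ↔ Relation.ReflTransGen (fun a b => b = α a ∨ b = x a) d₀ d)
    (p : D → P) (l : D → L) (hp : ∀ d ∈ T, p (x d) = p d) (hl : ∀ d ∈ T, l (α (x d)) = l d) :
    2 * (T.image p).card + 2 * (T.image l).card ≤ T.card + 4 := by
  classical
  have hTx : ∀ d ∈ T, x d ∈ T := fun d hd => (hT _).2 (((hT d).1 hd).tail (Or.inr rfl))
  have hTα : ∀ d ∈ T, α d ∈ T := fun d hd => (hT _).2 (((hT d).1 hd).tail (Or.inl rfl))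
  have hd₀ : d₀ ∈ T := (hT _).2 Relation.ReflTransGen.refl
  let x' : T → T := fun d => ⟨x d, hTx d d.2⟩
  have hx'inj : Function.Injective x' := fun a b h =>
    Subtype.ext (hx (congrArg Subtype.val h))
  let X : Equiv.Perm T := Equiv.ofBijective x' (Finite.injective_iff_bijective.1 hx'inj)
  let a' : T → T := fun d => ⟨α d, hTα d d.2⟩
  have ha' : Function.Involutive a' := fun d => Subtype.ext (hα d)
  let A : Equiv.Perm T := ha'.toPerm
  obtain ⟨Q, q, hq, hqα, -, hQ⟩ := exists_orbits_of_involution a' ha'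
    fun d h => hne d (congrArg Subtype.val h)
  let p' : T → T.image p := fun d => ⟨p d, Finset.mem_image_of_mem p d.2⟩
  let l' : T → T.image l := fun d => ⟨l (α d), Finset.mem_image_of_mem l (hTα d d.2)⟩
  have hp' : Function.Surjective p' := by
    rintro ⟨s, hs⟩
    obtain ⟨d, hd, rfl⟩ := Finset.mem_image.1 hs
    exact ⟨⟨d, hd⟩, rfl⟩
  have hl' : Function.Surjective l' := by
    rintro ⟨s, hs⟩
    obtain ⟨d, hd, rfl⟩ := Finset.mem_image.1 hs
    exact ⟨⟨α d, hTα d hd⟩, Subtype.ext (by simp [l', hα])⟩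
  have : Nonempty T := ⟨⟨d₀, hd₀⟩⟩
  have key := (euler_inequality_and_exactness X A hp' hq hl' (fun d => Subtype.ext (hp d d.2)) hqα
    (fun d => Subtype.ext (show l (α (x d)) = l (α (α d)) by rw [hl d d.2, hα])) ?_).1
  · simp only [Fintype.card_coe] at key hQ
    omega
  · intro g hgx hgα
    have : ∀ d ∈ T, ∃ h : d ∈ T, g ⟨d, h⟩ = g ⟨d₀, hd₀⟩ := by
      intro d hd
      induction (hT d).1 hd with
      | refl => exact ⟨hd₀, rfl⟩
      | tail hab h ih =>
        obtain ⟨h', e⟩ := ih ((hT _).2 hab)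
        rcases h with rfl | rfl
        exacts [⟨hd, (hgα ⟨_, h'⟩).trans e⟩, ⟨hd, (hgx ⟨_, h'⟩).trans e⟩]
    rintro ⟨d, hd⟩ ⟨d', hd'⟩
    rw [(this d hd).2, (this d' hd').2]

/-! ### Darts and regions -/

namespace Dart

variable {C : Type u}

def equivSum (C : Type u) : Dart C ≃ Bool ⊕ C × ZMod 4 where
  toFun
    | tail => Sum.inl true
    | head => Sum.inl false
    | half c i => Sum.inr (c, i)
  invFun
    | Sum.inl true => tail
    | Sum.inl false => head
    | Sum.inr (c, i) => half c i
  left_inv d := by cases d <;> rfl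
  right_inv d := by rcases d with (_ | _) | ⟨c, i⟩ <;> rfl

instance [Finite C] : Finite (Dart C) := Finite.of_equiv _ (equivSum C).symm

noncomputable instance [Fintype C] : Fintype (Dart C) := Fintype.ofEquiv _ (equivSum C).symm

theorem sum_eq [Fintype C] {M : Type*} [AddCommMonoid M] (f : Dart C → M) :
    ∑ d, f d = f tail + f head + ∑ c, ∑ i, f (half c i) := by
  rw [← Equiv.sum_comp (equivSum C).symm f, Fintype.sum_sum_type, Fintype.sum_prod_type]
  simp [equivSum]

theorem card_eq [Fintype C] : Fintype.card (Dart C) = 4 * Fintype.card C + 2 := by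
  rw [Fintype.card_congr (equivSum C)]
  simp
  ring

@[simp] theorem turn_tail : turn C tail = tail := rfl
@[simp] theorem turn_head : turn C head = head := rfl
@[simp] theorem turn_half (c : C) (i : ZMod 4) : turn C (half c i) = half c (i + 1) := rfl
@[simp] theorem turn_inv_tail : (turn C)⁻¹ tail = tail := rfl
@[simp] theorem turn_inv_head : (turn C)⁻¹ head = head := rfl

/-- The vertex at which a dart starts: an endpoint or a crossing. -/
def vertex : Dart C → Bool ⊕ C
  | tail => Sum.inl true
  | head => Sum.inl false
  | half c _ => Sum.inr c

@[simp] theorem vertex_tail : vertex (tail : Dart C) = Sum.inl true := rfl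
@[simp] theorem vertex_head : vertex (head : Dart C) = Sum.inl false := rfl
@[simp] theorem vertex_half (c : C) (i : ZMod 4) : vertex (half c i) = Sum.inr c := rfl

@[simp] theorem vertex_turn (d : Dart C) : vertex (turn C d) = vertex d := by cases d <;> rfl

theorem vertex_surjective : Function.Surjective (vertex : Dart C → Bool ⊕ C) := by
  rintro ((_ | _) | c)
  exacts [⟨head, rfl⟩, ⟨tail, rfl⟩, ⟨half c 0, rfl⟩]

/-- A function that is invariant under `turn` depends on the vertex only. -/
theorem half_eq_of_turn {X : Type*} {f : Dart C → X} (hf : ∀ d, f (turn C d) = f d) (c : C)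
    (i j : ZMod 4) : f (half c i) = f (half c j) := by
  have h : ∀ i, f (half c (i + 1)) = f (half c i) := fun i => hf (half c i)
  have h0 := h 0
  have h1 := h 1
  have h2 := h 2
  have key : ∀ i, f (half c i) = f (half c 0) := by
    intro i
    fin_cases i
    · rfl
    · exact h0
    · exact h1.trans h0
    · exact h2.trans (h1.trans h0)
  rw [key i, key j]

end Dart

namespace LinkoidUniverse

variable {C : Type u} (U : LinkoidUniverse C)

/-- The induction principle that expresses connectedness. -/
theorem dart_induction {Z : Dart C → Prop} (h0 : Z Dart.tail) (he : ∀ d, Z d → Z (U.edge d))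
    (ht : ∀ d, Z d → Z (Dart.turn C d)) (d : Dart C) : Z d := by
  induction U.connected d with
  | refl => exact h0
  | tail _ h ih =>
    rcases h with rfl | rfl
    exacts [he _ ih, ht _ ih]

theorem eq_tail_of_invariant {X : Type*} (g : Dart C → X) (he : ∀ d, g (U.edge d) = g d)
    (ht : ∀ d, g (Dart.turn C d) = g d) (d : Dart C) : g d = g Dart.tail :=
  U.dart_induction (Z := fun d => g d = g Dart.tail) rfl (fun d h => (he d).trans h)
    (fun d h => (ht d).trans h) d

theorem region_eq_iff {d d' : Dart C} :
    U.region d = U.region d' ↔ (facePerm U.edge).SameCycle d d' := Quotient.eq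

theorem region_surjective : Function.Surjective U.region := Quotient.mk_surjective

theorem region_facePerm (d : Dart C) : U.region (facePerm U.edge d) = U.region d :=
  U.region_eq_iff.2 (Equiv.Perm.sameCycle_apply_left.2 (Equiv.Perm.SameCycle.refl _ _))

theorem facePerm_edge (d : Dart C) : facePerm U.edge (U.edge d) = (Dart.turn C)⁻¹ d := by
  simp [facePerm, U.edge_edge]

theorem edge_turn_facePerm (d : Dart C) : Dart.turn C (facePerm U.edge d) = U.edge d := by
  simp [facePerm]

theorem region_edge_turn (d : Dart C) : U.region (U.edge (Dart.turn C d)) = U.region d := by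
  rw [← U.region_facePerm, facePerm_edge]
  simp

theorem region_edge_half (c : C) (i : ZMod 4) :
    U.region (U.edge (Dart.half c i)) = U.corner c (i - 1) := by
  have := U.region_edge_turn (Dart.half c (i - 1))
  rwa [Dart.turn_half, sub_add_cancel] at this

theorem region_edge_tail : U.region (U.edge Dart.tail) = U.star := U.region_edge_turn Dart.tail

theorem region_edge_head : U.region (U.edge Dart.head) = U.region Dart.head :=
  U.region_edge_turn Dart.head

/-- A property that is preserved by the face permutation spreads over the region (which is a finite
cycle). -/
theorem region_induction [Finite C] {Z : Dart C → Prop} (hZ : ∀ d, Z d → Z (facePerm U.edge d))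
    {d d' : Dart C} (h : U.region d = U.region d') (hd : Z d) : Z d' := by
  obtain ⟨n, -, rfl⟩ := (U.region_eq_iff.1 h).exists_pow_eq'
  have : ∀ n : ℕ, Z ((facePerm U.edge ^ n) d) := by
    intro n
    induction n with
    | zero => exact hd
    | succ k ih => rw [pow_succ', Equiv.Perm.mul_apply]; exact hZ _ ih
  exact this n

/-- If a region has a dart with a property, and one without, then some step along its boundary
acquires the property. -/
theorem exists_enter [Finite C] {Z : Dart C → Prop} {d d' : Dart C} (h : U.region d = U.region d')
    (hd : ¬ Z d) (hd' : Z d') :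
    ∃ y, U.region y = U.region d ∧ ¬ Z y ∧ Z (facePerm U.edge y) := by
  by_contra! hcon
  exact (U.region_induction (Z := fun y => U.region y = U.region d ∧ ¬ Z y)
    (fun y hy => ⟨(U.region_facePerm y).trans hy.1, hcon y hy.1 hy.2⟩) h ⟨rfl, hd⟩).2 hd'

theorem eq_of_region_eq {X : Type*} {f : Dart C → X} [Finite C]
    (hf : ∀ d, f (facePerm U.edge d) = f d) {d d' : Dart C} (h : U.region d = U.region d') :
    f d = f d' :=
  (U.region_induction (Z := fun y => f y = f d) (fun y hy => (hf y).trans hy) h rfl).symm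

instance [Finite C] : Finite U.Region := Quotient.finite _

theorem card_region : Nat.card U.Region = Nat.card C + 1 := by
  have := U.euler
  unfold Region
  omega

end LinkoidUniverse

namespace LinkoidUniverse

variable {C : Type u} (U : LinkoidUniverse C)

/-! ### Heights and potentials on the sphere -/

theorem invariant_const (g : Dart C → ℚ) (he : ∀ d, g (U.edge d) = g d)
    (ht : ∀ d, g (Dart.turn C d) = g d) (d d' : Dart C) : g d = g d' :=
  (U.eq_tail_of_invariant g he ht d).trans (U.eq_tail_of_invariant g he ht d').symm

/-- On the sphere, an antisymmetric function on the darts with sum zero around every region is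
the coboundary of a function on the vertices. -/
theorem exists_potential [Fintype C] (w : Dart C → ℚ) (hw : ∀ d, w (U.edge d) = - w d)
    (hR : ∀ a : U.Region → ℚ, ∑ d, a (U.region d) * w d = 0) :
    ∃ g : Dart C → ℚ, (∀ d, g (Dart.turn C d) = g d) ∧ ∀ d, g (U.edge d) - g d = w d := by
  obtain ⟨Q, q, hq, hqα, -, hQ⟩ := exists_orbits_of_involution U.edge U.edge_edge U.edge_ne
  have := Fintype.ofFinite U.Region
  have : Nonempty (Dart C) := ⟨Dart.tail⟩
  have hreg := U.card_region
  rw [Nat.card_eq_fintype_card, Nat.card_eq_fintype_card] at hreg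
  have hinv : ∀ d, facePerm U.edge (U.edge (Dart.turn C d)) = d := fun d => by
    rw [U.facePerm_edge]; simp
  obtain ⟨g, hg⟩ := (euler_inequality_and_exactness U.edge (facePerm U.edge) hq
    U.region_surjective Dart.vertex_surjective hqα U.region_facePerm
    (fun d => by rw [← U.edge_turn_facePerm, Dart.vertex_turn])
    (fun g h1 h2 => U.invariant_const g h1 fun d => by
      rw [← h1 (Dart.turn C d), ← h2, hinv])).2
    (by rw [hreg, Dart.card_eq, Fintype.card_sum, Fintype.card_bool]
        rw [Dart.card_eq] at hQ
        omega) w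
    (fun a => by
      have h := Equiv.sum_comp U.edge (fun d => a (q d) * w d)
      simp only [hqα, hw, mul_neg, Finset.sum_neg_distrib] at h
      linarith) hR
  exact ⟨fun d => g d.vertex, fun d => by simp, fun d => (hg d).symm⟩

open Classical in
/-- On the sphere, let the corners `i c` and `j c`, for the crossings `c` in `A`, be distributed in the
same way over the regions. Then there is a height of the edges that increases by `1` (counterclockwise
around `c`) across the corner `i c` and decreases by `1` across `j c`, for `c` in `A`, and changes at
no other corner. -/
theorem exists_height [Finite C] (A : Set C) (i j : C → ZMod 4) (f : C → C) (hf : Set.BijOn f A A)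
    (hij : ∀ c ∈ A, U.corner c (j c) = U.corner (f c) (i (f c))) :
    ∃ h : Dart C → ℚ, (∀ d, h (U.edge d) = h d) ∧
      ∀ c k, h (Dart.half c (k + 1)) - h (Dart.half c k) =
        if c ∈ A then (if k = i c then 1 else 0) - (if k = j c then 1 else 0) else 0 := by
  cases nonempty_fintype C
  obtain ⟨Q, q, hq, hqα, hqq, hQ⟩ := exists_orbits_of_involution U.edge U.edge_edge U.edge_ne
  have := Fintype.ofFinite U.Region
  have : Nonempty (Dart C) := ⟨Dart.tail⟩
  have hreg := U.card_region
  rw [Nat.card_eq_fintype_card, Nat.card_eq_fintype_card] at hreg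
  let w : Dart C → ℚ := fun d => match d with
    | Dart.tail => 0
    | Dart.head => 0
    | Dart.half c k =>
        if c ∈ A then (if k = i c then 1 else 0) - (if k = j c then 1 else 0) else 0
  obtain ⟨g, hg⟩ := (euler_inequality_and_exactness (Dart.turn C) (U.edge * Dart.turn C)
    Dart.vertex_surjective U.region_surjective hq Dart.vertex_turn U.region_edge_turn
    (fun d => (hqα _).symm)
    (fun g h1 h2 => U.invariant_const g (fun d => by
      have := h2 ((Dart.turn C)⁻¹ d)
      rw [← h1 ((Dart.turn C)⁻¹ d)] at this
      simpa using this) h1)).2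
    (by rw [hreg, Dart.card_eq, Fintype.card_sum, Fintype.card_bool]
        rw [Dart.card_eq] at hQ
        omega) w
    (fun a => by
      rw [Dart.sum_eq]
      simp only [w, Dart.vertex_half, mul_zero, add_zero, zero_add]
      refine Finset.sum_eq_zero fun c _ => ?_
      rw [← Finset.mul_sum]
      split_ifs <;> simp)
    (fun a => by
      rw [Dart.sum_eq]
      simp only [w, mul_zero, add_zero, zero_add]
      have h : ∑ c, (if c ∈ A then a (U.corner c (i c)) else 0) =
          ∑ c, (if c ∈ A then a (U.corner c (j c)) else 0) := by
        rw [← Finset.sum_filter, ← Finset.sum_filter]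
        symm
        refine Finset.sum_bij (fun c _ => f c) (fun c hc => ?_) (fun c hc c' hc' e => ?_)
          (fun c hc => ?_) (fun c hc => ?_)
        · simpa using hf.mapsTo (by simpa using hc)
        · exact hf.injOn (by simpa using hc) (by simpa using hc') e
        · obtain ⟨c', hc', e⟩ := hf.surjOn (by simpa using hc : c ∈ A)
          exact ⟨c', by simpa using hc', e⟩
        · rw [hij c (by simpa using hc)]
      rw [← sub_eq_zero, ← Finset.sum_sub_distrib] at h
      refine (Finset.sum_congr rfl fun c _ => ?_).trans h
      by_cases hc : c ∈ A
      · simp [hc, mul_sub, corner]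
      · simp [hc])
  exact ⟨fun d => g (q d), fun d => by simp [hqα], fun c k => (hg (Dart.half c k)).symm⟩

/-! ### Parity -/

/-- A set `T` of vertices contains an even number of ends of edges that lie within `T`; the other
half-edges at `T` are counted here. -/
theorem parity [Fintype C] (e : Dart C → Dart C) (he : ∀ d, e (e d) = d) (hne : ∀ d, e d ≠ d)
    (T : Dart C → Prop) [DecidablePred T]
    (hT : ∀ d, T (Dart.turn C d) ↔ T d) :
    ((Finset.univ.filter fun d => T d ∧ ¬ T (e d)).card : ZMod 2) =
      (if T Dart.tail then 1 else 0) + (if T Dart.head then 1 else 0) := by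
  classical
  have h1 : ∑ d, (if T d then 1 else 0 : ZMod 2) =
      (if T Dart.tail then 1 else 0) + (if T Dart.head then 1 else 0) := by
    rw [Dart.sum_eq, add_eq_left]
    refine Finset.sum_eq_zero fun c _ => ?_
    have h : ∀ i, (if T (Dart.half c i) then 1 else 0 : ZMod 2) =
        if T (Dart.half c 0) then 1 else 0 := fun i =>
      Dart.half_eq_of_turn (f := fun d => if T d then (1 : ZMod 2) else 0) (by simp [hT]) c i 0
    rw [Finset.sum_congr rfl fun i _ => h i, Finset.sum_const]
    split_ifs <;> decide
  have h2 : ∑ d, (if T d ∧ T (e d) then 1 else 0 : ZMod 2) = 0 := by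
    refine Finset.sum_involution (fun d _ => e d) (fun d _ => ?_) (fun d _ _ => hne d)
      (fun _ _ => Finset.mem_univ _) (fun d _ => he d)
    rw [he]
    by_cases a : T d <;> by_cases b : T (e d) <;> simp only [a, b] <;> decide
  rw [← h1, Finset.card_filter, Nat.cast_sum]
  refine ((add_zero _).symm.trans (congrArg (_ + ·) h2.symm)).trans ?_
  rw [← Finset.sum_add_distrib]
  refine Finset.sum_congr rfl fun d _ => ?_
  by_cases a : T d <;> by_cases b : T (e d) <;> simp [a, b]

theorem tail_iff_head_of_closed [Finite C] (e : Dart C → Dart C) (he : ∀ d, e (e d) = d)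
    (hne : ∀ d, e d ≠ d) (T : Dart C → Prop) (hT : ∀ d, T (Dart.turn C d) ↔ T d)
    (h : ∀ d, T d → T (e d)) :
    T Dart.tail ↔ T Dart.head := by
  classical
  cases nonempty_fintype C
  have := parity e he hne T hT
  rw [Finset.filter_false_of_mem fun d _ => by simpa using h d] at this
  by_cases a : T Dart.tail <;> by_cases b : T Dart.head <;> simp [a, b] at this ⊢

theorem tail_iff_not_head_of_one [Finite C] (T : Dart C → Prop)
    (hT : ∀ d, T (Dart.turn C d) ↔ T d) (b : Dart C) (h : ∀ d, T d ∧ ¬ T (U.edge d) ↔ d = b) :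
    T Dart.tail ↔ ¬ T Dart.head := by
  classical
  cases nonempty_fintype C
  have := parity U.edge U.edge_edge U.edge_ne T hT
  have hf : (Finset.univ.filter fun d => T d ∧ ¬ T (U.edge d)) = {b} := by
    ext d; simp [h]
  rw [hf, Finset.card_singleton] at this
  by_cases a : T Dart.tail <;> by_cases b : T Dart.head <;> simp [a, b] at this ⊢

theorem tail_iff_head_of_two [Finite C] (T : Dart C → Prop)
    (hT : ∀ d, T (Dart.turn C d) ↔ T d) (b b' : Dart C) (hb : b ≠ b')
    (h : ∀ d, T d ∧ ¬ T (U.edge d) ↔ d = b ∨ d = b') : T Dart.tail ↔ T Dart.head := by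
  classical
  cases nonempty_fintype C
  have := parity U.edge U.edge_edge U.edge_ne T hT
  have hf : (Finset.univ.filter fun d => T d ∧ ¬ T (U.edge d)) = {b, b'} := by
    ext d; simp [h]
  rw [hf, Finset.card_pair hb] at this
  by_cases a : T Dart.tail <;> by_cases b : T Dart.head <;> simp [a, b] at this ⊢ <;>
    exact absurd this (by decide)

/-- A region whose boundary leaves a set of vertices also enters it. -/
theorem exists_return [Finite C] {T : Dart C → Prop} (hT : ∀ d, T (Dart.turn C d) ↔ T d)
    {d : Dart C} (hd : T d) (hd' : ¬ T (U.edge d)) :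
    ∃ y, U.region y = U.region d ∧ ¬ T y ∧ T (U.edge y) := by
  have hφ : ∀ d, T (facePerm U.edge d) ↔ T (U.edge d) := fun d => by
    rw [← U.edge_turn_facePerm, hT]
  obtain ⟨y, hy, h1, h2⟩ := U.exists_enter (Z := T) (d := facePerm U.edge d) (d' := d)
    (U.region_facePerm d) (by rwa [hφ]) hd
  exact ⟨y, hy.trans (U.region_facePerm d), h1, (hφ y).1 h2⟩

end LinkoidUniverse

/-- A self-map of a nonempty finite set is bijective on some nonempty subset. -/
theorem exists_bijOn_of_mapsTo {C : Type*} [Finite C] (f : C → C) (B : Set C) (hB : B.Nonempty)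
    (hf : Set.MapsTo f B B) : ∃ A ⊆ B, A.Nonempty ∧ Set.BijOn f A A := by
  obtain ⟨A, ⟨hAB, hA, hfA⟩, hmin⟩ :=
    (Set.toFinite {A : Set C | A ⊆ B ∧ A.Nonempty ∧ Set.MapsTo f A A}).exists_minimal
      ⟨B, subset_rfl, hB, hf⟩
  have hsub : f '' A ⊆ A := hfA.image_subset
  have hsurj : A ⊆ f '' A := hmin ⟨hsub.trans hAB, hA.image f, fun c hc =>
    ⟨c, hsub hc, rfl⟩⟩ hsub
  refine ⟨A, hAB, hA, hfA, ?_, hsurj⟩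
  exact Set.injOn_of_ncard_image_eq (by rw [Set.Subset.antisymm hsub hsurj])

namespace LinkoidUniverse

variable {C : Type u} (U : LinkoidUniverse C)

/-! ### States and moves -/

variable {U} in
theorem IsState.injective {s : Marking C} (hs : U.IsState s) {c c' : C}
    (h : U.corner c (s c) = U.corner c' (s c')) : c = c' :=
  (hs.2 _ (hs.1 c')).unique h rfl

/-- As there are as many crossings as unstarred regions, injectivity is enough for a state. -/
theorem isState_of_injective [Finite C] {s : Marking C} (h0 : ∀ c, U.corner c (s c) ≠ U.star)
    (h : ∀ c c', U.corner c (s c) = U.corner c' (s c') → c = c') : U.IsState s := by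
  refine ⟨h0, fun R hR => ?_⟩
  cases nonempty_fintype C
  have := Fintype.ofFinite U.Region
  classical
  let f : C → {R : U.Region // R ≠ U.star} := fun c => ⟨U.corner c (s c), h0 c⟩
  have hf : Function.Bijective f := by
    rw [Fintype.bijective_iff_injective_and_card]
    refine ⟨fun c c' e => h c c' (congrArg Subtype.val e), ?_⟩
    have := U.card_region
    rw [Nat.card_eq_fintype_card, Nat.card_eq_fintype_card] at this
    rw [Fintype.card_subtype_compl, Fintype.card_subtype_eq, this]
    rfl
  obtain ⟨c, hc⟩ := hf.2 ⟨R, hR⟩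
  exact ⟨c, congrArg Subtype.val hc, fun c' hc' => h _ _ (hc'.trans (congrArg Subtype.val hc).symm)⟩

variable {U} in
/-- A move leads from a state to a state, because the occupied regions remain the same. -/
theorem IsState.of_move [Finite C] {t : Sense} {s s' : Marking C} (hs : U.IsState s)
    (h : U.IsDoubleMove t s s' ∨ U.IsHeadMove t s s') : U.IsState s' := by
  obtain ⟨f, hf, hfs⟩ : ∃ f : C → C, Function.Injective f ∧
      ∀ c, U.corner c (s' c) = U.corner (f c) (s (f c)) := by
    classical
    rcases h with ⟨c₁, c₂, hne, -, -, hc, h1, h2⟩ | ⟨c₁, -, hc, h1⟩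
    · refine ⟨Equiv.swap c₁ c₂, (Equiv.swap c₁ c₂).injective, fun c => ?_⟩
      by_cases e1 : c = c₁
      · subst e1; rw [Equiv.swap_apply_left, h1]
      by_cases e2 : c = c₂
      · subst e2; rw [Equiv.swap_apply_right, h2]
      rw [Equiv.swap_apply_of_ne_of_ne e1 e2, hc c e1 e2]
    · refine ⟨id, fun _ _ h => h, fun c => ?_⟩
      by_cases e : c = c₁
      · subst e; exact h1
      · rw [hc c e]; rfl
  refine U.isState_of_injective (fun c => ?_) fun c c' e => hf (hs.injective ?_)
  · rw [hfs]; exact hs.1 _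
  · rw [← hfs, ← hfs, e]

/-- A move is available as soon as two markers, or one, can exchange regions by quarter turns. -/
theorem exists_move_of_exchange [Finite C] {t : Sense} {s : Marking C} (hs : U.IsState s) {c₁ c₂ : C}
    (h1 : U.corner c₁ (s c₁ + t.step) = U.corner c₂ (s c₂))
    (h2 : U.corner c₂ (s c₂ + t.step) = U.corner c₁ (s c₁)) : ∃ s', U.IsClockMove t s s' := by
  classical
  by_cases h : c₁ = c₂
  · subst h
    have hm : U.IsHeadMove t s (Function.update s c₁ (s c₁ + t.step)) :=
      ⟨c₁, by simp, fun x hx => by simp [hx], by simpa using h1⟩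
    exact ⟨_, hs, hs.of_move (Or.inr hm), Or.inr hm⟩
  · have hm : U.IsDoubleMove t s
        (Function.update (Function.update s c₁ (s c₁ + t.step)) c₂ (s c₂ + t.step)) :=
      ⟨c₁, c₂, h, by simp [h], by simp, fun x hx hx' => by simp [hx, hx'],
        by simpa [h] using h1, by simpa [h] using h2⟩
    exact ⟨_, hs, hs.of_move (Or.inl hm), Or.inl hm⟩

end LinkoidUniverse

theorem zmod_four_cases (a b : ZMod 4) : b = a ∨ b = a + 1 ∨ b = a + 2 ∨ b = a + 3 := by
  revert a b; decide

namespace LinkoidUniverse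

variable {C : Type u} (U : LinkoidUniverse C)

/-! ### Cyclic exchanges contain a move -/

open Classical in
/-- Let half-edges `half c (i c)`, for `c` in a nonempty set `A`, be given such that the regions on
their left are the regions on their right, permuted, and let the crossings outside `A` have
markers in distinct other regions. Then one or two of these half-edges already exchange their
regions.

Cut the half-edges at `c ∈ A` off from their crossings, and consider a component at the top level of
the associated height. It consists of `v` uncut crossings and `q` tips; the `v` markers lie in
`v` different faces of it, and there is a further face at the tips. Euler's inequality leaves
only `q ≤ 2`. -/
theorem exists_exchange_of_cycle [Finite C] {s : Marking C} (hs : U.IsState s) (A : Set C)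
    (hA : A.Nonempty) (i : C → ZMod 4) (f : C → C) (hf : Set.BijOn f A A)
    (hlr : ∀ c ∈ A, U.corner c (i c) = U.corner (f c) (i (f c) - 1))
    (hinj : ∀ c ∈ A, ∀ c' ∈ A, U.corner c (i c) = U.corner c' (i c') → c = c')
    (hout : ∀ c ∉ A, ∀ a ∈ A, U.corner c (s c) ≠ U.corner a (i a)) :
    ∃ c₁ ∈ A, ∃ c₂ ∈ A, U.corner c₁ (i c₁) = U.corner c₂ (i c₂ - 1) ∧
      U.corner c₂ (i c₂) = U.corner c₁ (i c₁ - 1) := by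
  cases nonempty_fintype C
  obtain ⟨h, hedge, hjump⟩ := U.exists_height A (fun c => i c - 1) i f hf hlr
  have hconst : ∀ c ∉ A, ∀ k, h (Dart.half c (k + 1)) = h (Dart.half c k) := fun c hc k => by
    have := hjump c k
    rw [if_neg hc] at this
    linarith
  have hother : ∀ c ∈ A, ∀ k, k ≠ i c → h (Dart.half c k) = h (Dart.half c (i c)) - 1 := by
    intro c hc k hk
    have j1 := hjump c (i c)
    have j2 := hjump c (i c + 1)
    have j3 := hjump c (i c + 2)
    rw [if_pos hc] at j1 j2 j3
    have e1 : i c ≠ i c - 1 := by generalize i c = a; revert a; decide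
    have e2 : i c + 1 ≠ i c - 1 := by generalize i c = a; revert a; decide
    have e3 : i c + 2 ≠ i c - 1 := by generalize i c = a; revert a; decide
    have e4 : i c + 1 ≠ i c := by generalize i c = a; revert a; decide
    have e5 : i c + 2 ≠ i c := by generalize i c = a; revert a; decide
    simp only [e1, e2, e3, e4, e5, if_true, if_false, add_assoc] at j1 j2 j3
    norm_num at j1 j2 j3
    rcases zmod_four_cases (i c) k with rfl | rfl | rfl | rfl
    · exact absurd rfl hk
    all_goals linarith
  obtain ⟨m, -, hm⟩ := Finset.exists_max_image (Finset.univ : Finset (Dart C)) h ⟨Dart.tail, by simp⟩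
  replace hm : ∀ d, h d ≤ h m := fun d => hm d (Finset.mem_univ d)
  -- some tip lies at the top level
  obtain ⟨c₀, hc₀, hc₀m⟩ : ∃ c ∈ A, h (Dart.half c (i c)) = h m := by
    by_contra! hcon
    have hall : ∀ d, (if h d = h m then 1 else 0 : ℚ) = 1 := by
      intro d
      rw [U.invariant_const (fun d => if h d = h m then 1 else 0 : Dart C → ℚ) (by simp [hedge])
        (fun d => ?_) d m]
      · simp
      · cases d with
        | tail => rfl
        | head => rfl
        | half c k =>
          by_cases hc : c ∈ A
          · have hlow : ∀ k, h (Dart.half c k) ≠ h m := by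
              intro k
              have := lt_of_le_of_ne (hm _) (hcon c hc)
              by_cases hk : k = i c
              · rw [hk]; exact this.ne
              · rw [hother c hc k hk]; linarith
            simp [hlow]
          · simp [hconst c hc]
    obtain ⟨c, hc⟩ := hA
    have := hall (Dart.half c (i c))
    simp [hcon c hc] at this
  -- the rotation after cutting off the half-edges at `A`, and the component `T` of a top tip
  let x : Dart C → Dart C := fun d => match d with
    | Dart.tail => Dart.tail
    | Dart.head => Dart.head
    | Dart.half c k => if c ∈ A then Dart.half c k else Dart.half c (k + 1)
  have hx : Function.Injective x := by
    have hv : ∀ d, (x d).vertex = d.vertex := by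
      rintro (_ | _ | ⟨c, k⟩)
      · rfl
      · rfl
      · by_cases hc : c ∈ A <;> simp [x, hc]
    intro a b hab
    have hvv := (hv a).symm.trans ((congrArg Dart.vertex hab).trans (hv b))
    cases a <;> cases b <;> simp at hvv <;> try rfl
    subst hvv
    rename_i c k k'
    by_cases hc : c ∈ A <;> simpa [x, hc] using hab
  let T : Finset (Dart C) := Finset.univ.filter fun d =>
    Relation.ReflTransGen (fun a b => b = U.edge a ∨ b = x a) (Dart.half c₀ (i c₀)) d
  have hT : ∀ d, d ∈ T ↔
      Relation.ReflTransGen (fun a b => b = U.edge a ∨ b = x a) (Dart.half c₀ (i c₀)) d := by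
    simp [T]
  have hTe : ∀ d ∈ T, U.edge d ∈ T := fun d hd => (hT _).2 (((hT d).1 hd).tail (Or.inl rfl))
  have hTx : ∀ d ∈ T, x d ∈ T := fun d hd => (hT _).2 (((hT d).1 hd).tail (Or.inr rfl))
  have hTh : ∀ d ∈ T, h d = h m := by
    intro d hd
    induction (hT d).1 hd with
    | refl => exact hc₀m
    | @tail b _ hab hb ih =>
      have ih' := ih ((hT _).2 hab)
      rcases hb with rfl | rfl
      · rw [hedge, ih']
      · rw [← ih']
        rcases b with _ | _ | ⟨c, k⟩
        · rfl
        · rfl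
        · by_cases hc : c ∈ A <;> simp [x, hc, hconst]
  -- at the top level only the tips are left of the crossings in `A`
  have hTA : ∀ c ∈ A, ∀ k, Dart.half c k ∈ T → k = i c := by
    intro c hc k hk
    by_contra hne
    have h1 := hTh _ hk
    rw [hother c hc k hne] at h1
    have := hm (Dart.half c (i c))
    linarith
  have hTfull : ∀ c ∉ A, ∀ k k', Dart.half c k ∈ T → Dart.half c k' ∈ T := by
    intro c hc k k' hk
    have step : ∀ k, Dart.half c k ∈ T → Dart.half c (k + 1) ∈ T := fun k hk => by
      have := hTx _ hk
      simpa [x, hc] using this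
    have s1 := step _ hk
    have s2 := step _ s1
    have s3 := step _ s2
    rcases zmod_four_cases k k' with rfl | rfl | rfl | rfl
    · exact hk
    · exact s1
    · have : k + 2 = k + 1 + 1 := by ring
      rwa [this]
    · have : k + 3 = k + 1 + 1 + 1 := by ring
      rwa [this]
  -- faces of the component: the region of a marker outside `A` is labelled by its crossing, and all
  -- other regions, in particular those at the tips, are not distinguished
  let l : Dart C → Option C := fun d =>
    if hd : ∃ c, c ∉ A ∧ U.corner c (s c) = U.region d then some hd.choose else none
  have hlnone : ∀ d, ∀ a ∈ A, U.region d = U.corner a (i a) → l d = none := by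
    intro d a ha hd
    simp only [l]
    rw [dif_neg]
    rintro ⟨c, hc, e⟩
    exact hout c hc a ha (e.trans hd)
  have hlsome : ∀ c ∉ A, l (Dart.half c (s c)) = some c := by
    intro c hc
    have hd : ∃ c', c' ∉ A ∧ U.corner c' (s c') = U.region (Dart.half c (s c)) := ⟨c, hc, rfl⟩
    simp only [l]
    rw [dif_pos hd]
    exact congrArg some (hs.injective hd.choose_spec.2)
  have hright : ∀ a ∈ A, ∃ a' ∈ A, U.corner a (i a - 1) = U.corner a' (i a') := by
    intro a ha
    obtain ⟨a', ha', rfl⟩ := hf.surjOn ha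
    exact ⟨a', ha', (hlr a' ha').symm⟩
  have key := orbit_euler_inequality x U.edge hx U.edge_edge U.edge_ne T _ hT Dart.vertex l
    (by rintro (_ | _ | ⟨c, k⟩) -
        · rfl
        · rfl
        · by_cases hc : c ∈ A <;> simp [x, hc])
    (by rintro (_ | _ | ⟨c, k⟩) hd
        · have : U.region (U.edge (x Dart.tail)) = U.region Dart.tail := U.region_edge_tail
          simp only [l, this]
        · have : U.region (U.edge (x Dart.head)) = U.region Dart.head := U.region_edge_head
          simp only [l, this]
        · by_cases hc : c ∈ A
          · obtain rfl := hTA c hc k hd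
            obtain ⟨a', ha', e⟩ := hright c hc
            rw [hlnone _ a' ha', hlnone _ c hc rfl]
            simp only [x, hc, if_true]
            rw [U.region_edge_half, e]
          · have : U.region (U.edge (x (Dart.half c k))) = U.region (Dart.half c k) := by
              simp only [x, hc, if_false]
              exact U.region_edge_turn (Dart.half c k)
            simp only [l, this])
  let F : Finset C := Finset.univ.filter fun c => c ∉ A ∧ Dart.half c 0 ∈ T
  let A₀ : Finset C := Finset.univ.filter fun c => c ∈ A ∧ Dart.half c (i c) ∈ T
  -- `v = |F|` uncut crossings and `q = |A₀|` tips
  have hcardl : F.card + 1 ≤ (T.image l).card := by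
    have : (insert none (F.image some)) ⊆ T.image l := by
      intro o ho
      rcases Finset.mem_insert.1 ho with rfl | ho
      · exact Finset.mem_image.2 ⟨_, (hT _).2 Relation.ReflTransGen.refl, hlnone _ c₀ hc₀ rfl⟩
      · obtain ⟨c, hc, rfl⟩ := Finset.mem_image.1 ho
        simp only [F, Finset.mem_filter, Finset.mem_univ, true_and] at hc
        exact Finset.mem_image.2 ⟨_, hTfull c hc.1 0 (s c) hc.2, hlsome c hc.1⟩
    have := Finset.card_le_card this
    rwa [Finset.card_insert_of_notMem (by simp),
      Finset.card_image_of_injective _ (Option.some_injective C)] at this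
  have hcardv : F.card + A₀.card ≤ (T.image Dart.vertex).card := by
    rw [← Finset.card_union_of_disjoint (by
      rw [Finset.disjoint_left]
      intro c hc hc'
      simp only [F, A₀, Finset.mem_filter, Finset.mem_univ, true_and] at hc hc'
      exact hc.1 hc'.1), ← Finset.card_image_of_injective _ (Sum.inr_injective (α := Bool))]
    refine Finset.card_le_card fun v hv => ?_
    obtain ⟨c, hc, rfl⟩ := Finset.mem_image.1 hv
    simp only [F, A₀, Finset.mem_union, Finset.mem_filter, Finset.mem_univ, true_and] at hc
    rcases hc with hc | hc
    exacts [Finset.mem_image.2 ⟨_, hc.2, rfl⟩, Finset.mem_image.2 ⟨_, hc.2, rfl⟩]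
  have hcardT : T.card ≤ (T.image Dart.vertex).card + 3 * F.card := by
    rw [Finset.card_eq_sum_card_image Dart.vertex T]
    have hb : ∀ v ∈ T.image Dart.vertex, (T.filter fun d => d.vertex = v).card ≤
        1 + if v ∈ F.image Sum.inr then 3 else 0 := by
      intro v hv
      obtain ⟨d, hd, rfl⟩ := Finset.mem_image.1 hv
      by_cases hF : d.vertex ∈ F.image Sum.inr
      · obtain ⟨c, -, hcd⟩ := Finset.mem_image.1 hF
        rw [if_pos hF]
        have : (T.filter fun e => e.vertex = d.vertex) ⊆
            (Finset.univ : Finset (ZMod 4)).image (Dart.half c) := by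
          intro e he
          have he := (Finset.mem_filter.1 he).2
          rw [← hcd] at he
          cases e with
          | tail => simp at he
          | head => simp at he
          | half c' k => simp at he; simp [he]
        exact (Finset.card_le_card this).trans Finset.card_image_le
      · rw [if_neg hF]
        refine Finset.card_le_one.2 fun a ha b hb => ?_
        obtain ⟨haT, ha⟩ := Finset.mem_filter.1 ha
        obtain ⟨hbT, hb⟩ := Finset.mem_filter.1 hb
        have hab := ha.trans hb.symm
        rcases a with _ | _ | ⟨c, k⟩ <;> rcases b with _ | _ | ⟨c', k'⟩ <;> simp at hab <;> try rfl
        subst hab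
        have hc : c ∈ A := by
          by_contra hc
          refine hF (Finset.mem_image.2 ⟨c, ?_, by rw [← ha]; rfl⟩)
          simp only [F, Finset.mem_filter, Finset.mem_univ, true_and]
          exact ⟨hc, hTfull c hc _ _ haT⟩
        rw [hTA c hc k haT, hTA c hc k' hbT]
    refine (Finset.sum_le_sum hb).trans ?_
    rw [Finset.sum_add_distrib, Finset.sum_const, ← Finset.sum_filter, Finset.sum_const]
    have : ((T.image Dart.vertex).filter fun v => v ∈ F.image Sum.inr).card ≤ F.card :=
      (Finset.card_le_card fun v hv => (Finset.mem_filter.1 hv).2).trans Finset.card_image_le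
    simp only [smul_eq_mul]
    omega
  have hA₀ : A₀.card ≤ 2 := by omega
  -- going around the region on the left of a tip, one leaves the component at a tip of which it
  -- is the region on the right
  have hnext : ∀ c ∈ A₀, ∃ c' ∈ A₀, U.corner c (i c) = U.corner c' (i c' - 1) := by
    intro c hc
    simp only [A₀, Finset.mem_filter, Finset.mem_univ, true_and] at hc
    obtain ⟨hc, hcT⟩ := hc
    have h1 : U.region (Dart.half c (i c)) = U.region (U.edge (Dart.half c (i c + 1))) :=
      (U.region_edge_turn (Dart.half c (i c))).symm
    have h2 : U.edge (Dart.half c (i c + 1)) ∉ T := by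
      intro hmem
      have := hTe _ hmem
      rw [U.edge_edge] at this
      have := hTA c hc _ this
      revert this
      generalize i c = a
      revert a; decide
    obtain ⟨y, hy, hyT, hyT'⟩ := U.exists_enter (Z := fun d => d ∉ T) h1 (by simpa using hcT) h2
    have hyT := hTe _ (not_not.1 hyT)
    have hφ : facePerm U.edge y = (Dart.turn C)⁻¹ (U.edge y) := rfl
    rw [← U.region_facePerm, hφ] at hy
    rw [hφ] at hyT'
    generalize U.edge y = e at hy hyT hyT'
    rcases e with _ | _ | ⟨c', k⟩
    · exact absurd hyT hyT'
    · exact absurd hyT hyT'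
    · by_cases hc' : c' ∈ A
      · obtain rfl := hTA c' hc' k hyT
        refine ⟨c', ?_, hy.symm⟩
        simp only [A₀, Finset.mem_filter, Finset.mem_univ, true_and]
        exact ⟨hc', hyT⟩
      · exact absurd (hTfull c' hc' _ _ hyT) hyT'
  have hmemA : ∀ c ∈ A₀, c ∈ A := fun c hc => (Finset.mem_filter.1 hc).2.1
  have hc₀A : c₀ ∈ A₀ := by
    simp only [A₀, Finset.mem_filter, Finset.mem_univ, true_and]
    exact ⟨hc₀, (hT _).2 Relation.ReflTransGen.refl⟩
  -- three steps from tip to tip return to the first or second tip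
  obtain ⟨c₁, hc₁, e₁⟩ := hnext c₀ hc₀A
  obtain ⟨c₂, hc₂, e₂⟩ := hnext c₁ hc₁
  refine ⟨c₀, hc₀, c₁, hmemA _ hc₁, e₁, ?_⟩
  by_cases h01 : c₁ = c₀
  · subst h01; exact e₁
  by_cases h20 : c₂ = c₀
  · subst h20; exact e₂
  by_cases h21 : c₂ = c₁
  · subst h21
    exact absurd (hinj _ hc₀ _ (hmemA _ hc₁) (e₁.trans e₂.symm)).symm h01
  have : ({c₀, c₁, c₂} : Finset C).card = 3 := by
    rw [Finset.card_eq_three]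
    exact ⟨c₀, c₁, c₂, fun h => h01 h.symm, fun h => h20 h.symm, fun h => h21 h.symm, rfl⟩
  have hsub : ({c₀, c₁, c₂} : Finset C) ⊆ A₀ := by
    intro c hc
    simp only [Finset.mem_insert, Finset.mem_singleton] at hc
    rcases hc with rfl | rfl | rfl <;> assumption
  have := Finset.card_le_card hsub
  omega

end LinkoidUniverse

namespace LinkoidUniverse

variable {C : Type u} (U : LinkoidUniverse C)

/-! ### Uniqueness of extreme states -/

/-- A cyclic exchange of regions by quarter turns in one sense contains a move in this sense. -/
theorem exists_move_of_cycle [Finite C] (t : Sense) {s : Marking C} (hs : U.IsState s) {A : Set C}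
    (hA : A.Nonempty) {f : C → C} (hf : Set.BijOn f A A)
    (h : ∀ c ∈ A, U.corner c (s c + t.step) = U.corner (f c) (s (f c))) :
    ∃ s', U.IsClockMove t s s' := by
  have hout : ∀ c ∉ A, ∀ a ∈ A, U.corner c (s c) ≠ U.corner a (s a) := fun c hc a ha e =>
    hc (hs.injective e ▸ ha)
  cases t with
  | counterclockwise =>
    simp only [Sense.step] at h
    obtain ⟨c₁, -, c₂, -, h1, h2⟩ := U.exists_exchange_of_cycle hs A hA (fun c => s c + 1) f hf
      (fun c hc => by simpa using h c hc)
      (fun c hc c' hc' e => hf.injOn hc hc' (hs.injective (by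
        rw [← h c hc, ← h c' hc']; exact e)))
      (fun c hc a ha => by rw [h a ha]; exact hout c hc _ (hf.mapsTo ha))
    exact U.exists_move_of_exchange hs (c₁ := c₁) (c₂ := c₂)
      (by simpa [Sense.step] using h1) (by simpa [Sense.step] using h2)
  | clockwise =>
    have : Nonempty C := hA.to_type
    have hinv := hf.invOn_invFunOn
    have hg := hf.symm hinv.symm
    obtain ⟨c₁, -, c₂, -, h1, h2⟩ := U.exists_exchange_of_cycle hs A hA s
      (Function.invFunOn f A) hg
      (fun c hc => by
        have := h _ (hg.mapsTo hc)
        rw [hinv.2 hc] at this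
        rw [← this]
        simp [Sense.step, sub_eq_add_neg])
      (fun c _ c' _ e => hs.injective e) hout
    exact U.exists_move_of_exchange hs (c₁ := c₁) (c₂ := c₂)
      (by simpa [Sense.step, sub_eq_add_neg] using h2.symm)
      (by simpa [Sense.step, sub_eq_add_neg] using h1.symm)

open Classical in
/-- The height that compares two states. -/
theorem exists_height_of_states [Finite C] {s s' : Marking C} (hs : U.IsState s)
    (hs' : U.IsState s') : ∃ h : Dart C → ℚ, (∀ d, h (U.edge d) = h d) ∧
      ∀ c k, h (Dart.half c (k + 1)) - h (Dart.half c k) =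
        (if k = s c then 1 else 0) - (if k = s' c then 1 else 0) := by
  choose f hf using fun c => (hs.2 _ (hs'.1 c)).exists
  have hinj : Function.Injective f := fun c c' e => hs'.injective (by rw [← hf, ← hf, e])
  obtain ⟨h, h1, h2⟩ := U.exists_height Set.univ s s' f
    ((Finite.injective_iff_bijective.1 hinj).bijOn_univ) (fun c _ => (hf c).symm)
  exact ⟨h, h1, by simpa using h2⟩

open Classical in
/-- If the height that compares `s` with `s'` exceeds its value at the tail, then at its top level
the markers of `s` chase each other counterclockwise, and those of `s'` clockwise; as they cannot
escape to the starred region, both admit a move. -/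
theorem exists_moves_of_height [Finite C] {s s' : Marking C} (hs : U.IsState s) (hs' : U.IsState s')
    {h : Dart C → ℚ} (hedge : ∀ d, h (U.edge d) = h d)
    (hjump : ∀ c k, h (Dart.half c (k + 1)) - h (Dart.half c k) =
      (if k = s c then 1 else 0) - (if k = s' c then 1 else 0)) {m : Dart C} (hm : ∀ d, h d ≤ h m)
    (htail : h Dart.tail < h m) :
    (∃ s₁, U.IsClockMove Sense.counterclockwise s s₁) ∧
    ∃ s₁, U.IsClockMove Sense.clockwise s' s₁ := by
  have hup : ∀ c k, h (Dart.half c k) < h (Dart.half c (k + 1)) → k = s c := by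
    intro c k hlt
    by_contra hne
    have := hjump c k
    rw [if_neg hne] at this
    split_ifs at this <;> linarith
  have hdown : ∀ c k, h (Dart.half c (k + 1)) < h (Dart.half c k) → k = s' c := by
    intro c k hlt
    by_contra hne
    have := hjump c k
    rw [if_neg hne] at this
    split_ifs at this <;> linarith
  have hφ : ∀ d, h (Dart.turn C (facePerm U.edge d)) = h d := fun d => by
    rw [U.edge_turn_facePerm, hedge]
  -- the height is constant on the boundary of the starred region
  have hstar : ∀ d, U.region d = U.star → h d = h Dart.tail := by
    intro d hd
    refine (U.region_induction (Z := fun d => U.region d = U.star ∧ h d = h Dart.tail) ?_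
      (d := Dart.tail) (d' := d) hd.symm ⟨rfl, rfl⟩).2
    rintro d ⟨hd, hhd⟩
    refine ⟨(U.region_facePerm d).trans hd, ?_⟩
    rw [← hhd, ← hφ d]
    rw [← U.region_facePerm] at hd
    generalize facePerm U.edge d = e at hd
    rcases e with _ | _ | ⟨c, k⟩
    · rfl
    · rfl
    · have h1 : k ≠ s c := fun e => hs.1 c (e ▸ hd)
      have h2 : k ≠ s' c := fun e => hs'.1 c (e ▸ hd)
      have := hjump c k
      rw [if_neg h1, if_neg h2] at this
      rw [Dart.turn_half]
      linarith
  have hnestar : ∀ d, h d = h m → U.region d ≠ U.star := fun d hd e => by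
    have := hstar d e
    linarith
  -- the top level is not closed under rotation, by connectedness
  have hnotall : ¬ ∀ d, (h (Dart.turn C d) = h m ↔ h d = h m) := by
    intro hall
    have := U.invariant_const (fun d => if h d = h m then 1 else 0 : Dart C → ℚ) (by simp [hedge])
      (fun d => by simp [hall d]) Dart.tail m
    rw [if_pos rfl, if_neg htail.ne] at this
    norm_num at this
  have h4 : ∀ d, Dart.turn C (Dart.turn C (Dart.turn C (Dart.turn C d))) = d := by
    rintro (_ | _ | ⟨c, k⟩)
    · rfl
    · rfl
    · simp only [Dart.turn_half]
      congr 1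
      generalize k = a
      revert a; decide
  constructor
  -- where the marker `s c` borders on the top level, so does the one in the region it moves to: the
  -- boundary of this region enters the top level at the marker of `s`, its only upward jump
  · have hstep : ∀ c, h (Dart.half c (s c + 1)) = h m →
        ∃ c', U.corner c (s c + 1) = U.corner c' (s c') ∧ h (Dart.half c' (s c' + 1)) = h m := by
      intro c hc
      obtain ⟨c', hc', -⟩ := hs.2 _ (hnestar _ hc)
      refine ⟨c', hc'.symm, ?_⟩
      by_cases hall : ∀ d, U.region d = U.corner c (s c + 1) → h d = h m
      · have h1 : h (Dart.half c' (s c')) = h m := hall _ hc'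
        have h2 := hjump c' (s c')
        have h3 := hm (Dart.half c' (s c' + 1))
        rw [if_pos rfl] at h2
        split_ifs at h2 <;> linarith
      · push Not at hall
        obtain ⟨d, hd, hdm⟩ := hall
        obtain ⟨y, hy, hym, hyφ⟩ := U.exists_enter (Z := fun d => h d ≠ h m)
          (d := Dart.half c (s c + 1)) (d' := d) hd.symm (by simpa using hc) hdm
        rw [not_not] at hym
        rw [← U.region_facePerm] at hy
        rw [← hφ y] at hym
        generalize facePerm U.edge y = e at hy hym hyφ
        rcases e with _ | _ | ⟨c'', k⟩
        · exact absurd hym hyφ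
        · exact absurd hym hyφ
        · rw [Dart.turn_half] at hym
          obtain rfl := hup c'' k (by rw [hym]; exact lt_of_le_of_ne (hm _) hyφ)
          obtain rfl := hs.injective (c := c'') (c' := c') (hy.trans hc'.symm)
          exact hym
    have hne : {c | h (Dart.half c (s c + 1)) = h m}.Nonempty := by
      by_contra hcon
      have hcon' : ∀ d, h (Dart.turn C d) = h m → h d = h m := by
        rintro (_ | _ | ⟨c, k⟩) hd
        · exact hd
        · exact hd
        · by_contra hk
          rw [Dart.turn_half] at hd
          obtain rfl := hup c k (by rw [hd]; exact lt_of_le_of_ne (hm _) hk)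
          exact hcon ⟨c, hd⟩
      refine hnotall fun d => ⟨hcon' d, fun hd => ?_⟩
      refine hcon' _ (hcon' _ (hcon' _ ?_))
      rwa [h4]
    choose! f hf1 hf2 using hstep
    obtain ⟨A, hAB, hA, hfA⟩ := exists_bijOn_of_mapsTo f _ hne hf2
    exact U.exists_move_of_cycle _ hs hA hfA fun c hc => hf1 c (hAB hc)
  -- likewise, a region's boundary leaves the top level at the marker of `s'` only
  · have hstep : ∀ c, h (Dart.half c (s' c)) = h m →
        ∃ c', U.corner c (s' c - 1) = U.corner c' (s' c') ∧ h (Dart.half c' (s' c')) = h m := by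
      intro c hc
      have hreg := U.region_edge_half c (s' c)
      rw [← hedge] at hc
      have hns := hnestar _ hc
      rw [hreg] at hns
      obtain ⟨c', hc', -⟩ := hs'.2 _ hns
      refine ⟨c', hc'.symm, ?_⟩
      by_contra hall
      obtain ⟨y, hy, hym, hyφ⟩ := U.exists_enter (Z := fun d => h d = h m)
        (d := Dart.half c' (s' c')) (d' := U.edge (Dart.half c (s' c))) (hc'.trans hreg.symm)
        hall hc
      rw [← U.region_facePerm] at hy
      rw [← hφ y] at hym
      generalize facePerm U.edge y = e at hy hym hyφ
      rcases e with _ | _ | ⟨c'', k⟩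
      · exact absurd hyφ hym
      · exact absurd hyφ hym
      · rw [Dart.turn_half] at hym
        obtain rfl := hdown c'' k (by rw [hyφ]; exact lt_of_le_of_ne (hm _) hym)
        obtain rfl := hs'.injective (c := c'') (c' := c') hy
        exact hall hyφ
    have hne : {c | h (Dart.half c (s' c)) = h m}.Nonempty := by
      by_contra hcon
      have hcon' : ∀ d, h d = h m → h (Dart.turn C d) = h m := by
        rintro (_ | _ | ⟨c, k⟩) hd
        · exact hd
        · exact hd
        · by_contra hk
          rw [Dart.turn_half] at hk
          obtain rfl := hdown c k (by rw [hd]; exact lt_of_le_of_ne (hm _) hk)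
          exact hcon ⟨c, hd⟩
      refine hnotall fun d => ⟨fun hd => ?_, hcon' d⟩
      rw [← h4 d]
      exact hcon' _ (hcon' _ (hcon' _ hd))
    choose! f hf1 hf2 using hstep
    obtain ⟨A, hAB, hA, hfA⟩ := exists_bijOn_of_mapsTo f _ hne hf2
    exact U.exists_move_of_cycle _ hs' hA hfA fun c hc => by
      simpa [Sense.step, sub_eq_add_neg] using hf1 c (hAB hc)

/-- Of two different states, one admits a counterclockwise move and the other a clockwise one. -/
theorem exists_moves_of_ne [Finite C] {s s' : Marking C} (hs : U.IsState s) (hs' : U.IsState s')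
    (hne : s ≠ s') :
    ((∃ s₁, U.IsClockMove Sense.counterclockwise s s₁) ∧
      ∃ s₁, U.IsClockMove Sense.clockwise s' s₁) ∨
    ((∃ s₁, U.IsClockMove Sense.counterclockwise s' s₁) ∧
      ∃ s₁, U.IsClockMove Sense.clockwise s s₁) := by
  classical
  cases nonempty_fintype C
  obtain ⟨h, hedge, hjump⟩ := U.exists_height_of_states hs hs'
  obtain ⟨m, -, hm⟩ := Finset.exists_max_image (Finset.univ : Finset (Dart C)) h ⟨Dart.tail, by simp⟩
  obtain ⟨m', -, hm'⟩ :=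
    Finset.exists_min_image (Finset.univ : Finset (Dart C)) h ⟨Dart.tail, by simp⟩
  by_cases h1 : h Dart.tail < h m
  · exact Or.inl (U.exists_moves_of_height hs hs' hedge hjump (fun d => hm d (by simp)) h1)
  by_cases h2 : h m' < h Dart.tail
  · refine Or.inr (U.exists_moves_of_height hs' hs (h := fun d => - h d) (m := m')
      (by simpa using hedge) (fun c k => ?_) (fun d => neg_le_neg (hm' d (by simp)))
      (neg_lt_neg h2))
    linarith [hjump c k]
  · exfalso
    have hc : ∀ d, h d = h Dart.tail := fun d =>
      le_antisymm ((hm d (by simp)).trans (not_lt.1 h1)) ((not_lt.1 h2).trans (hm' d (by simp)))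
    refine hne (funext fun c => ?_)
    have := hjump c (s c)
    rw [if_pos rfl] at this
    by_contra hcne
    rw [if_neg hcne] at this
    linarith [hc (Dart.half c (s c)), hc (Dart.half c (s c + 1))]

theorem isClocked_unique [Finite C] {s s' : Marking C} (hs : U.IsClocked s) (hs' : U.IsClocked s') :
    s = s' := by
  by_contra hne
  rcases U.exists_moves_of_ne hs.1 hs'.1 hne with ⟨⟨s₁, h⟩, -⟩ | ⟨⟨s₁, h⟩, -⟩
  exacts [hs.2 _ h, hs'.2 _ h]

theorem isCounterClocked_unique [Finite C] {s s' : Marking C} (hs : U.IsCounterClocked s)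
    (hs' : U.IsCounterClocked s') : s = s' := by
  by_contra hne
  rcases U.exists_moves_of_ne hs.1 hs'.1 hne with ⟨-, s₁, h⟩ | ⟨-, s₁, h⟩
  exacts [hs'.2 _ h, hs.2 _ h]

end LinkoidUniverse

namespace LinkoidUniverse

variable {C : Type u} (U : LinkoidUniverse C)

/-! ### States determine trails -/

theorem smoothing_half (s : Marking C) (c : C) (k : ZMod 4) :
    smoothing s (Dart.half c k) = Dart.half c (2 * s c + 3 - k) := rfl

theorem smoothing_smoothing (s : Marking C) (d : Dart C) : smoothing s (smoothing s d) = d := by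
  rcases d with _ | _ | ⟨c, k⟩
  · rfl
  · rfl
  · simp [smoothing_half]

open Classical in
/-- There is no closed chain of crossings, each of which has its marker in the region that the next
one joins to its own marked region. Otherwise the chain separates the sphere. Consider the map made
of the universe on the side of the tail, smoothed at the chain: its `v` unsmoothed crossings have
their markers in `v` different faces, and there are two further faces, the starred one and one
along the chain, more than Euler's inequality permits. -/
theorem not_exists_marker_cycle [Finite C] {s : Marking C} (hs : U.IsState s) (A : Set C)
    (hA : A.Nonempty) (f : C → C) (hf : Set.BijOn f A A)
    (hsf : ∀ c ∈ A, U.corner c (s c) = U.corner (f c) (s (f c) + 2)) : False := by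
  cases nonempty_fintype C
  obtain ⟨h, hedge, hjump⟩ := U.exists_height A (fun c => s c + 2) s f hf hsf
  have hconst : ∀ c ∉ A, ∀ k, h (Dart.half c (k + 1)) = h (Dart.half c k) := fun c hc k => by
    have := hjump c k
    rw [if_neg hc] at this
    linarith
  have hh : ∀ c ∈ A, h (Dart.half c (s c + 2)) = h (Dart.half c (s c + 1)) ∧
      h (Dart.half c (s c + 3)) = h (Dart.half c (s c)) ∧
      h (Dart.half c (s c + 1)) = h (Dart.half c (s c)) - 1 := by
    intro c hc
    have j1 := hjump c (s c)
    have j2 := hjump c (s c + 1)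
    have j3 := hjump c (s c + 2)
    rw [if_pos hc] at j1 j2 j3
    have e1 : s c ≠ s c + 2 := by generalize s c = a; revert a; decide
    have e2 : s c + 1 ≠ s c + 2 := by generalize s c = a; revert a; decide
    have e4 : s c + 1 ≠ s c := by generalize s c = a; revert a; decide
    have e5 : s c + 2 ≠ s c := by generalize s c = a; revert a; decide
    simp only [e1, e2, e4, e5, if_true, if_false, add_assoc] at j1 j2 j3
    norm_num at j1 j2 j3
    refine ⟨?_, ?_, ?_⟩ <;> linarith
  have a1 : ∀ a : ZMod 4, 2 * a + 3 - a = a + 3 := by decide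
  have a2 : ∀ a : ZMod 4, 2 * a + 3 - (a + 1) = a + 2 := by decide
  have a3 : ∀ a : ZMod 4, 2 * a + 3 - (a + 2) = a + 1 := by decide
  have a4 : ∀ a : ZMod 4, 2 * a + 3 - (a + 3) = a := by decide
  -- the rotation after smoothing the crossings in `A`, and the component `T` of the tail
  let x : Dart C → Dart C := fun d => match d with
    | Dart.tail => Dart.tail
    | Dart.head => Dart.head
    | Dart.half c k => if c ∈ A then Dart.half c (2 * s c + 3 - k) else Dart.half c (k + 1)
  have hxA : ∀ c ∈ A, ∀ k, x (Dart.half c k) = Dart.half c (2 * s c + 3 - k) := fun c hc k => by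
    simp [x, hc]
  have hxnA : ∀ c ∉ A, ∀ k, x (Dart.half c k) = Dart.half c (k + 1) := fun c hc k => by
    simp [x, hc]
  have hxv : ∀ d, (x d).vertex = d.vertex := by
    rintro (_ | _ | ⟨c, k⟩)
    · rfl
    · rfl
    · by_cases hc : c ∈ A <;> simp [x, hc]
  have hx : Function.Injective x := by
    intro a b hab
    have hvv := (hxv a).symm.trans ((congrArg Dart.vertex hab).trans (hxv b))
    rcases a with _ | _ | ⟨c, k⟩ <;> rcases b with _ | _ | ⟨c', k'⟩ <;> simp at hvv <;> try rfl
    subst hvv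
    by_cases hc : c ∈ A <;> simpa [x, hc] using hab
  let T : Finset (Dart C) := Finset.univ.filter fun d =>
    Relation.ReflTransGen (fun a b => b = U.edge a ∨ b = x a) Dart.tail d
  have hT : ∀ d, d ∈ T ↔
      Relation.ReflTransGen (fun a b => b = U.edge a ∨ b = x a) Dart.tail d := by
    simp [T]
  have hTe : ∀ d ∈ T, U.edge d ∈ T := fun d hd => (hT _).2 (((hT d).1 hd).tail (Or.inl rfl))
  have hTx : ∀ d ∈ T, x d ∈ T := fun d hd => (hT _).2 (((hT d).1 hd).tail (Or.inr rfl))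
  have hT0 : Dart.tail ∈ T := (hT _).2 Relation.ReflTransGen.refl
  have hTh : ∀ d ∈ T, h d = h Dart.tail := by
    intro d hd
    induction (hT d).1 hd with
    | refl => rfl
    | @tail b _ hab hb ih =>
      have ih' := ih ((hT _).2 hab)
      rcases hb with rfl | rfl
      · rw [hedge, ih']
      · rw [← ih']
        rcases b with _ | _ | ⟨c, k⟩
        · rfl
        · rfl
        · by_cases hc : c ∈ A
          · obtain ⟨h1, h2, -⟩ := hh c hc
            rw [hxA c hc]
            rcases zmod_four_cases (s c) k with rfl | rfl | rfl | rfl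
            · rw [a1, h2]
            · rw [a2, h1]
            · rw [a3, h1]
            · rw [a4, h2]
          · rw [hxnA c hc, hconst c hc]
  have hTfull : ∀ c ∉ A, ∀ k k', Dart.half c k ∈ T → Dart.half c k' ∈ T := by
    intro c hc k k' hk
    have step : ∀ k, Dart.half c k ∈ T → Dart.half c (k + 1) ∈ T := fun k hk => by
      have := hTx _ hk
      rwa [hxnA c hc] at this
    have s1 := step _ hk
    have s2 := step _ s1
    have s3 := step _ s2
    rcases zmod_four_cases k k' with rfl | rfl | rfl | rfl
    · exact hk
    · exact s1
    · have : k + 2 = k + 1 + 1 := by ring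
      rwa [this]
    · have : k + 3 = k + 1 + 1 + 1 := by ring
      rwa [this]
  -- labels of its faces: `none` for the starred region, the crossing for a region that has its marker
  -- outside `A`, and `some none` for the regions along the chain, which the smoothing joins
  let l : Dart C → Option (Option C) := fun d =>
    if U.region d = U.star then none
    else if hd : ∃ c, c ∉ A ∧ U.corner c (s c) = U.region d then some (some hd.choose)
    else some none
  have hlstar : l Dart.tail = none := if_pos rfl
  have hlA : ∀ d, ∀ a ∈ A, U.region d = U.corner a (s a) → l d = some none := by
    intro d a ha hd
    simp only [l]
    rw [if_neg (hd ▸ hs.1 a), dif_neg]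
    rintro ⟨c, hc, e⟩
    exact hc (hs.injective (e.trans hd) ▸ ha)
  have hlA2 : ∀ d, ∀ a ∈ A, U.region d = U.corner a (s a + 2) → l d = some none := by
    intro d a ha hd
    obtain ⟨a', ha', rfl⟩ := hf.surjOn ha
    exact hlA d a' ha' (hd.trans (hsf a' ha').symm)
  have hlsome : ∀ c ∉ A, l (Dart.half c (s c)) = some (some c) := by
    intro c hc
    have hd : ∃ c', c' ∉ A ∧ U.corner c' (s c') = U.region (Dart.half c (s c)) := ⟨c, hc, rfl⟩
    simp only [l]
    rw [if_neg (show U.region (Dart.half c (s c)) ≠ U.star from hs.1 c), dif_pos hd]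
    exact congrArg _ (congrArg some (hs.injective hd.choose_spec.2))
  have hlreg : ∀ d d', U.region d = U.region d' → l d = l d' := fun d d' e => by simp only [l, e]
  have key := orbit_euler_inequality x U.edge hx U.edge_edge U.edge_ne T _ hT Dart.vertex l
    (fun d _ => hxv d)
    (by rintro (_ | _ | ⟨c, k⟩) hd
        · exact hlreg _ _ U.region_edge_tail
        · exact hlreg _ _ U.region_edge_head
        · by_cases hc : c ∈ A
          · rw [hxA c hc]
            have b1 : ∀ a : ZMod 4, a + 3 - 1 = a + 2 := by decide
            have b2 : ∀ a : ZMod 4, a + 2 - 1 = a + 1 := by decide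
            have b3 : ∀ a : ZMod 4, a + 1 - 1 = a := by decide
            have b4 : ∀ a : ZMod 4, a - 1 = a + 3 := by decide
            rcases zmod_four_cases (s c) k with rfl | rfl | rfl | rfl
            · rw [a1, hlA2 _ c hc (by rw [U.region_edge_half, b1]), hlA _ c hc rfl]
            · rw [a2]
              exact hlreg _ _ (by rw [U.region_edge_half, b2]; rfl)
            · rw [a3, hlA _ c hc (by rw [U.region_edge_half, b3]), hlA2 _ c hc rfl]
            · rw [a4]
              exact hlreg _ _ (by rw [U.region_edge_half, b4]; rfl)
          · rw [hxnA c hc]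
            exact hlreg _ _ (U.region_edge_turn (Dart.half c k)))
  let F : Finset C := Finset.univ.filter fun c => c ∉ A ∧ Dart.half c 0 ∈ T
  -- the chain is reached, because otherwise the orbit would be everything
  obtain ⟨d₁, hd₁T, hd₁⟩ : ∃ d ∈ T, l d = some none := by
    by_contra hcon
    have hno : ∀ c ∈ A, ∀ k, Dart.half c k ∉ T := by
      intro c hc k hk
      have hk' := hTx _ hk
      rw [hxA c hc] at hk'
      rcases zmod_four_cases (s c) k with rfl | rfl | rfl | rfl
      · exact hcon ⟨_, hk, hlA _ c hc rfl⟩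
      · rw [a2] at hk'
        exact hcon ⟨_, hk', hlA2 _ c hc rfl⟩
      · exact hcon ⟨_, hk, hlA2 _ c hc rfl⟩
      · rw [a4] at hk'
        exact hcon ⟨_, hk', hlA _ c hc rfl⟩
    obtain ⟨c, hc⟩ := hA
    refine hno c hc 0 (U.dart_induction (Z := fun d => d ∈ T) hT0 hTe ?_ _)
    rintro (_ | _ | ⟨c, k⟩) hd
    · exact hd
    · exact hd
    · by_cases hc : c ∈ A
      · exact absurd hd (hno c hc k)
      · exact hTfull c hc _ _ hd
  have hcardl : F.card + 2 ≤ (T.image l).card := by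
    have : (insert none (insert (some none) (F.image fun c => some (some c)))) ⊆ T.image l := by
      intro o ho
      rcases Finset.mem_insert.1 ho with rfl | ho
      · exact Finset.mem_image.2 ⟨_, hT0, hlstar⟩
      rcases Finset.mem_insert.1 ho with rfl | ho
      · exact Finset.mem_image.2 ⟨_, hd₁T, hd₁⟩
      · obtain ⟨c, hc, rfl⟩ := Finset.mem_image.1 ho
        simp only [F, Finset.mem_filter, Finset.mem_univ, true_and] at hc
        exact Finset.mem_image.2 ⟨_, hTfull c hc.1 0 (s c) hc.2, hlsome c hc.1⟩
    have := Finset.card_le_card this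
    rwa [Finset.card_insert_of_notMem (by simp), Finset.card_insert_of_notMem (by simp),
      Finset.card_image_of_injective _ (fun a b e => by simpa using e)] at this
  -- a smoothed crossing has at most two half-edges in `T`, because the height drops across the chain
  have hcardT : T.card + 1 ≤ 2 * (T.image Dart.vertex).card + 2 * F.card := by
    have hone : ∑ v ∈ T.image Dart.vertex, (if v = Sum.inl true then 1 else 0) = 1 := by
      rw [Finset.sum_ite_eq', if_pos (Finset.mem_image.2 ⟨_, hT0, Dart.vertex_tail⟩)]
    rw [Finset.card_eq_sum_card_image Dart.vertex T, ← hone, ← Finset.sum_add_distrib]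
    have hb : ∀ v ∈ T.image Dart.vertex, (T.filter fun d => d.vertex = v).card +
        (if v = Sum.inl true then 1 else 0) ≤ 2 + if v ∈ F.image Sum.inr then 2 else 0 := by
      intro v hv
      have hend : ∀ b, (T.filter fun e => e.vertex = Sum.inl b).card ≤ 1 := fun b =>
        Finset.card_le_one.2 fun a ha a' ha' => by
          have h1 := (Finset.mem_filter.1 ha).2
          have h2 := (Finset.mem_filter.1 ha').2
          cases a <;> cases a' <;> simp at h1 h2 <;> simp_all
      rcases v with (_ | _) | c
      · have := hend false
        rw [if_neg (by simp), add_zero]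
        omega
      · have := hend true
        rw [if_pos rfl]
        omega
      · rw [if_neg (by simp), add_zero]
        obtain ⟨d, hd, hdv⟩ := Finset.mem_image.1 hv
        obtain ⟨k, rfl⟩ : ∃ k, d = Dart.half c k := by
          rcases d with _ | _ | ⟨c', k⟩
          · simp at hdv
          · simp at hdv
          · simp at hdv
            exact ⟨k, by rw [hdv]⟩
        by_cases hc : c ∈ A
        · have hsub : (T.filter fun e => e.vertex = Sum.inr c) ⊆
              {Dart.half c k, Dart.half c (2 * s c + 3 - k)} := by
            intro e he
            obtain ⟨heT, hev⟩ := Finset.mem_filter.1 he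
            rcases e with _ | _ | ⟨c', k'⟩
            · simp at hev
            · simp at hev
            · simp at hev
              subst hev
              have heq := (hTh _ heT).trans (hTh _ hd).symm
              obtain ⟨h1, h2, h3⟩ := hh c' hc
              rcases zmod_four_cases (s c') k with rfl | rfl | rfl | rfl <;>
                rcases zmod_four_cases (s c') k' with rfl | rfl | rfl | rfl <;>
                first
                | (simp only [a1, a2, a3, a4]; simp; done)
                | (exfalso; linarith)
          have hle := (Finset.card_le_card hsub).trans Finset.card_le_two
          omega
        · have hF : Sum.inr c ∈ F.image (Sum.inr : C → Bool ⊕ C) := by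
            refine Finset.mem_image.2 ⟨c, ?_, rfl⟩
            simp only [F, Finset.mem_filter, Finset.mem_univ, true_and]
            exact ⟨hc, hTfull c hc _ _ hd⟩
          rw [if_pos hF]
          have hsub : (T.filter fun e => e.vertex = Sum.inr c) ⊆
              (Finset.univ : Finset (ZMod 4)).image (Dart.half c) := by
            intro e he
            have he := (Finset.mem_filter.1 he).2
            cases e with
            | tail => simp at he
            | head => simp at he
            | half c' k => simp at he; simp [he]
          have hle := (Finset.card_le_card hsub).trans Finset.card_image_le
          have h4 : (Finset.univ : Finset (ZMod 4)).card = 4 := rfl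
          omega
    refine (Finset.sum_le_sum hb).trans ?_
    rw [Finset.sum_add_distrib, Finset.sum_const, ← Finset.sum_filter, Finset.sum_const]
    have : ((T.image Dart.vertex).filter fun v => v ∈ F.image Sum.inr).card ≤ F.card :=
      (Finset.card_le_card fun v hv => (Finset.mem_filter.1 hv).2).trans Finset.card_image_le
    simp only [smul_eq_mul]
    omega
  omega

/-- The smoothing of a state is connected. If not, the crossings at which the component of the tail
touches another one contain a closed chain as excluded above. -/
theorem isTrail_smoothing [Finite C] {s : Marking C} (hs : U.IsState s) :
    U.IsTrail (smoothing s) := by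
  refine ⟨⟨s, rfl⟩, ?_⟩
  by_contra hcon
  let B : Dart C → Prop := fun d =>
    Relation.ReflTransGen (fun a b => b = U.edge a ∨ b = smoothing s a) Dart.tail d
  have hBe' : ∀ d, B d → B (U.edge d) := fun d hd => hd.tail (Or.inl rfl)
  have hBj' : ∀ d, B d → B (smoothing s d) := fun d hd => hd.tail (Or.inr rfl)
  have hBe : ∀ d, B (U.edge d) ↔ B d := fun d =>
    ⟨fun h => by simpa [U.edge_edge] using hBe' _ h, hBe' d⟩
  have hBj : ∀ d, B (smoothing s d) ↔ B d := fun d =>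
    ⟨fun h => by simpa [smoothing_smoothing] using hBj' _ h, hBj' d⟩
  have a1 : ∀ a : ZMod 4, 2 * a + 3 - a = a + 3 := by decide
  have a2 : ∀ a : ZMod 4, 2 * a + 3 - (a + 1) = a + 2 := by decide
  have hB03 : ∀ c, B (Dart.half c (s c + 3)) ↔ B (Dart.half c (s c)) := fun c => by
    have := hBj (Dart.half c (s c))
    rwa [smoothing_half, a1] at this
  have hB12 : ∀ c, B (Dart.half c (s c + 2)) ↔ B (Dart.half c (s c + 1)) := fun c => by
    have := hBj (Dart.half c (s c + 1))
    rwa [smoothing_half, a2] at this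
  have e2 : ∀ a : ZMod 4, a + 1 + 1 = a + 2 := by decide
  have e3 : ∀ a : ZMod 4, a + 2 + 1 = a + 3 := by decide
  have e4 : ∀ a : ZMod 4, a + 3 + 1 = a := by decide
  -- the boundary of the region of a marker where two components touch must return to the first
  -- component at another crossing, in the corner opposite to the marker there
  have hstep : ∀ c, ¬ (B (Dart.half c (s c + 1)) ↔ B (Dart.half c (s c))) →
      ∃ c', U.corner c (s c) = U.corner c' (s c' + 2) ∧
        ¬ (B (Dart.half c' (s c' + 1)) ↔ B (Dart.half c' (s c'))) := by
    intro c hc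
    obtain ⟨y, hy, hy1, hy2⟩ := U.exists_enter
      (Z := fun d => ¬ (B d ↔ B (Dart.half c (s c)))) (d := Dart.half c (s c))
      (d' := U.edge (Dart.half c (s c + 1))) (U.region_edge_turn (Dart.half c (s c))).symm
      (by simp) (by rwa [hBe])
    rw [not_not, ← hBe, ← U.edge_turn_facePerm] at hy1
    rw [← U.region_facePerm] at hy
    generalize facePerm U.edge y = e at hy hy1 hy2
    rcases e with _ | _ | ⟨c', k⟩
    · exact absurd hy1 hy2
    · exact absurd hy1 hy2
    · rw [Dart.turn_half] at hy1
      rcases zmod_four_cases (s c') k with rfl | rfl | rfl | rfl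
      · obtain rfl := hs.injective (c := c') (c' := c) hy
        exact absurd Iff.rfl hy2
      · rw [e2, hB12] at hy1
        exact absurd hy1 hy2
      · refine ⟨c', hy.symm, ?_⟩
        rw [e3, hB03] at hy1
        rw [hB12] at hy2
        tauto
      · rw [e4] at hy1
        rw [hB03] at hy2
        exact absurd hy1 hy2
  have hne : {c | ¬ (B (Dart.half c (s c + 1)) ↔ B (Dart.half c (s c)))}.Nonempty := by
    by_contra hemp
    refine hcon (U.dart_induction (Z := B) Relation.ReflTransGen.refl hBe' ?_)
    rintro (_ | _ | ⟨c, k⟩) hd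
    · exact hd
    · exact hd
    · have hc : B (Dart.half c (s c + 1)) ↔ B (Dart.half c (s c)) := by
        by_contra h
        exact hemp ⟨c, h⟩
      rw [Dart.turn_half]
      rcases zmod_four_cases (s c) k with rfl | rfl | rfl | rfl
      · exact hc.2 hd
      · rwa [e2, hB12]
      · rw [e3, hB03]
        exact hc.1 ((hB12 c).1 hd)
      · rw [e4]
        exact (hB03 c).1 hd
  choose! f hf1 hf2 using hstep
  obtain ⟨A, hAB, hA, hfA⟩ := exists_bijOn_of_mapsTo f _ hne hf2
  exact U.not_exists_marker_cycle hs A hA f hfA fun c hc => hf1 c (hAB hc)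

end LinkoidUniverse

namespace Dart

theorem map_turn_inv {C : Type u} {C' : Type v} (f : C → C') (d : Dart C) :
    ((turn C)⁻¹ d).map f = (turn C')⁻¹ (d.map f) := by cases d <;> rfl

@[simp] theorem map_tail {C : Type u} {C' : Type v} (f : C → C') : (tail : Dart C).map f = tail :=
  rfl

@[simp] theorem map_head {C : Type u} {C' : Type v} (f : C → C') : (head : Dart C).map f = head :=
  rfl

@[simp] theorem map_half {C : Type u} {C' : Type v} (f : C → C') (c : C) (i : ZMod 4) :
    (half c i).map f = half (f c) i := rfl

theorem map_injective {C : Type u} {C' : Type v} {f : C → C'} (hf : Function.Injective f) :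
    Function.Injective (map f) := by
  intro a b h
  cases a <;> cases b <;> simp_all [hf.eq_iff]

end Dart

/-- The opposite sense of rotation. -/
def Sense.reverse : Sense → Sense
  | clockwise => counterclockwise
  | counterclockwise => clockwise

theorem Sense.step_reverse (t : Sense) : t.reverse.step = - t.step := by
  cases t <;> simp [Sense.reverse, Sense.step]

namespace LinkoidUniverse

variable {C : Type u} (U : LinkoidUniverse C)

/-! ### Pieces of a universe -/

/-- The common form of `IsClocked` and `IsCounterClocked`: a state that admits no move in the sense
opposite to `t`. -/
def IsExtreme (t : Sense) (s : Marking C) : Prop :=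
  U.IsState s ∧ ∀ s', ¬ U.IsClockMove t.reverse s s'

/-- `V`, whose crossings are regarded as crossings of `U` by means of `ι`, is a piece of `U` if the
unstarred regions of `V` that have corners are also regions of `U`, not starred and different for
different regions of `V`. -/
def IsPiece {C' : Type v} (V : LinkoidUniverse C') (ι : C' → C) : Prop :=
  ∀ c i, V.corner c i ≠ V.star → U.corner (ι c) i ≠ U.star ∧
    ∀ c' i', V.corner c i = V.corner c' i' ↔ U.corner (ι c) i = U.corner (ι c') i'

variable {U}

/-- A move of markers of a piece is a move on this piece. -/
theorem IsPiece.not_doubleMove {C' : Type v} [Finite C'] {V : LinkoidUniverse C'} {ι : C' → C}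
    (h : U.IsPiece V ι) (hι : Function.Injective ι) {t : Sense} {s s' : Marking C}
    (hs : V.IsExtreme t fun c => s (ι c)) {d₁ d₂ : C'} (hne : ι d₁ ≠ ι d₂)
    (h1 : s' (ι d₁) = s (ι d₁) + t.reverse.step) (h2 : s' (ι d₂) = s (ι d₂) + t.reverse.step)
    (h3 : ∀ c, c ≠ ι d₁ → c ≠ ι d₂ → s' c = s c)
    (h4 : U.corner (ι d₁) (s' (ι d₁)) = U.corner (ι d₂) (s (ι d₂)))
    (h5 : U.corner (ι d₂) (s' (ι d₂)) = U.corner (ι d₁) (s (ι d₁))) : False := by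
  have hm : V.IsDoubleMove t.reverse (fun c => s (ι c)) (fun c => s' (ι c)) :=
    ⟨d₁, d₂, fun e => hne (congrArg ι e), h1, h2,
      fun c hc hc' => h3 _ (fun e => hc (hι e)) (fun e => hc' (hι e)),
      (((h d₂ _ (hs.1.1 d₂)).2 _ _).2 h4.symm).symm, (((h d₁ _ (hs.1.1 d₁)).2 _ _).2 h5.symm).symm⟩
  exact hs.2 _ ⟨hs.1, hs.1.of_move (Or.inl hm), Or.inl hm⟩

theorem IsPiece.not_headMove {C' : Type v} [Finite C'] {V : LinkoidUniverse C'} {ι : C' → C}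
    (h : U.IsPiece V ι) (hι : Function.Injective ι) {t : Sense} {s s' : Marking C}
    (hs : V.IsExtreme t fun c => s (ι c)) {d : C'}
    (h1 : s' (ι d) = s (ι d) + t.reverse.step) (h3 : ∀ c, c ≠ ι d → s' c = s c)
    (h4 : U.corner (ι d) (s' (ι d)) = U.corner (ι d) (s (ι d))) : False := by
  have hm : V.IsHeadMove t.reverse (fun c => s (ι c)) (fun c => s' (ι c)) :=
    ⟨d, h1, fun c hc => h3 _ (fun e => hc (hι e)), (((h d _ (hs.1.1 d)).2 _ _).2 h4.symm).symm⟩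
  exact hs.2 _ ⟨hs.1, hs.1.of_move (Or.inr hm), Or.inr hm⟩

/-- Extreme states of two complementary pieces fit together. -/
theorem isExtreme_of_pieces [Finite C] {S : Set C} {U₁ : LinkoidUniverse S}
    {U₂ : LinkoidUniverse ↥(Sᶜ)} (h₁ : U.IsPiece U₁ Subtype.val) (h₂ : U.IsPiece U₂ Subtype.val)
    (h : ∀ c i c' i', U₂.corner c i ≠ U₂.star → U.corner c.1 i ≠ U.corner (c' : S).1 i')
    {t : Sense} {s : Marking C} (hs₁ : U₁.IsExtreme t fun c => s c.1)
    (hs₂ : U₂.IsExtreme t fun c => s c.1) : U.IsExtreme t s := by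
  have hcross : ∀ c ∉ S, ∀ c' ∈ S, ∀ i', U.corner c (s c) ≠ U.corner c' i' :=
    fun c hc c' hc' i' => h ⟨c, hc⟩ _ ⟨c', hc'⟩ i' (hs₂.1.1 ⟨c, hc⟩)
  have hstate : U.IsState s := by
    refine U.isState_of_injective (fun c => ?_) fun c c' e => ?_
    · by_cases hc : c ∈ S
      · exact (h₁ ⟨c, hc⟩ _ (hs₁.1.1 ⟨c, hc⟩)).1
      · exact (h₂ ⟨c, hc⟩ _ (hs₂.1.1 ⟨c, hc⟩)).1
    · by_cases hc : c ∈ S <;> by_cases hc' : c' ∈ S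
      · exact congrArg Subtype.val (hs₁.1.injective (c := ⟨c, hc⟩) (c' := ⟨c', hc'⟩)
          (((h₁ ⟨c, hc⟩ _ (hs₁.1.1 ⟨c, hc⟩)).2 ⟨c', hc'⟩ _).2 e))
      · exact absurd e.symm (hcross c' hc' c hc _)
      · exact absurd e (hcross c hc c' hc' _)
      · exact congrArg Subtype.val (hs₂.1.injective (c := ⟨c, hc⟩) (c' := ⟨c', hc'⟩)
          (((h₂ ⟨c, hc⟩ _ (hs₂.1.1 ⟨c, hc⟩)).2 ⟨c', hc'⟩ _).2 e))
  refine ⟨hstate, ?_⟩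
  rintro s' ⟨-, -, ⟨c₁, c₂, hne, h1, h2, h3, h4, h5⟩ | ⟨c, h1, h3, h4⟩⟩
  · by_cases hc₁ : c₁ ∈ S <;> by_cases hc₂ : c₂ ∈ S
    · exact h₁.not_doubleMove Subtype.val_injective hs₁ (d₁ := ⟨c₁, hc₁⟩) (d₂ := ⟨c₂, hc₂⟩)
        hne h1 h2 h3 h4 h5
    · exact hcross c₂ hc₂ c₁ hc₁ _ h4.symm
    · exact hcross c₁ hc₁ c₂ hc₂ _ h5.symm
    · exact h₂.not_doubleMove Subtype.val_injective hs₂ (d₁ := ⟨c₁, hc₁⟩) (d₂ := ⟨c₂, hc₂⟩)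
        hne h1 h2 h3 h4 h5
  · by_cases hc : c ∈ S
    · exact h₁.not_headMove Subtype.val_injective hs₁ (d := ⟨c, hc⟩) h1 h3 h4
    · exact h₂.not_headMove Subtype.val_injective hs₂ (d := ⟨c, hc⟩) h1 h3 h4

variable (U)

/-- Two universes with together as many crossings as `U` are pieces of `U` if their darts can be
labelled compatibly by regions of `U`: the labels `ρ` of `U₁` are constant along its regions; the
labels `κ` of `U₂` are so too, except that those in the range of `ρ` need not be
distinguished. The proof is by counting the regions. -/
theorem isPiece_of_labels [Finite C] {C₁ C₂ : Type u} [Finite C₁] [Finite C₂]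
    (U₁ : LinkoidUniverse C₁) (U₂ : LinkoidUniverse C₂) (ι₁ : C₁ → C) (ι₂ : C₂ → C)
    (hcard : Nat.card C = Nat.card C₁ + Nat.card C₂) (ρ : Dart C₁ → U.Region)
    (κ : Dart C₂ → U.Region) (hρ : ∀ d, ρ (facePerm U₁.edge d) = ρ d)
    (hκ : ∀ d, κ (facePerm U₂.edge d) = κ d ∨
      (κ (facePerm U₂.edge d) ∈ Set.range ρ ∧ κ d ∈ Set.range ρ))
    (hρtail : ρ Dart.tail = U.star) (hκtail : κ Dart.tail ∈ Set.range ρ)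
    (hρhalf : ∀ c i, ρ (Dart.half c i) = U.corner (ι₁ c) i)
    (hκhalf : ∀ c i, κ (Dart.half c i) = U.corner (ι₂ c) i)
    (hall : ∀ R, R ∈ Set.range ρ ∨ R ∈ Set.range κ) :
    U.IsPiece U₁ ι₁ ∧ U.IsPiece U₂ ι₂ ∧
    ∀ c i c' i', U₂.corner c i ≠ U₂.star → U.corner (ι₂ c) i ≠ U.corner (ι₁ c') i' := by
  classical
  have := Fintype.ofFinite U.Region
  have := Fintype.ofFinite U₁.Region
  have := Fintype.ofFinite U₂.Region
  have n0 := U.card_region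
  have n1 := U₁.card_region
  have n2 := U₂.card_region
  rw [Nat.card_eq_fintype_card] at n0 n1 n2
  let l : Dart C₂ → Option {R : U.Region // R ∉ Set.range ρ} := fun d =>
    if h : κ d ∉ Set.range ρ then some ⟨κ d, h⟩ else none
  have hl : ∀ d, l (facePerm U₂.edge d) = l d := fun d => by
    rcases hκ d with h | ⟨h, h'⟩
    · simp only [l, h]
    · simp only [l, h, h', not_true_eq_false, dite_false]
  let f₁ : U₁.Region → Set.range ρ := Quotient.lift (fun d => ⟨ρ d, d, rfl⟩) fun d d' h =>
    Subtype.ext (U₁.eq_of_region_eq hρ (U₁.region_eq_iff.2 h))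
  let f₂ : U₂.Region → Option {R : U.Region // R ∉ Set.range ρ} := Quotient.lift l fun d d' h =>
    U₂.eq_of_region_eq hl (U₂.region_eq_iff.2 h)
  have hf₁ : Function.Surjective f₁ := by
    rintro ⟨R, d, rfl⟩
    exact ⟨U₁.region d, rfl⟩
  have hf₂ : Function.Surjective f₂ := by
    rintro (_ | ⟨R, hR⟩)
    · exact ⟨U₂.region Dart.tail, dif_neg (not_not.2 hκtail)⟩
    · rcases hall R with h | ⟨d, rfl⟩
      · exact absurd h hR
      · exact ⟨U₂.region d, dif_pos hR⟩
  have c1 := Fintype.card_le_of_surjective f₁ hf₁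
  have c2 := Fintype.card_le_of_surjective f₂ hf₂
  have c3 := Fintype.card_subtype_compl fun R => R ∈ Set.range ρ
  have c4 := Fintype.card_subtype_le fun R => R ∈ Set.range ρ
  have c5 : Fintype.card (Set.range ρ) = Fintype.card {R // R ∈ Set.range ρ} :=
    Fintype.card_congr (Equiv.refl _)
  rw [Fintype.card_option] at c2
  have b₁ : Function.Injective f₁ :=
    ((Fintype.bijective_iff_surjective_and_card f₁).2 ⟨hf₁, by omega⟩).1
  have b₂ : Function.Injective f₂ :=
    ((Fintype.bijective_iff_surjective_and_card f₂).2
      ⟨hf₂, by rw [Fintype.card_option]; omega⟩).1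
  have hρinj : ∀ d d', ρ d = ρ d' ↔ U₁.region d = U₁.region d' := fun d d' =>
    ⟨fun h => b₁ (Subtype.ext h), fun h => U₁.eq_of_region_eq hρ h⟩
  have hlinj : ∀ d d', l d = l d' ↔ U₂.region d = U₂.region d' := fun d d' =>
    ⟨fun h => b₂ h, fun h => U₂.eq_of_region_eq hl h⟩
  have hnot : ∀ c i, U₂.corner c i ≠ U₂.star → U.corner (ι₂ c) i ∉ Set.range ρ := by
    intro c i hc hmem
    refine hc ((hlinj _ _).1 ?_)
    simp only [l]
    rw [dif_neg (not_not.2 hκtail), dif_neg]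
    rwa [not_not, hκhalf]
  refine ⟨fun c i hc => ⟨fun e => hc ?_, fun c' i' => ?_⟩, fun c i hc =>
    ⟨fun e => hnot c i hc ⟨Dart.tail, hρtail.trans e.symm⟩, fun c' i' => ?_⟩,
    fun c i c' i' hc e => hnot c i hc ⟨Dart.half c' i', (hρhalf c' i').trans e.symm⟩⟩
  · exact (hρinj _ _).1 (by rw [hρhalf, hρtail, e])
  · rw [← hρhalf, ← hρhalf, hρinj]
    rfl
  · rw [← hκhalf, ← hκhalf]
    have h1 : κ (Dart.half c i) ∉ Set.range ρ := by rw [hκhalf]; exact hnot c i hc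
    refine (hlinj _ _).symm.trans ⟨fun e => ?_, fun e => ?_⟩
    · simp only [l, dif_pos h1] at e
      split_ifs at e
      simpa using e
    · simp only [l, e]

theorem region_turn_inv (d : Dart C) : U.region ((Dart.turn C)⁻¹ d) = U.region (U.edge d) := by
  rw [← U.facePerm_edge, U.region_facePerm]

theorem facePerm_eq (d : Dart C) : facePerm U.edge d = (Dart.turn C)⁻¹ (U.edge d) := rfl

theorem edge_eq_iff {d d' : Dart C} : U.edge d = d' ↔ d = U.edge d' :=
  ⟨fun h => by rw [← h, U.edge_edge], fun h => by rw [h, U.edge_edge]⟩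

theorem edge_tail_ne_head [Nonempty C] : U.edge Dart.tail ≠ Dart.head := by
  intro h
  have key : ∀ d, d = Dart.tail ∨ d = Dart.head :=
    U.dart_induction (Or.inl rfl)
      (by rintro d (rfl | rfl)
          exacts [Or.inr h, Or.inl (U.edge_eq_iff.1 h).symm])
      (by rintro d (rfl | rfl)
          exacts [Or.inl rfl, Or.inr rfl])
  obtain ⟨c⟩ := ‹Nonempty C›
  rcases key (Dart.half c 0) with h | h <;> simp at h

theorem card_eq_add_compl [Finite C] (S : Set C) : Nat.card C = Nat.card S + Nat.card ↥(Sᶜ) := by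
  classical
  rw [← Nat.card_sum]
  exact Nat.card_congr (Equiv.Set.sumCompl S).symm

/-- The dart starts at a crossing in `S`. -/
def _root_.Dart.At (S : Set C) : Dart C → Prop
  | Dart.tail => False
  | Dart.head => False
  | Dart.half c _ => c ∈ S

@[simp] theorem _root_.Dart.at_tail (S : Set C) : Dart.At S Dart.tail ↔ False := Iff.rfl
@[simp] theorem _root_.Dart.at_head (S : Set C) : Dart.At S Dart.head ↔ False := Iff.rfl
@[simp] theorem _root_.Dart.at_half (S : Set C) (c : C) (i : ZMod 4) :
    Dart.At S (Dart.half c i) ↔ c ∈ S := Iff.rfl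

theorem _root_.Dart.at_turn (S : Set C) (d : Dart C) : Dart.At S (Dart.turn C d) ↔ Dart.At S d := by
  cases d <;> rfl

variable {U}

/-- Both factors of a composition are pieces, and only the region at the spliced edge, which is
starred in the second factor, is common to them. -/
theorem IsComposition.isPiece [Finite C] {S : Set C} {U₁ : LinkoidUniverse S}
    {U₂ : LinkoidUniverse ↥(Sᶜ)} (h : U.IsComposition S U₁ U₂) :
    U.IsPiece U₁ Subtype.val ∧ U.IsPiece U₂ Subtype.val ∧
    ∀ c i c' i', U₂.corner c i ≠ U₂.star → U.corner c.1 i ≠ U.corner (c' : S).1 i' := by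
  classical
  obtain ⟨h1, h2, h3⟩ := h
  have hne1 := U₁.edge_ne Dart.head
  have hne2 := U₂.edge_ne Dart.tail
  -- the region on both sides of the edge at which the parts are spliced
  have hxy : U.region ((U₁.edge Dart.head).map Subtype.val) =
      U.region ((U₂.edge Dart.tail).map Subtype.val) := by
    let T : Dart C → Prop := fun d => d = Dart.tail ∨ Dart.At S d
    have hT : ∀ d, T (Dart.turn C d) ↔ T d := by rintro (_ | _ | ⟨c, i⟩) <;> simp [T]
    have hTmap : ∀ d : Dart S, d ≠ Dart.head → T (d.map Subtype.val) := by
      rintro (_ | _ | ⟨c, i⟩) hd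
      · exact Or.inl rfl
      · exact absurd rfl hd
      · exact Or.inr c.2
    have hnT : ∀ d : Dart ↥(Sᶜ), d ≠ Dart.tail → ¬ T (d.map Subtype.val) := by
      rintro (_ | _ | ⟨c, i⟩) hd
      · exact absurd rfl hd
      · simp [T]
      · rintro (h | h)
        · cases h
        · exact c.2 h
    obtain ⟨y, hy, hyT, hyT'⟩ := U.exists_return (T := T) hT (hTmap _ hne1)
      (by rw [h3]; exact hnT _ hne2)
    rw [← hy]
    obtain ⟨d, hd, hdy⟩ : ∃ d : Dart S, d ≠ Dart.head ∧ d.map Subtype.val = U.edge y := by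
      generalize U.edge y = e at hyT'
      rcases e with _ | _ | ⟨c, i⟩
      · exact ⟨Dart.tail, by simp, rfl⟩
      · simp [T] at hyT'
      · refine ⟨Dart.half ⟨c, ?_⟩ i, by simp, rfl⟩
        simpa [T] using hyT'
    by_cases hd' : U₁.edge d = Dart.head
    · rw [U₁.edge_eq_iff] at hd'
      rw [← h3, ← hd', hdy, U.edge_edge]
    · have := h1 d hd hd'
      rw [hdy, U.edge_edge] at this
      exact absurd (this ▸ hTmap _ hd') hyT
  refine U.isPiece_of_labels U₁ U₂ Subtype.val Subtype.val (card_eq_add_compl S)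
    (fun d => if d = Dart.head then U.region ((U₁.edge Dart.head).map Subtype.val)
      else U.region (d.map Subtype.val))
    (fun d => if d = Dart.tail then U.region ((U₂.edge Dart.tail).map Subtype.val)
      else U.region (d.map Subtype.val)) (fun d => ?_) (fun d => Or.inl ?_) (by rw [if_neg (by simp)]; rfl)
    ⟨Dart.head, by simpa using hxy⟩ (fun c i => by rw [if_neg (by simp)]; rfl)
    (fun c i => by rw [if_neg (by simp)]; rfl) (fun R => ?_)
  · by_cases hd : d = Dart.head
    · subst hd
      have hne : (Dart.turn S)⁻¹ (U₁.edge Dart.head) ≠ Dart.head := by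
        rwa [Ne, Equiv.Perm.inv_eq_iff_eq, Dart.turn_head]
      rw [U₁.facePerm_eq, if_neg hne, if_pos rfl, Dart.map_turn_inv, U.region_turn_inv, h3, hxy]
    · by_cases hd' : U₁.edge d = Dart.head
      · rw [U₁.facePerm_eq, hd', Dart.turn_inv_head, if_pos rfl, if_neg hd,
          U₁.edge_eq_iff.1 hd']
      · have hne : (Dart.turn S)⁻¹ (U₁.edge d) ≠ Dart.head := by
          rwa [Ne, Equiv.Perm.inv_eq_iff_eq, Dart.turn_head]
        rw [U₁.facePerm_eq, if_neg hne, if_neg hd, Dart.map_turn_inv, ← h1 d hd hd',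
          ← U.facePerm_eq, U.region_facePerm]
  · by_cases hd : d = Dart.tail
    · subst hd
      have hne : (Dart.turn ↥(Sᶜ))⁻¹ (U₂.edge Dart.tail) ≠ Dart.tail := by
        rwa [Ne, Equiv.Perm.inv_eq_iff_eq, Dart.turn_tail]
      rw [U₂.facePerm_eq, if_neg hne, if_pos rfl, Dart.map_turn_inv, U.region_turn_inv, ← hxy,
        ← h3, U.edge_edge]
    · by_cases hd' : U₂.edge d = Dart.tail
      · rw [U₂.facePerm_eq, hd', Dart.turn_inv_tail, if_pos rfl, if_neg hd,
          U₂.edge_eq_iff.1 hd']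
      · have hne : (Dart.turn ↥(Sᶜ))⁻¹ (U₂.edge d) ≠ Dart.tail := by
          rwa [Ne, Equiv.Perm.inv_eq_iff_eq, Dart.turn_tail]
        rw [U₂.facePerm_eq, if_neg hne, if_neg hd, Dart.map_turn_inv, ← h2 d hd hd',
          ← U.facePerm_eq, U.region_facePerm]
  · obtain ⟨d, rfl⟩ := U.region_surjective R
    rcases d with _ | _ | ⟨c, i⟩
    · exact Or.inl ⟨Dart.tail, if_neg (by simp)⟩
    · exact Or.inr ⟨Dart.head, if_neg (by simp)⟩
    · by_cases hc : c ∈ S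
      · exact Or.inl ⟨Dart.half ⟨c, hc⟩ i, if_neg (by simp)⟩
      · exact Or.inr ⟨Dart.half ⟨c, hc⟩ i, if_neg (by simp)⟩

/-- The carrier and the rider are pieces; the starred region of the rider is cut into the two regions
at the carrying edge. -/
theorem IsInsertion.isPiece [Finite C] {S : Set C} {U₁ : LinkoidUniverse S} {e : Dart S}
    {U₂ : LinkoidUniverse ↥(Sᶜ)} (hS : (Sᶜ).Nonempty) (h : U.IsInsertion S U₁ e U₂) :
    U.IsPiece U₁ Subtype.val ∧ U.IsPiece U₂ Subtype.val ∧
    ∀ c i c' i', U₂.corner c i ≠ U₂.star → U.corner c.1 i ≠ U.corner (c' : S).1 i' := by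
  classical
  obtain ⟨hk, h1, h2, h3, h4⟩ := h
  have : Nonempty ↥(Sᶜ) := hS.to_subtype
  have hth := U₂.edge_tail_ne_head
  have hne1 := U₂.edge_ne Dart.tail
  have hne2 := U₂.edge_ne Dart.head
  have hht : U₂.edge Dart.head ≠ Dart.tail := fun e => hth (U₂.edge_eq_iff.1 e).symm
  have hmapS : ∀ d : Dart S, ¬ Dart.At Sᶜ (d.map Subtype.val) := by
    rintro (_ | _ | ⟨c, i⟩)
    · simp
    · simp
    · simp
  have hmapSc : ∀ d : Dart ↥(Sᶜ), d ≠ Dart.tail → d ≠ Dart.head →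
      Dart.At Sᶜ (d.map Subtype.val) := by
    rintro (_ | _ | ⟨c, i⟩) a b
    · exact absurd rfl a
    · exact absurd rfl b
    · exact c.2
  have hex : ∀ d, Dart.At Sᶜ d → ¬ Dart.At Sᶜ (U.edge d) →
      d = (U₂.edge Dart.tail).map Subtype.val ∨ d = (U₂.edge Dart.head).map Subtype.val := by
    rintro (_ | _ | ⟨c, i⟩) hd hd'
    · exact absurd hd (by simp)
    · exact absurd hd (by simp)
    · by_cases a : U₂.edge (Dart.half ⟨c, hd⟩ i) = Dart.tail
      · rw [← U₂.edge_eq_iff.1 a]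
        exact Or.inl rfl
      by_cases b : U₂.edge (Dart.half ⟨c, hd⟩ i) = Dart.head
      · rw [← U₂.edge_eq_iff.1 b]
        exact Or.inr rfl
      have := h2 (Dart.half ⟨c, hd⟩ i) (by simp) (by simp) a b
      rw [Dart.map_half] at this
      exact absurd (this ▸ hmapSc _ a b) hd'
  set xb := e.map Subtype.val with hxb
  set xh := (U₁.edge e).map Subtype.val with hxh
  set b := (U₂.edge Dart.tail).map Subtype.val with hb
  set h := (U₂.edge Dart.head).map Subtype.val with hh
  have hbAt : Dart.At Sᶜ b := hmapSc _ hne1 hth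
  have hhAt : Dart.At Sᶜ h := hmapSc _ hht hne2
  have hleave : ∀ y, ¬ Dart.At Sᶜ y → Dart.At Sᶜ (U.edge y) →
      U.region b = U.region y ∨ U.region h = U.region y := by
    intro y hy hy'
    obtain ⟨z, hz, hz1, hz2⟩ := U.exists_return (T := fun d => ¬ Dart.At Sᶜ d)
      (fun d => by rw [Dart.at_turn]) hy (not_not.2 hy')
    rcases hex z (not_not.1 hz1) hz2 with rfl | rfl
    exacts [Or.inl hz, Or.inr hz]
  have henter : ∀ y, Dart.At Sᶜ y → ¬ Dart.At Sᶜ (U.edge y) →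
      U.region xb = U.region y ∨ U.region xh = U.region y := by
    intro y hy hy'
    obtain ⟨z, hz, hz1, hz2⟩ := U.exists_return (Dart.at_turn Sᶜ) hy hy'
    rcases hex _ hz2 (by rwa [U.edge_edge]) with e | e
    · rw [← h3] at e
      rw [U.edge.injective e] at hz
      exact Or.inl hz
    · rw [← h4] at e
      rw [U.edge.injective e] at hz
      exact Or.inr hz
  have i1 := hleave xb (hmapS e) (by rw [h3]; exact hbAt)
  have i2 := hleave xh (hmapS _) (by rw [h4]; exact hhAt)
  have i3 := henter b hbAt (by rw [← h3, U.edge_edge]; exact hmapS e)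
  have i4 := henter h hhAt (by rw [← h4, U.edge_edge]; exact hmapS _)
  have hknot : U.region xb = U.region b → U.region xh = U.region h → U.region b = U.region h := by
    intro j1 j2
    let κ : Dart ↥(Sᶜ) → U.Region := fun d => if d = Dart.tail then U.region b
      else if d = Dart.head then U.region h else U.region (d.map Subtype.val)
    have hκ : ∀ d, κ (facePerm U₂.edge d) = κ d := by
      intro d
      rw [U₂.facePerm_eq]
      by_cases a1 : U₂.edge d = Dart.tail
      · have hd := U₂.edge_eq_iff.1 a1
        rw [a1, Dart.turn_inv_tail, hd]
        simp [κ, hne1, hth, hb]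
      by_cases a2 : U₂.edge d = Dart.head
      · have hd := U₂.edge_eq_iff.1 a2
        rw [a2, Dart.turn_inv_head, hd]
        simp [κ, hne2, hht, hh]
      have n1 : (Dart.turn ↥(Sᶜ))⁻¹ (U₂.edge d) ≠ Dart.tail := by
        rwa [Ne, Equiv.Perm.inv_eq_iff_eq, Dart.turn_tail]
      have n2 : (Dart.turn ↥(Sᶜ))⁻¹ (U₂.edge d) ≠ Dart.head := by
        rwa [Ne, Equiv.Perm.inv_eq_iff_eq, Dart.turn_head]
      simp only [κ, if_neg n1, if_neg n2, Dart.map_turn_inv, U.region_turn_inv]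
      by_cases a3 : d = Dart.tail
      · subst a3
        rw [if_pos rfl, ← hb, ← h3, U.edge_edge, j1, h3]
      by_cases a4 : d = Dart.head
      · subst a4
        rw [if_neg a3, if_pos rfl, ← hh, ← h4, U.edge_edge, j2, h4]
      rw [if_neg a3, if_neg a4, ← h2 d a3 a4 a1 a2, U.edge_edge]
    have := U₂.eq_of_region_eq hκ hk
    simpa [κ] using this.symm
  -- the boundary of the rider joins the two sides of the carrying edge crosswise
  have hcross : U.region xb = U.region h ∧ U.region xh = U.region b := by
    rcases i1 with i1 | i1 <;> rcases i2 with i2 | i2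
    · rcases i4 with i4 | i4
      · exact ⟨i4, i2.symm⟩
      · exact ⟨i1.symm.trans (i2.trans i4), i2.symm⟩
    · have := hknot i1.symm i2.symm
      exact ⟨i1.symm.trans this, i2.symm.trans this.symm⟩
    · exact ⟨i1.symm, i2.symm⟩
    · rcases i3 with i3 | i3
      · exact ⟨i1.symm, i2.symm.trans (i1.trans i3)⟩
      · exact ⟨i1.symm, i3⟩
  obtain ⟨k1, k2⟩ := hcross
  refine U.isPiece_of_labels U₁ U₂ Subtype.val Subtype.val (card_eq_add_compl S)
    (fun d => U.region (d.map Subtype.val))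
    (fun d => if d = Dart.tail ∨ d = Dart.head then U.star else U.region (d.map Subtype.val))
    (fun d => ?_) (fun d => ?_) rfl ⟨Dart.tail, by simp [star]⟩ (fun c i => rfl)
    (fun c i => by rw [if_neg (by simp)]; rfl) (fun R => ?_)
  · rw [U₁.facePerm_eq, Dart.map_turn_inv, U.region_turn_inv]
    by_cases a1 : d = e
    · subst a1
      rw [← hxh, h4, ← k1]
    by_cases a2 : d = U₁.edge e
    · rw [a2, U₁.edge_edge, ← hxb, h3, ← hxh, k2]
    · rw [← h1 d a1 a2, U.edge_edge]
  · have hstar : U.star ∈ Set.range fun d : Dart S => U.region (d.map Subtype.val) :=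
      ⟨Dart.tail, rfl⟩
    have hbr : U.region b ∈ Set.range fun d : Dart S => U.region (d.map Subtype.val) :=
      ⟨U₁.edge e, k2⟩
    have hhr : U.region h ∈ Set.range fun d : Dart S => U.region (d.map Subtype.val) :=
      ⟨e, k1⟩
    rw [U₂.facePerm_eq]
    by_cases a1 : U₂.edge d = Dart.tail
    · right
      have hd := U₂.edge_eq_iff.1 a1
      rw [a1, Dart.turn_inv_tail, hd, if_pos (Or.inl rfl), if_neg (by simp [hne1, hth]), ← hb]
      exact ⟨hstar, hbr⟩
    by_cases a2 : U₂.edge d = Dart.head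
    · right
      have hd := U₂.edge_eq_iff.1 a2
      rw [a2, Dart.turn_inv_head, hd, if_pos (Or.inr rfl), if_neg (by simp [hne2, hht]), ← hh]
      exact ⟨hstar, hhr⟩
    have n1 : (Dart.turn ↥(Sᶜ))⁻¹ (U₂.edge d) ≠ Dart.tail := by
      rwa [Ne, Equiv.Perm.inv_eq_iff_eq, Dart.turn_tail]
    have n2 : (Dart.turn ↥(Sᶜ))⁻¹ (U₂.edge d) ≠ Dart.head := by
      rwa [Ne, Equiv.Perm.inv_eq_iff_eq, Dart.turn_head]
    rw [if_neg (not_or.2 ⟨n1, n2⟩), Dart.map_turn_inv, U.region_turn_inv]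
    by_cases a3 : d = Dart.tail
    · subst a3
      right
      rw [if_pos (Or.inl rfl), ← hb, ← h3, U.edge_edge, k1]
      exact ⟨hhr, hstar⟩
    by_cases a4 : d = Dart.head
    · subst a4
      right
      rw [if_pos (Or.inr rfl), ← hh, ← h4, U.edge_edge, k2]
      exact ⟨hbr, hstar⟩
    · left
      rw [if_neg (not_or.2 ⟨a3, a4⟩), ← h2 d a3 a4 a1 a2, U.edge_edge]
  · obtain ⟨d, rfl⟩ := U.region_surjective R
    rcases d with _ | _ | ⟨c, i⟩
    · exact Or.inl ⟨Dart.tail, rfl⟩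
    · exact Or.inl ⟨Dart.head, rfl⟩
    · by_cases hc : c ∈ S
      · exact Or.inl ⟨Dart.half ⟨c, hc⟩ i, rfl⟩
      · exact Or.inr ⟨Dart.half ⟨c, hc⟩ i, if_neg (by simp)⟩

end LinkoidUniverse

namespace LinkoidUniverse

/-! ### Construction of universes -/

/-- Half-edges matched by a symmetric relation. -/
theorem exists_edge_of_relation {D : Type*} (r : D → D → Prop) (hex : ∀ d, ∃ d', r d d')
    (hsymm : ∀ d d', r d d' → r d' d) (huniq : ∀ d a b, r d a → r d b → a = b)
    (hirr : ∀ d, ¬ r d d) :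
    ∃ e : Equiv.Perm D, (∀ d, e (e d) = d) ∧ (∀ d, e d ≠ d) ∧ ∀ d, r d (e d) := by
  choose f hf using hex
  have hff : Function.Involutive f := fun d => huniq _ _ _ (hf (f d)) (hsymm _ _ (hf d))
  exact ⟨hff.toPerm, hff, fun d h => hirr d (by
    have h2 := hf d
    rwa [show f d = d from h] at h2), hf⟩

/-- Half-edges matched by an involution `ε` after an injective map. -/
theorem exists_edge_of_injective {D D' : Type*} (ι : D → D') (hι : Function.Injective ι)
    (ε : D' → D') (hε : ∀ d, ε (ε (ι d)) = ι d) (hne : ∀ d, ε (ι d) ≠ ι d)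
    (hex : ∀ d, ∃ d', ι d' = ε (ι d)) :
    ∃ e : Equiv.Perm D, (∀ d, e (e d) = d) ∧ (∀ d, e d ≠ d) ∧ ∀ d, ι (e d) = ε (ι d) :=
  exists_edge_of_relation (fun d d' => ι d' = ε (ι d)) hex (fun d d' h => by rw [h, hε])
    (fun d a b ha hb => hι (ha.trans hb.symm)) (fun d h => hne d h.symm)

/-- The rotation system with edges `e` is connected. -/
def IsConnectedEdge {C : Type u} (e : Equiv.Perm (Dart C)) : Prop :=
  ∀ Z : Dart C → Prop, Z Dart.tail → (∀ d, Z d → Z (e d)) → (∀ d, Z d → Z (Dart.turn C d)) →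
    ∀ d, Z d

section Build

variable {C : Type u} [Finite C] {e : Equiv.Perm (Dart C)} {L : Type*}

/-- A connected rotation system with `n` crossings has at most `n + 1` regions. -/
theorem card_label_le (he : ∀ d, e (e d) = d) (hne : ∀ d, e d ≠ d) (hconn : IsConnectedEdge e)
    (l : Dart C → L) (hl : ∀ d, l (facePerm e d) = l d) (hsurj : Function.Surjective l) :
    Nat.card L ≤ Nat.card C + 1 := by
  classical
  cases nonempty_fintype C
  have key := orbit_euler_inequality (Dart.turn C) e (Dart.turn C).injective he hne Finset.univ
    Dart.tail (fun d => ⟨fun _ => ?_, fun _ => Finset.mem_univ _⟩) Dart.vertex l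
    (fun d _ => Dart.vertex_turn d) (fun d _ => ?_)
  · rw [Finset.image_univ_of_surjective Dart.vertex_surjective, Finset.card_univ,
      Finset.card_univ, Dart.card_eq, Fintype.card_sum, Fintype.card_bool] at key
    have : (Finset.univ.image l).card = Nat.card L := by
      rw [← Set.ncard_univ, ← hsurj.range_eq, ← Set.ncard_coe_finset]
      simp
    rw [Nat.card_eq_fintype_card (α := C)]
    omega
  · exact hconn (fun d => Relation.ReflTransGen (fun a b => b = e a ∨ b = Dart.turn C a) Dart.tail d)
      Relation.ReflTransGen.refl (fun d h => h.tail (Or.inl rfl)) (fun d h => h.tail (Or.inr rfl)) d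
  · rw [← hl]
    simp [facePerm, he]

/-- A connected rotation system with sufficiently many regions is a universe. -/
theorem exists_universe (he : ∀ d, e (e d) = d) (hne : ∀ d, e d ≠ d) (hconn : IsConnectedEdge e)
    (l : Dart C → L) (hl : ∀ d, l (facePerm e d) = l d) (hsurj : Function.Surjective l)
    (hcard : Nat.card C + 1 ≤ Nat.card L) : ∃ V : LinkoidUniverse C, V.edge = e := by
  have hlq : ∀ d d', (facePerm e).SameCycle d d' → l d = l d' := by
    intro d d' h
    obtain ⟨n, -, rfl⟩ := h.exists_pow_eq'
    induction n with
    | zero => rfl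
    | succ k ih => rw [pow_succ', Equiv.Perm.mul_apply, hl]; exact ih ⟨k, by simp⟩
  have h1 := card_label_le he hne hconn
    (fun d => (Quotient.mk (Equiv.Perm.SameCycle.setoid (facePerm e)) d))
    (fun d => Quotient.sound (Equiv.Perm.sameCycle_apply_left.2 (Equiv.Perm.SameCycle.refl _ _)))
    Quotient.mk_surjective
  have : Finite (Quotient (Equiv.Perm.SameCycle.setoid (facePerm e))) := Quotient.finite _
  have h2 := Nat.card_le_card_of_surjective
    (Quotient.lift l hlq : Quotient (Equiv.Perm.SameCycle.setoid (facePerm e)) → L)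
    (fun a => by obtain ⟨d, rfl⟩ := hsurj a; exact ⟨Quotient.mk _ d, rfl⟩)
  refine ⟨⟨e, he, hne, fun d => hconn (fun d => Relation.ReflTransGen
    (fun a b => b = e a ∨ b = Dart.turn C a) Dart.tail d) Relation.ReflTransGen.refl
    (fun d h => h.tail (Or.inl rfl)) (fun d h => h.tail (Or.inr rfl)) d, ?_⟩, rfl⟩
  have : Nat.card (Quotient (Equiv.Perm.SameCycle.setoid (facePerm e))) = Nat.card C + 1 := by
    omega
  rw [this]
  push_cast
  ring

/-- In a universe, labels of the maximal number distinguish the regions. -/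
theorem region_eq_of_label_eq (V : LinkoidUniverse C) (l : Dart C → L)
    (hl : ∀ d, l (facePerm V.edge d) = l d) (hsurj : Function.Surjective l)
    (hcard : Nat.card C + 1 ≤ Nat.card L) {d d' : Dart C} (h : l d = l d') :
    V.region d = V.region d' := by
  let f : V.Region → L := Quotient.lift l fun d d' h =>
    V.eq_of_region_eq hl (V.region_eq_iff.2 h)
  have hf : Function.Surjective f := fun a => by
    obtain ⟨d, rfl⟩ := hsurj a
    exact ⟨V.region d, rfl⟩
  have : Finite L := Finite.of_surjective f hf
  have hle := Nat.card_le_card_of_surjective f hf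
  have hreg := V.card_region
  have hbij : Function.Bijective f := (Nat.bijective_iff_surjective_and_card f).2 ⟨hf, by omega⟩
  exact hbij.1 h

end Build

/-- A set that is closed under turning is a union of vertices, as `turn` has order four. -/
theorem turn_iff_of_imp {C : Type u} {Z : Dart C → Prop} (h : ∀ d, Z d → Z (Dart.turn C d))
    (d : Dart C) : Z (Dart.turn C d) ↔ Z d := by
  refine ⟨fun hd => ?_, h d⟩
  have h4 : Dart.turn C (Dart.turn C (Dart.turn C (Dart.turn C d))) = d := by
    rcases d with _ | _ | ⟨c, k⟩
    · rfl
    · rfl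
    · simp only [Dart.turn_half]
      congr 1
      generalize k = a
      revert a; decide
  rw [← h4]
  exact h _ (h _ (h _ hd))

variable {C : Type u} (U : LinkoidUniverse C)

/-! ### Cutting a universe apart -/

/-- A set `T` of vertices that contains the tail, but not the head, and is connected to the other
vertices by a single edge, which has the same region on both sides, splits off as a factor. -/
theorem exists_composition_of_bridge [Finite C] {T : Dart C → Prop}
    (hT : ∀ d, T (Dart.turn C d) ↔ T d) (htail : T Dart.tail) (hhead : ¬ T Dart.head) (d₀ : Dart C)
    (hcut : ∀ d, T d ∧ ¬ T (U.edge d) ↔ d = d₀) (hreg : U.region d₀ = U.region (U.edge d₀)) :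
    ∃ (U₁ : LinkoidUniverse ↥{c | T (Dart.half c 0)})
      (U₂ : LinkoidUniverse ↥({c | T (Dart.half c 0)}ᶜ)),
      U.IsComposition {c | T (Dart.half c 0)} U₁ U₂ := by
  classical
  have hThalf : ∀ c i, T (Dart.half c i) ↔ T (Dart.half c 0) := fun c i =>
    iff_of_eq (Dart.half_eq_of_turn (fun d => propext (hT d)) c i 0)
  have hTinv : ∀ d, T ((Dart.turn C)⁻¹ d) ↔ T d := fun d => by
    rw [← hT ((Dart.turn C)⁻¹ d)]; simp
  have hd₀ : T d₀ := ((hcut d₀).2 rfl).1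
  have hd₀' : ¬ T (U.edge d₀) := ((hcut d₀).2 rfl).2
  set S : Set C := {c | T (Dart.half c 0)} with hS
  -- the bridge is cut, and its ends become the head of the first and the tail of the second part
  let ι₁ : Dart S → Dart C := fun d => if d = Dart.head then U.edge d₀ else d.map Subtype.val
  let ι₂ : Dart ↥(Sᶜ) → Dart C := fun d => if d = Dart.tail then d₀ else d.map Subtype.val
  have hι₁ : ∀ d, d ≠ Dart.head → ι₁ d = d.map Subtype.val := fun d hd => if_neg hd
  have hι₂ : ∀ d, d ≠ Dart.tail → ι₂ d = d.map Subtype.val := fun d hd => if_neg hd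
  have hι₁h : ι₁ Dart.head = U.edge d₀ := if_pos rfl
  have hι₂t : ι₂ Dart.tail = d₀ := if_pos rfl
  have hT₁ : ∀ d, d ≠ Dart.head → T (ι₁ d) := by
    rintro (_ | _ | ⟨c, i⟩) hd
    · rw [hι₁ _ hd]
      exact htail
    · exact absurd rfl hd
    · rw [hι₁ _ hd]
      exact (hThalf _ _).2 c.2
  have hT₂ : ∀ d, d ≠ Dart.tail → ¬ T (ι₂ d) := by
    rintro (_ | _ | ⟨c, i⟩) hd
    · exact absurd rfl hd
    · rw [hι₂ _ hd]
      exact hhead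
    · rw [hι₂ _ hd]
      exact fun h => c.2 ((hThalf _ _).1 h)
  have hs₁ : ∀ y, T y → ∃ d, d ≠ Dart.head ∧ ι₁ d = y := by
    rintro (_ | _ | ⟨c, i⟩) hy
    · exact ⟨Dart.tail, by simp, hι₁ _ (by simp)⟩
    · exact absurd hy hhead
    · exact ⟨Dart.half ⟨c, (hThalf _ _).1 hy⟩ i, by simp, hι₁ _ (by simp)⟩
  have hs₂ : ∀ y, ¬ T y → ∃ d, d ≠ Dart.tail ∧ ι₂ d = y := by
    rintro (_ | _ | ⟨c, i⟩) hy
    · exact absurd htail hy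
    · exact ⟨Dart.head, by simp, hι₂ _ (by simp)⟩
    · exact ⟨Dart.half ⟨c, fun h => hy ((hThalf _ _).2 h)⟩ i, by simp, hι₂ _ (by simp)⟩
  have hinj₁ : Function.Injective ι₁ := by
    intro a b hab
    by_cases ha : a = Dart.head <;> by_cases hb : b = Dart.head
    · rw [ha, hb]
    · have := hT₁ b hb
      rw [← hab, ha, hι₁h] at this
      exact absurd this hd₀'
    · have := hT₁ a ha
      rw [hab, hb, hι₁h] at this
      exact absurd this hd₀'
    · rw [hι₁ a ha, hι₁ b hb] at hab
      exact Dart.map_injective Subtype.val_injective hab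
  have hinj₂ : Function.Injective ι₂ := by
    intro a b hab
    by_cases ha : a = Dart.tail <;> by_cases hb : b = Dart.tail
    · rw [ha, hb]
    · have := hT₂ b hb
      rw [← hab, ha, hι₂t] at this
      exact absurd hd₀ this
    · have := hT₂ a ha
      rw [hab, hb, hι₂t] at this
      exact absurd hd₀ this
    · rw [hι₂ a ha, hι₂ b hb] at hab
      exact Dart.map_injective Subtype.val_injective hab
  obtain ⟨e₁, he₁, hne₁, hι₁e⟩ := exists_edge_of_injective ι₁ hinj₁ U.edge
    (fun d => U.edge_edge _) (fun d => U.edge_ne _) (fun d => by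
      by_cases hd : d = Dart.head
      · rw [hd, hι₁h, U.edge_edge]
        obtain ⟨d', -, h⟩ := hs₁ d₀ hd₀
        exact ⟨d', h⟩
      by_cases h : T (U.edge (ι₁ d))
      · obtain ⟨d', -, h⟩ := hs₁ _ h
        exact ⟨d', h⟩
      · rw [(hcut _).1 ⟨hT₁ d hd, h⟩]
        exact ⟨_, hι₁h⟩)
  obtain ⟨e₂, he₂, hne₂, hι₂e⟩ := exists_edge_of_injective ι₂ hinj₂ U.edge
    (fun d => U.edge_edge _) (fun d => U.edge_ne _) (fun d => by
      by_cases hd : d = Dart.tail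
      · rw [hd, hι₂t]
        obtain ⟨d', -, h⟩ := hs₂ _ hd₀'
        exact ⟨d', h⟩
      by_cases h : T (U.edge (ι₂ d))
      · have := (hcut _).1 ⟨h, by rw [U.edge_edge]; exact hT₂ d hd⟩
        exact ⟨_, hι₂t.trans this.symm⟩
      · obtain ⟨d', -, h⟩ := hs₂ _ h
        exact ⟨d', h⟩)
  have hconn₁ : IsConnectedEdge e₁ := by
    intro Z h0 hZe hZt
    have key : ∀ y, (∃ d, d ≠ Dart.head ∧ ι₁ d = y ∧ Z d) ∨ (¬ T y ∧ Z Dart.head) := by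
      refine U.dart_induction (Or.inl ⟨Dart.tail, by simp, hι₁ _ (by simp), h0⟩) ?_ ?_
      · rintro y (⟨d, hd, rfl, hZ⟩ | ⟨hy, hZ⟩)
        · rw [← hι₁e]
          by_cases h : e₁ d = Dart.head
          · rw [h, hι₁h]
            exact Or.inr ⟨hd₀', h ▸ hZe _ hZ⟩
          · exact Or.inl ⟨_, h, rfl, hZe _ hZ⟩
        · by_cases h : T (U.edge y)
          · have := (hcut _).1 ⟨h, by rwa [U.edge_edge]⟩
            refine Or.inl ⟨e₁ Dart.head, hne₁ _, ?_, hZe _ hZ⟩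
            rw [hι₁e, hι₁h, U.edge_edge, this]
          · exact Or.inr ⟨h, hZ⟩
      · rintro y (⟨d, hd, rfl, hZ⟩ | ⟨hy, hZ⟩)
        · left
          rw [hι₁ d hd]
          rcases d with _ | _ | ⟨c, i⟩
          · exact ⟨Dart.tail, hd, hι₁ _ hd, hZ⟩
          · exact absurd rfl hd
          · exact ⟨Dart.half c (i + 1), by simp, hι₁ _ (by simp), hZt _ hZ⟩
        · exact Or.inr ⟨by rwa [hT], hZ⟩
    intro d
    rcases key (ι₁ d) with ⟨d', hd', h, hZ⟩ | ⟨h, hZ⟩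
    · rwa [← hinj₁ h]
    · by_cases hd : d = Dart.head
      · rwa [hd]
      · exact absurd (hT₁ d hd) h
  have hconn₂ : IsConnectedEdge e₂ := by
    intro Z h0 hZe hZt
    have key : ∀ y, (∃ d, d ≠ Dart.tail ∧ ι₂ d = y ∧ Z d) ∨ T y := by
      refine U.dart_induction (Or.inr htail) ?_ ?_
      · rintro y (⟨d, hd, rfl, hZ⟩ | hy)
        · rw [← hι₂e]
          by_cases h : e₂ d = Dart.tail
          · rw [h, hι₂t]
            exact Or.inr hd₀
          · exact Or.inl ⟨_, h, rfl, hZe _ hZ⟩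
        · by_cases h : T (U.edge y)
          · exact Or.inr h
          · rw [(hcut y).1 ⟨hy, h⟩]
            refine Or.inl ⟨e₂ Dart.tail, hne₂ _, ?_, hZe _ h0⟩
            rw [hι₂e, hι₂t]
      · rintro y (⟨d, hd, rfl, hZ⟩ | hy)
        · left
          rw [hι₂ d hd]
          rcases d with _ | _ | ⟨c, i⟩
          · exact absurd rfl hd
          · exact ⟨Dart.head, hd, hι₂ _ hd, hZ⟩
          · exact ⟨Dart.half c (i + 1), by simp, hι₂ _ (by simp), hZt _ hZ⟩
        · exact Or.inr (by rwa [hT])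
    intro d
    by_cases hd : d = Dart.tail
    · rwa [hd]
    rcases key (ι₂ d) with ⟨d', hd', h, hZ⟩ | h
    · rwa [← hinj₂ h]
    · exact absurd h (hT₂ d hd)
  -- the faces of a part are labelled by the regions that the part touches
  let l₁ : Dart S → {R : U.Region // ∃ y, T y ∧ U.region y = R} := fun d => ⟨U.region (ι₁ d), by
    by_cases hd : d = Dart.head
    · exact ⟨d₀, hd₀, by rw [hd, hι₁h, hreg]⟩
    · exact ⟨_, hT₁ d hd, rfl⟩⟩
  let l₂ : Dart ↥(Sᶜ) → {R : U.Region // ∃ y, ¬ T y ∧ U.region y = R} :=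
    fun d => ⟨U.region (ι₂ d), by
      by_cases hd : d = Dart.tail
      · exact ⟨_, hd₀', by rw [hd, hι₂t, hreg]⟩
      · exact ⟨_, hT₂ d hd, rfl⟩⟩
  have hl₁ : ∀ d, l₁ (facePerm e₁ d) = l₁ d := by
    intro d
    refine Subtype.ext ?_
    change U.region (ι₁ ((Dart.turn S)⁻¹ (e₁ d))) = U.region (ι₁ d)
    by_cases h : e₁ d = Dart.head
    · have hd : d = e₁ Dart.head := by rw [← h, he₁]
      rw [h, Dart.turn_inv_head, hd, hι₁e, hι₁h, U.edge_edge, hreg]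
    · have hne : (Dart.turn S)⁻¹ (e₁ d) ≠ Dart.head := by
        rwa [Ne, Equiv.Perm.inv_eq_iff_eq, Dart.turn_head]
      rw [hι₁ _ hne, Dart.map_turn_inv, U.region_turn_inv, ← hι₁ _ h, hι₁e, U.edge_edge]
  have hl₂ : ∀ d, l₂ (facePerm e₂ d) = l₂ d := by
    intro d
    refine Subtype.ext ?_
    change U.region (ι₂ ((Dart.turn ↥(Sᶜ))⁻¹ (e₂ d))) = U.region (ι₂ d)
    by_cases h : e₂ d = Dart.tail
    · have hd : d = e₂ Dart.tail := by rw [← h, he₂]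
      rw [h, Dart.turn_inv_tail, hd, hι₂e, hι₂t, hreg]
    · have hne : (Dart.turn ↥(Sᶜ))⁻¹ (e₂ d) ≠ Dart.tail := by
        rwa [Ne, Equiv.Perm.inv_eq_iff_eq, Dart.turn_tail]
      rw [hι₂ _ hne, Dart.map_turn_inv, U.region_turn_inv, ← hι₂ _ h, hι₂e, U.edge_edge]
  have hsurj₁ : Function.Surjective l₁ := by
    rintro ⟨R, y, hy, rfl⟩
    obtain ⟨d, -, rfl⟩ := hs₁ y hy
    exact ⟨d, rfl⟩
  have hsurj₂ : Function.Surjective l₂ := by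
    rintro ⟨R, y, hy, rfl⟩
    obtain ⟨d, -, rfl⟩ := hs₂ y hy
    exact ⟨d, rfl⟩
  have c1 := card_label_le he₁ hne₁ hconn₁ l₁ hl₁ hsurj₁
  have c2 := card_label_le he₂ hne₂ hconn₂ l₂ hl₂ hsurj₂
  have c0 := U.card_region
  rw [card_eq_add_compl S] at c0
  -- both parts have the region along the bridge
  have c3 : Nat.card U.Region + 1 ≤ Nat.card {R : U.Region // ∃ y, T y ∧ U.region y = R} +
      Nat.card {R : U.Region // ∃ y, ¬ T y ∧ U.region y = R} := by
    have hun : {R : U.Region | ∃ y, T y ∧ U.region y = R} ∪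
        {R : U.Region | ∃ y, ¬ T y ∧ U.region y = R} = Set.univ := by
      refine Set.eq_univ_of_forall fun R => ?_
      obtain ⟨y, rfl⟩ := U.region_surjective R
      by_cases hy : T y
      exacts [Or.inl ⟨y, hy, rfl⟩, Or.inr ⟨y, hy, rfl⟩]
    have hin : 0 < ({R : U.Region | ∃ y, T y ∧ U.region y = R} ∩
        {R : U.Region | ∃ y, ¬ T y ∧ U.region y = R}).ncard := by
      rw [Set.ncard_pos]
      exact ⟨U.region d₀, ⟨d₀, hd₀, rfl⟩, ⟨_, hd₀', hreg.symm⟩⟩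
    have := Set.ncard_union_add_ncard_inter {R : U.Region | ∃ y, T y ∧ U.region y = R}
      {R : U.Region | ∃ y, ¬ T y ∧ U.region y = R}
    rw [hun, Set.ncard_univ] at this
    change _ ≤ Nat.card ↥{R : U.Region | ∃ y, T y ∧ U.region y = R} +
      Nat.card ↥{R : U.Region | ∃ y, ¬ T y ∧ U.region y = R}
    rw [Nat.card_coe_set_eq, Nat.card_coe_set_eq]
    omega
  obtain ⟨U₁, rfl⟩ := exists_universe he₁ hne₁ hconn₁ l₁ hl₁ hsurj₁ (by omega)
  obtain ⟨U₂, rfl⟩ := exists_universe he₂ hne₂ hconn₂ l₂ hl₂ hsurj₂ (by omega)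
  refine ⟨U₁, U₂, fun d hd hd' => ?_, fun d hd hd' => ?_, ?_⟩
  · rw [← hι₁ d hd, ← hι₁ _ hd', hι₁e]
  · rw [← hι₂ d hd, ← hι₂ _ hd', hι₂e]
  · rw [← hι₁ _ (hne₁ _), ← hι₂ _ (hne₂ _), hι₁e, hι₂e, hι₁h, hι₂t, U.edge_edge]

/-- In a prime universe only the edges at the tail and the head have the same region on both
sides. -/
theorem IsPrime.bridge [Finite C] {U : LinkoidUniverse C} (hU : U.IsPrime) {d : Dart C}
    (hd : U.region d = U.region (U.edge d)) :
    (d = Dart.tail ∨ d = Dart.head) ∨ (U.edge d = Dart.tail ∨ U.edge d = Dart.head) := by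
  classical
  cases nonempty_fintype C
  by_contra hcon
  push Not at hcon
  obtain ⟨⟨n1, n2⟩, n3, n4⟩ := hcon
  have hne := U.edge_ne d
  -- a closed curve that crosses this edge only cuts the sphere in two
  obtain ⟨g, hgt, hge⟩ := U.exists_potential
    (fun y => (if y = d then 1 else 0) - (if y = U.edge d then 1 else 0))
    (fun y => by
      have : U.edge y = d ↔ y = U.edge d := U.edge_eq_iff
      simp [this])
    (fun a => by simp [mul_sub, hd])
  have hgd := hge d
  rw [if_pos rfl, if_neg hne.symm] at hgd
  have hother : ∀ y, y ≠ d → y ≠ U.edge d → g (U.edge y) = g y := fun y h1 h2 => by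
    have := hge y
    rw [if_neg h1, if_neg h2] at this
    linarith
  have hcut : ∀ y, g y = g d ∧ ¬ g (U.edge y) = g d ↔ y = d := by
    intro y
    constructor
    · rintro ⟨h1, h2⟩
      by_contra hy
      by_cases hy' : y = U.edge d
      · rw [hy'] at h1; linarith
      · exact h2 ((hother y hy hy').trans h1)
    · rintro rfl
      exact ⟨rfl, fun h => by linarith⟩
  have hcase : ∀ (T : Dart C → Prop) (d : Dart C), d ≠ Dart.tail → d ≠ Dart.head →
      U.edge d ≠ Dart.tail → U.edge d ≠ Dart.head → U.region d = U.region (U.edge d) →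
      (∀ y, T (Dart.turn C y) ↔ T y) → T Dart.tail → ¬ T Dart.head →
      (∀ y, T y ∧ ¬ T (U.edge y) ↔ y = d) → False := by
    intro T d n1 n2 n3 n4 hd hT h1 h2 hcut
    obtain ⟨U₁, U₂, h⟩ := U.exists_composition_of_bridge hT h1 h2 d hcut hd
    obtain ⟨hd1, hd2⟩ := (hcut d).2 rfl
    have hThalf : ∀ c i, T (Dart.half c i) ↔ T (Dart.half c 0) := fun c i =>
      iff_of_eq (Dart.half_eq_of_turn (fun d => propext (hT d)) c i 0)
    refine hU ⟨_, U₁, U₂, ?_, ?_, h⟩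
    · rcases d with _ | _ | ⟨c, i⟩
      · exact absurd rfl n1
      · exact absurd rfl n2
      · exact ⟨c, (hThalf c i).1 hd1⟩
    · generalize U.edge d = y at n3 n4 hd2
      rcases y with _ | _ | ⟨c, i⟩
      · exact absurd rfl n3
      · exact absurd rfl n4
      · exact ⟨c, fun hc => hd2 ((hThalf c i).2 hc)⟩
  have hpar := U.tail_iff_not_head_of_one (fun y => g y = g d) (fun y => by rw [hgt]) d hcut
  by_cases h : g Dart.tail = g d
  · exact hcase (fun y => g y = g d) d n1 n2 n3 n4 hd (fun y => by rw [hgt]) h (hpar.1 h) hcut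
  · refine hcase (fun y => ¬ g y = g d) (U.edge d) n3 n4 (by rwa [U.edge_edge])
      (by rwa [U.edge_edge]) (by rw [U.edge_edge, hd]) (fun y => by rw [hgt]) h ?_ (fun y => ?_)
    · tauto
    · rw [← U.edge_eq_iff, ← hcut, U.edge_edge]
      tauto

end LinkoidUniverse

namespace LinkoidUniverse

variable {C : Type u} {U : LinkoidUniverse C}

/-! ### Cutting two edges of a prime universe -/

/-- Two edges that bound a part of a prime universe do not have the same region on both sides. -/
theorem IsPrime.region_ne_of_two_cut [Finite C] (hU : U.IsPrime) {S : Set C} (hS : S.Nonempty)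
    {b h : Dart C} (hbh : b ≠ h)
    (hcut : ∀ y, Dart.At Sᶜ y ∧ ¬ Dart.At Sᶜ (U.edge y) ↔ y = b ∨ y = h) :
    U.region b ≠ U.region (U.edge b) := by
  have hend : ∀ x, (x = b ∨ x = h) → U.region x = U.region (U.edge x) →
      U.edge x = Dart.tail ∨ U.edge x = Dart.head := by
    intro x hx hreg
    rcases hU.bridge hreg with (rfl | rfl) | h1
    · exact absurd ((hcut _).2 hx).1 (by simp)
    · exact absurd ((hcut _).2 hx).1 (by simp)
    · exact h1
  intro hreg
  have hb := (hcut b).2 (Or.inl rfl)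
  have hh := (hcut h).2 (Or.inr rfl)
  have hxb := hend b (Or.inl rfl) hreg
  have hne : U.edge b ≠ U.edge h := fun e => hbh (U.edge.injective e)
  have hturn : ∀ x y : Dart C, (x = Dart.tail ∨ x = Dart.head) → (Dart.turn C y = x ↔ y = x) := by
    rintro x (_ | _ | ⟨c, i⟩) (rfl | rfl) <;> simp
  -- the part together with the end of the first edge is left along the second edge only
  obtain ⟨y, hy, h1, h2⟩ := U.exists_return (T := fun y => Dart.At Sᶜ y ∨ y = U.edge b)
    (fun y => by rw [Dart.at_turn, hturn _ _ hxb]) (d := h) (Or.inl hh.1)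
    (fun e => e.elim hh.2 fun e => hne e.symm)
  push Not at h1
  have hyh : U.edge y = h := by
    rcases h2 with h2 | h2
    · rcases (hcut (U.edge y)).1 ⟨h2, by rw [U.edge_edge]; exact h1.1⟩ with e | e
      · exact absurd (U.edge_eq_iff.1 e) h1.2
      · exact e
    · exact absurd (U.edge.injective h2 ▸ hb.1) h1.1
  have hyx : y = U.edge h := U.edge_eq_iff.1 hyh
  have hxh := hend h (Or.inr rfl) (by rw [← hyx, hy])
  have hends : ∀ x : Dart C, x = Dart.tail ∨ x = Dart.head → x = U.edge b ∨ x = U.edge h := by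
    rcases hxb with e1 | e1 <;> rcases hxh with e2 | e2 <;> rw [e1, e2] at hne ⊢
    · exact absurd rfl hne
    · exact fun _ h => h
    · exact fun _ h => h.symm
    · exact absurd rfl hne
  have key : ∀ y, Dart.At Sᶜ y ∨ (y = Dart.tail ∨ y = Dart.head) := by
    refine U.dart_induction (Or.inr (Or.inl rfl)) ?_ ?_
    · rintro y (hy | hy)
      · by_cases hc : Dart.At Sᶜ (U.edge y)
        · exact Or.inl hc
        · rcases (hcut y).1 ⟨hy, hc⟩ with rfl | rfl
          exacts [Or.inr hxb, Or.inr hxh]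
      · left
        rcases hends y hy with rfl | rfl
        · rw [U.edge_edge]; exact hb.1
        · rw [U.edge_edge]; exact hh.1
    · rintro y (hy | rfl | rfl)
      · left; rwa [Dart.at_turn]
      · right; left; rfl
      · right; right; rfl
  obtain ⟨c, hc⟩ := hS
  rcases key (Dart.half c 0) with h | h | h
  · exact h hc
  · cases h
  · cases h

/-- A part of a prime universe that is bounded by two edges, contains no endpoint, and does not
contain all crossings, is a rider. -/
theorem IsPrime.hasRider_of_two_cut [Finite C] (hU : U.IsPrime) {S : Set C} (hS : S.Nonempty)
    {b h : Dart C} (hbh : b ≠ h)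
    (hcut : ∀ y, Dart.At Sᶜ y ∧ ¬ Dart.At Sᶜ (U.edge y) ↔ y = b ∨ y = h) : U.HasRider := by
  classical
  have hb := (hcut b).2 (Or.inl rfl)
  have hh := (hcut h).2 (Or.inr rfl)
  have hnb := hU.region_ne_of_two_cut hS hbh hcut
  have hnh := hU.region_ne_of_two_cut hS hbh.symm (fun y => (hcut y).trans or_comm)
  have hret : ∀ x, (x = b ∨ x = h) → ∃ y, (y = b ∨ y = h) ∧ U.region y = U.region (U.edge x) := by
    intro x hx
    have h0 := (hcut x).2 hx
    obtain ⟨y, hy, h1, h2⟩ := U.exists_return (T := fun y => ¬ Dart.At Sᶜ y)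
      (fun y => by rw [Dart.at_turn]) (d := U.edge x) h0.2 (by rw [U.edge_edge]; exact not_not.2 h0.1)
    exact ⟨y, (hcut y).1 ⟨not_not.1 h1, h2⟩, hy⟩
  have hregb : U.region h = U.region (U.edge b) := by
    obtain ⟨y, rfl | rfl, hy⟩ := hret b (Or.inl rfl)
    exacts [absurd hy hnb, hy]
  have hregh : U.region b = U.region (U.edge h) := by
    obtain ⟨y, rfl | rfl, hy⟩ := hret h (Or.inr rfl)
    exacts [hy, absurd hy hnh]
  have hxne : U.edge b ≠ U.edge h := fun e => hbh (U.edge.injective e)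
  have hout : ∀ y, Dart.At Sᶜ y → ¬ Dart.At Sᶜ (U.edge y) → y = b ∨ y = h :=
    fun y h1 h2 => (hcut y).1 ⟨h1, h2⟩
  have hin : ∀ y, ¬ Dart.At Sᶜ y → Dart.At Sᶜ (U.edge y) → y = U.edge b ∨ y = U.edge h := by
    intro y h1 h2
    rw [← U.edge_eq_iff, ← U.edge_eq_iff]
    exact hout _ h2 (by rwa [U.edge_edge])
  -- the carrier, in which the outer ends of the two edges are joined
  let ι₁ : Dart S → Dart C := fun d => d.map Subtype.val
  have hι₁inj : Function.Injective ι₁ := Dart.map_injective Subtype.val_injective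
  have hι₁at : ∀ d, ¬ Dart.At Sᶜ (ι₁ d) := by
    rintro (_ | _ | ⟨c, i⟩)
    exacts [id, id, fun h => h c.2]
  have hs₁ : ∀ y, ¬ Dart.At Sᶜ y → ∃ d, ι₁ d = y := by
    rintro (_ | _ | ⟨c, i⟩) hy
    · exact ⟨Dart.tail, rfl⟩
    · exact ⟨Dart.head, rfl⟩
    · exact ⟨Dart.half ⟨c, not_not.1 hy⟩ i, rfl⟩
  -- the rider, whose endpoints are the outer ends of the two edges
  let ι₂ : Dart ↥(Sᶜ) → Dart C := fun d =>
    if d = Dart.tail then U.edge b else if d = Dart.head then U.edge h else d.map Subtype.val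
  have hι₂t : ι₂ Dart.tail = U.edge b := if_pos rfl
  have hι₂h : ι₂ Dart.head = U.edge h := by simp [ι₂]
  have hι₂ : ∀ d, d ≠ Dart.tail → d ≠ Dart.head → ι₂ d = d.map Subtype.val := fun d h1 h2 => by
    simp [ι₂, h1, h2]
  have hι₂half : ∀ c i, ι₂ (Dart.half c i) = Dart.half c.1 i := fun c i => hι₂ _ (by simp) (by simp)
  have hs₂ : ∀ y, Dart.At Sᶜ y → ∃ c i, y = ι₂ (Dart.half c i) := by
    rintro (_ | _ | ⟨c, i⟩) hy
    · exact hy.elim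
    · exact hy.elim
    · exact ⟨⟨c, hy⟩, i, (hι₂half ⟨c, hy⟩ i).symm⟩
  have hι₂at : ∀ c i, Dart.At Sᶜ (ι₂ (Dart.half c i)) := fun c i => by
    rw [hι₂half]; exact c.2
  have hι₂inj : Function.Injective ι₂ := by
    rintro (_ | _ | ⟨c, i⟩) (_ | _ | ⟨c', i'⟩) hab
    · rfl
    · rw [hι₂t, hι₂h] at hab; exact absurd hab hxne
    · exact absurd (hι₂at c' i') (by rw [← hab, hι₂t]; exact hb.2)
    · rw [hι₂t, hι₂h] at hab; exact absurd hab.symm hxne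
    · rfl
    · exact absurd (hι₂at c' i') (by rw [← hab, hι₂h]; exact hh.2)
    · exact absurd (hι₂at c i) (by rw [hab, hι₂t]; exact hb.2)
    · exact absurd (hι₂at c i) (by rw [hab, hι₂h]; exact hh.2)
    · rw [hι₂half, hι₂half] at hab
      injection hab with h1 h2
      rw [Subtype.ext h1, h2]
  let ε : Dart C → Dart C := fun y =>
    if y = U.edge b then U.edge h else if y = U.edge h then U.edge b else U.edge y
  have hεb : ε (U.edge b) = U.edge h := if_pos rfl
  have hεh : ε (U.edge h) = U.edge b := by simp [ε, hxne.symm]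
  have hε : ∀ y, y ≠ U.edge b → y ≠ U.edge h → ε y = U.edge y := fun y h1 h2 => by
    simp [ε, h1, h2]
  have hεat : ∀ y, ¬ Dart.At Sᶜ y → ¬ Dart.At Sᶜ (ε y) := by
    intro y hy
    by_cases h1 : y = U.edge b
    · rw [h1, hεb]; exact hh.2
    by_cases h2 : y = U.edge h
    · rw [h2, hεh]; exact hb.2
    rw [hε y h1 h2]
    exact fun h3 => (hin y hy h3).elim h1 h2
  obtain ⟨e₁, he₁, hne₁, hι₁e⟩ := exists_edge_of_injective ι₁ hι₁inj ε (fun d => by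
      by_cases h1 : ι₁ d = U.edge b
      · rw [h1, hεb, hεh]
      by_cases h2 : ι₁ d = U.edge h
      · rw [h2, hεh, hεb]
      rw [hε _ h1 h2, hε, U.edge_edge]
      · exact fun e => hι₁at d (by rw [U.edge.injective e]; exact hb.1)
      · exact fun e => hι₁at d (by rw [U.edge.injective e]; exact hh.1)) (fun d => by
      by_cases h1 : ι₁ d = U.edge b
      · rw [h1, hεb]; exact hxne.symm
      by_cases h2 : ι₁ d = U.edge h
      · rw [h2, hεh]; exact hxne
      rw [hε _ h1 h2]; exact U.edge_ne _) (fun d => hs₁ _ (hεat _ (hι₁at d)))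
  obtain ⟨e₂, he₂, hne₂, hι₂e⟩ := exists_edge_of_injective ι₂ hι₂inj U.edge
    (fun d => U.edge_edge _) (fun d => U.edge_ne _) (fun d => by
      have : Dart.At Sᶜ (U.edge (ι₂ d)) ∨ U.edge (ι₂ d) = U.edge b ∨ U.edge (ι₂ d) = U.edge h := by
        rcases d with _ | _ | ⟨c, i⟩
        · left; rw [hι₂t, U.edge_edge]; exact hb.1
        · left; rw [hι₂h, U.edge_edge]; exact hh.1
        · by_cases h1 : Dart.At Sᶜ (U.edge (ι₂ (Dart.half c i)))
          · exact Or.inl h1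
          · right
            rcases hout _ (hι₂at c i) h1 with e | e <;> simp [e]
      rcases this with h1 | h1 | h1
      · obtain ⟨c, i, h1⟩ := hs₂ _ h1
        exact ⟨_, h1.symm⟩
      · exact ⟨_, hι₂t.trans h1.symm⟩
      · exact ⟨_, hι₂h.trans h1.symm⟩)
  obtain ⟨a, ha⟩ := hs₁ _ hb.2
  have he₁a : ι₁ (e₁ a) = U.edge h := by rw [hι₁e, ha, hεb]
  have hconn₁ : IsConnectedEdge e₁ := by
    intro Z h0 hZe hZt
    have key : ∀ y, (∃ d, ι₁ d = y ∧ Z d) ∨ (Dart.At Sᶜ y ∧ Z a) := by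
      refine U.dart_induction (Or.inl ⟨Dart.tail, rfl, h0⟩) ?_ ?_
      · rintro y (⟨d, rfl, hZ⟩ | ⟨hy, hZ⟩)
        · by_cases h1 : ι₁ d = U.edge b
          · right
            rw [h1, U.edge_edge, hι₁inj (ha.trans h1.symm)]
            exact ⟨hb.1, hZ⟩
          by_cases h2 : ι₁ d = U.edge h
          · right
            rw [h2, U.edge_edge]
            refine ⟨hh.1, ?_⟩
            rw [← he₁ a, hι₁inj (he₁a.trans h2.symm)]
            exact hZe _ hZ
          · exact Or.inl ⟨e₁ d, by rw [hι₁e, hε _ h1 h2], hZe _ hZ⟩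
        · by_cases h1 : Dart.At Sᶜ (U.edge y)
          · exact Or.inr ⟨h1, hZ⟩
          · left
            rcases hout y hy h1 with rfl | rfl
            exacts [⟨a, ha, hZ⟩, ⟨_, he₁a, hZe _ hZ⟩]
      · rintro y (⟨d, rfl, hZ⟩ | ⟨hy, hZ⟩)
        · exact Or.inl ⟨Dart.turn S d, by cases d <;> rfl, hZt _ hZ⟩
        · exact Or.inr ⟨by rwa [Dart.at_turn], hZ⟩
    intro d
    rcases key (ι₁ d) with ⟨d', h1, hZ⟩ | ⟨h1, hZ⟩
    · rwa [← hι₁inj h1]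
    · exact absurd h1 (hι₁at d)
  have hconn₂ : IsConnectedEdge e₂ := by
    intro Z h0 hZe hZt
    have hhead : Z Dart.head :=
      (tail_iff_head_of_closed e₂ he₂ hne₂ Z (turn_iff_of_imp hZt) hZe).1 h0
    have key : ∀ y, (∃ c i, ι₂ (Dart.half c i) = y ∧ Z (Dart.half c i)) ∨ ¬ Dart.At Sᶜ y := by
      refine U.dart_induction (Or.inr id) ?_ ?_
      · rintro y (⟨c, i, rfl, hZ⟩ | hy)
        · by_cases h1 : Dart.At Sᶜ (U.edge (ι₂ (Dart.half c i)))
          · left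
            obtain ⟨c', i', h2⟩ := hs₂ _ h1
            refine ⟨c', i', h2.symm, ?_⟩
            rw [← hι₂inj ((hι₂e (Dart.half c i)).trans h2)]
            exact hZe _ hZ
          · exact Or.inr h1
        · by_cases h1 : Dart.At Sᶜ (U.edge y)
          · left
            obtain ⟨c', i', h2⟩ := hs₂ _ h1
            refine ⟨c', i', h2.symm, ?_⟩
            rcases hin y hy h1 with rfl | rfl
            · rw [← hι₂inj (show ι₂ (e₂ Dart.tail) = ι₂ (Dart.half c' i') by rw [← h2, hι₂e, hι₂t])]
              exact hZe _ h0
            · rw [← hι₂inj (show ι₂ (e₂ Dart.head) = ι₂ (Dart.half c' i') by rw [← h2, hι₂e, hι₂h])]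
              exact hZe _ hhead
          · exact Or.inr h1
      · rintro y (⟨c, i, rfl, hZ⟩ | hy)
        · exact Or.inl ⟨c, i + 1, by rw [hι₂half, hι₂half]; rfl, hZt _ hZ⟩
        · exact Or.inr (by rwa [Dart.at_turn])
    rintro (_ | _ | ⟨c, i⟩)
    · exact h0
    · exact hhead
    · rcases key (ι₂ (Dart.half c i)) with ⟨c', i', h1, hZ⟩ | h1
      · rwa [← hι₂inj h1]
      · exact absurd (hι₂at c i) h1
  -- regions which the carrier touches; for the rider they all become the starred region
  let P : U.Region → Prop := fun R => ∃ y, ¬ Dart.At Sᶜ y ∧ U.region y = R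
  let l₁ : Dart S → {R // P R} := fun d => ⟨U.region (ι₁ d), _, hι₁at d, rfl⟩
  let l₂ : Dart ↥(Sᶜ) → Option {R // ¬ P R} := fun d =>
    if hd : P (U.region (ι₂ d)) then none else some ⟨_, hd⟩
  have hl₂none : ∀ d, P (U.region (ι₂ d)) → l₂ d = none := fun d hd => dif_pos hd
  have hl₂eq : ∀ d d', U.region (ι₂ d) = U.region (ι₂ d') → l₂ d = l₂ d' := fun d d' e => by
    simp only [l₂, e]
  have hl₁ : ∀ d, l₁ (facePerm e₁ d) = l₁ d := by
    intro d
    refine Subtype.ext ?_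
    change U.region (((Dart.turn S)⁻¹ (e₁ d)).map Subtype.val) = U.region (ι₁ d)
    rw [Dart.map_turn_inv, U.region_turn_inv]
    change U.region (U.edge (ι₁ (e₁ d))) = _
    rw [hι₁e]
    by_cases h1 : ι₁ d = U.edge b
    · rw [h1, hεb, U.edge_edge, hregb]
    by_cases h2 : ι₁ d = U.edge h
    · rw [h2, hεh, U.edge_edge, hregh]
    rw [hε _ h1 h2, U.edge_edge]
  have hl₂t : l₂ Dart.tail = none := hl₂none _ ⟨_, hb.2, by rw [hι₂t]⟩
  have hl₂h : l₂ Dart.head = none := hl₂none _ ⟨_, hh.2, by rw [hι₂h]⟩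
  have hl₂ : ∀ d, l₂ (facePerm e₂ d) = l₂ d := by
    intro d
    change l₂ ((Dart.turn ↥(Sᶜ))⁻¹ (e₂ d)) = l₂ d
    by_cases h1 : e₂ d = Dart.tail
    · have hd : d = e₂ Dart.tail := by rw [← h1, he₂]
      rw [h1, Dart.turn_inv_tail, hl₂t, hl₂none]
      rw [hd, hι₂e, hι₂t, U.edge_edge, hregh]
      exact ⟨_, hh.2, rfl⟩
    by_cases h2 : e₂ d = Dart.head
    · have hd : d = e₂ Dart.head := by rw [← h2, he₂]
      rw [h2, Dart.turn_inv_head, hl₂h, hl₂none]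
      rw [hd, hι₂e, hι₂h, U.edge_edge, hregb]
      exact ⟨_, hb.2, rfl⟩
    have h3 : (Dart.turn ↥(Sᶜ))⁻¹ (e₂ d) ≠ Dart.tail := by
      rwa [Ne, Equiv.Perm.inv_eq_iff_eq, Dart.turn_tail]
    have h4 : (Dart.turn ↥(Sᶜ))⁻¹ (e₂ d) ≠ Dart.head := by
      rwa [Ne, Equiv.Perm.inv_eq_iff_eq, Dart.turn_head]
    refine hl₂eq _ _ ?_
    rw [hι₂ _ h3 h4, Dart.map_turn_inv, U.region_turn_inv, ← hι₂ _ h1 h2, hι₂e, U.edge_edge]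
  have hsurj₁ : Function.Surjective l₁ := by
    rintro ⟨R, y, hy, rfl⟩
    obtain ⟨d, rfl⟩ := hs₁ y hy
    exact ⟨d, rfl⟩
  have hsurj₂ : Function.Surjective l₂ := by
    rintro (_ | ⟨R, hR⟩)
    · exact ⟨_, hl₂t⟩
    · obtain ⟨y, rfl⟩ := U.region_surjective R
      have hy : Dart.At Sᶜ y := by
        by_contra hy
        exact hR ⟨y, hy, rfl⟩
      obtain ⟨c, i, rfl⟩ := hs₂ y hy
      exact ⟨_, dif_neg hR⟩
  have c1 := card_label_le he₁ hne₁ hconn₁ l₁ hl₁ hsurj₁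
  have c2 := card_label_le he₂ hne₂ hconn₂ l₂ hl₂ hsurj₂
  have c0 := U.card_region
  rw [card_eq_add_compl S] at c0
  have hopt : Nat.card (Option {R // ¬ P R}) = Nat.card {R // ¬ P R} + 1 := Finite.card_option
  have hsum : Nat.card U.Region = Nat.card {R // P R} + Nat.card {R // ¬ P R} := by
    rw [← Nat.card_sum]
    exact Nat.card_congr (Equiv.sumCompl P).symm
  obtain ⟨U₁, rfl⟩ := exists_universe he₁ hne₁ hconn₁ l₁ hl₁ hsurj₁ (by omega)
  obtain ⟨U₂, rfl⟩ := exists_universe he₂ hne₂ hconn₂ l₂ hl₂ hsurj₂ (by omega)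
  have hknot : U₂.IsKnotType :=
    region_eq_of_label_eq U₂ l₂ hl₂ hsurj₂ (by omega) (hl₂h.trans hl₂t.symm)
  have hmap : ∀ d, Dart.At Sᶜ (ι₂ d) → ι₂ d = d.map Subtype.val := by
    rintro (_ | _ | ⟨c, i⟩) hd
    · rw [hι₂t] at hd; exact absurd hd hb.2
    · rw [hι₂h] at hd; exact absurd hd hh.2
    · exact hι₂half c i
  have hSc : Sᶜ.Nonempty := by
    obtain ⟨c, -, -⟩ := hs₂ b hb.1
    exact ⟨c.1, c.2⟩
  refine ⟨S, U₁, a, U₂, hS, hSc, hknot, fun d h1 h2 => ?_, fun d h1 h2 h3 h4 => ?_, ?_, ?_⟩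
  · change U.edge (ι₁ d) = ι₁ (U₁.edge d)
    rw [hι₁e, hε]
    · exact fun e => h1 (hι₁inj (e.trans ha.symm))
    · exact fun e => h2 (hι₁inj (e.trans he₁a.symm))
  · rw [← hι₂ d h1 h2, ← hι₂ _ h3 h4, hι₂e]
  · have h1 : ι₂ (U₂.edge Dart.tail) = b := by rw [hι₂e, hι₂t, U.edge_edge]
    rw [← hmap _ (by rw [h1]; exact hb.1), h1]
    change U.edge (ι₁ a) = b
    rw [ha, U.edge_edge]
  · have h1 : ι₂ (U₂.edge Dart.head) = h := by rw [hι₂e, hι₂h, U.edge_edge]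
    rw [← hmap _ (by rw [h1]; exact hh.1), h1]
    change U.edge (ι₁ (U₁.edge a)) = h
    rw [he₁a, U.edge_edge]

end LinkoidUniverse

namespace LinkoidUniverse

variable {C : Type u} {U : LinkoidUniverse C}

/-! ### The boundary of a simple universe -/

/-- In a simple universe, a set of vertices that contains no endpoint and is bounded by two edges
consists of all crossings, so that these edges lead to the endpoints. -/
theorem IsSimple.region_eq_of_two_cut [Finite C] (hU : U.IsSimple) {A : Dart C → Prop}
    (hA : ∀ d, A (Dart.turn C d) ↔ A d) (ht : ¬ A Dart.tail) (hh : ¬ A Dart.head) {b h : Dart C}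
    (hbh : b ≠ h) (hcut : ∀ y, A y ∧ ¬ A (U.edge y) ↔ y = b ∨ y = h) :
    U.region b = U.region (U.edge b) := by
  by_contra hreg
  have hAt : ∀ y, Dart.At {c | ¬ A (Dart.half c 0)}ᶜ y ↔ A y := by
    rintro (_ | _ | ⟨c, i⟩)
    · exact ⟨False.elim, fun h => ht h⟩
    · exact ⟨False.elim, fun h => hh h⟩
    · rw [Dart.at_half, Set.mem_compl_iff, Set.mem_ofPred_eq, not_not]
      exact iff_of_eq (Dart.half_eq_of_turn (fun d => propext (hA d)) c 0 i)
  refine hU.2 (hU.1.hasRider_of_two_cut (S := {c | ¬ A (Dart.half c 0)}) ?_ hbh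
    (fun y => by rw [hAt, hAt, hcut]))
  have hb := ((hcut b).2 (Or.inl rfl)).2
  rcases hx : U.edge b with _ | _ | ⟨c, i⟩
  · rw [U.edge_eq_iff] at hx
    exact absurd (by rw [hx, U.region_edge_tail, U.edge_edge]; rfl) hreg
  · rw [U.edge_eq_iff] at hx
    exact absurd (by rw [hx, U.region_edge_head, U.edge_edge]) hreg
  · refine ⟨c, fun h => hb ?_⟩
    rw [hx]
    exact (iff_of_eq (Dart.half_eq_of_turn (fun d => propext (hA d)) c 0 i)).1 h

/-- In a simple universe a region other than the starred one has at most one edge in common with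
the starred region. -/
theorem IsSimple.eq_of_adjacent_star [Finite C] (hU : U.IsSimple) {d d' : Dart C}
    (hd : U.region d ≠ U.star) (hdd' : U.region d' = U.region d)
    (he : U.region (U.edge d) = U.star) (he' : U.region (U.edge d') = U.star) : d = d' := by
  classical
  cases nonempty_fintype C
  by_contra hne
  -- a closed curve through the two regions and the two edges cuts the sphere in two
  obtain ⟨g, hgt, hge⟩ := U.exists_potential
    (fun y => ((if y = d then 1 else 0) - (if y = U.edge d then 1 else 0))
      - ((if y = d' then 1 else 0) - (if y = U.edge d' then 1 else 0)))
    (fun y => by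
      have h1 : U.edge y = d ↔ y = U.edge d := U.edge_eq_iff
      have h2 : U.edge y = d' ↔ y = U.edge d' := U.edge_eq_iff
      simp only [h1, h2, U.edge.injective.eq_iff]
      ring)
    (fun a => by simp [mul_sub, Finset.sum_sub_distrib, hdd', he, he'])
  have n1 : d ≠ U.edge d' := fun e => hd (by rw [e, he'])
  have n2 : d' ≠ U.edge d := fun e => n1 (U.edge_eq_iff.1 e.symm).symm.symm
  have hgd : g (U.edge d) - g d = 1 := by
    rw [hge, if_pos rfl, if_neg (U.edge_ne d).symm, if_neg hne, if_neg n1]; ring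
  have hgd' : g (U.edge d') - g d' = -1 := by
    rw [hge, if_neg (Ne.symm hne), if_neg n2, if_pos rfl, if_neg (U.edge_ne d').symm]; ring
  have hother : ∀ y, y ≠ d → y ≠ U.edge d → y ≠ d' → y ≠ U.edge d' → g (U.edge y) = g y := by
    intro y h1 h2 h3 h4
    have := hge y
    rw [if_neg h1, if_neg h2, if_neg h3, if_neg h4] at this
    linarith
  have hout : ∀ y, g y = g d → ¬ g (U.edge y) = g d → y = d ∨ y = d' ∨ y = U.edge d' := by
    intro y h1 h2
    by_contra hcon
    push Not at hcon
    refine h2 ((hother y hcon.1 (fun e => ?_) hcon.2.1 hcon.2.2).trans h1)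
    rw [e] at h1
    linarith
  -- the boundary of the region of `d` leaves the level set of `d` and must return along `d'`
  obtain ⟨y, hy, h1, h2⟩ := U.exists_return (T := fun y => g y = g d) (fun y => by rw [hgt])
    (d := d) rfl (by linarith)
  have hyd : y = d' := by
    rcases hout _ h2 (by rwa [U.edge_edge]) with e | e | e
    · rw [U.edge_eq_iff] at e
      exact absurd (by rw [← hy, e, he]) hd
    · rw [U.edge_eq_iff] at e
      exact absurd (by rw [← hy, e, he']) hd
    · exact U.edge.injective e
  rw [hyd] at h1 h2
  have hcut : ∀ y, g y = g d ∧ ¬ g (U.edge y) = g d ↔ y = d ∨ y = U.edge d' := by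
    intro y
    constructor
    · rintro ⟨h3, h4⟩
      rcases hout y h3 h4 with e | e | e
      · exact Or.inl e
      · exact absurd (e ▸ h3) h1
      · exact Or.inr e
    · rintro (rfl | rfl)
      · exact ⟨rfl, by linarith⟩
      · exact ⟨h2, by rwa [U.edge_edge]⟩
  have hpar := U.tail_iff_head_of_two (fun y => g y = g d) (fun y => by rw [hgt]) _ _ n1 hcut
  by_cases ht : g Dart.tail = g d
  · refine hd ?_
    have := hU.region_eq_of_two_cut (A := fun y => ¬ g y = g d) (fun y => by rw [hgt])
      (not_not.2 ht) (not_not.2 (hpar.1 ht)) (b := U.edge d) (h := d') n2.symm (fun y => by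
        have := hcut (U.edge y)
        rw [U.edge_edge, U.edge_eq_iff, U.edge.injective.eq_iff] at this
        rw [← this]
        tauto)
    rw [U.edge_edge, he] at this
    exact this.symm
  · refine hd ?_
    rw [hU.region_eq_of_two_cut (A := fun y => g y = g d) (fun y => by rw [hgt])
      ht (fun h => ht (hpar.2 h)) n1 hcut, he]

/-- The half-edges at one crossing are not matched among themselves, as the tail is connected to
them. -/
theorem not_closed_at (c : C) : ∃ i, ¬ Dart.At {c} (U.edge (Dart.half c i)) := by
  by_contra hcon
  push Not at hcon
  refine U.dart_induction (Z := fun d => ¬ Dart.At {c} d) id (fun d hd h => hd ?_)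
    (fun d hd => by rwa [Dart.at_turn]) (Dart.half c 0) rfl
  rcases hx : U.edge d with _ | _ | ⟨c', i⟩
  · rw [hx] at h; exact h.elim
  · rw [hx] at h; exact h.elim
  · rw [hx] at h
    obtain rfl : c' = c := h
    rw [← U.edge_edge d, hx]
    exact hcon i

/-- In a simple universe the starred region does not lie only in two opposite corners at a
crossing. -/
theorem IsSimple.not_opposite_star [Finite C] (hU : U.IsSimple) {c : C} {k : ZMod 4}
    (h0 : U.corner c k = U.star) (h1 : U.corner c (k + 1) ≠ U.star)
    (h2 : U.corner c (k + 2) = U.star) (h3 : U.corner c (k + 3) ≠ U.star) : False := by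
  -- a closed curve through `c` and the starred region cuts the sphere in two
  obtain ⟨h, hhe, hhc⟩ := U.exists_height {c} (fun _ => k) (fun _ => k + 2) id (Set.bijOn_id _)
    (fun c' hc' => by rw [Set.mem_singleton_iff.1 hc', h2, id, h0])
  have hturn : ∀ y, ¬ Dart.At {c} y → h (Dart.turn C y) = h y := by
    rintro (_ | _ | ⟨c', i⟩) hy
    · rfl
    · rfl
    · have := hhc c' i
      rw [if_neg (by exact hy)] at this
      exact sub_eq_zero.1 this
  have e0 := hhc c k
  have e1 := hhc c (k + 1)
  have e2 := hhc c (k + 2)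
  have q2 : k + 1 + 1 = k + 2 := by ring
  have q3 : k + 2 + 1 = k + 3 := by ring
  have z1 : (1 : ZMod 4) ≠ 0 := by decide
  have z2 : (2 : ZMod 4) ≠ 0 := by decide
  have z12 : (1 : ZMod 4) ≠ 2 := by decide
  simp [z1, z2, z12, q2, q3] at e0 e1 e2
  -- one of the two levels at `c` does not contain the tail
  have hside : ∀ (w : ℚ) (p : ZMod 4), (∀ i, h (Dart.half c i) = w ↔ i = p ∨ i = p + 1) →
      U.corner c p ≠ U.star → U.corner c (p + 1) = U.star → U.corner c (p + 2) ≠ U.star →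
      U.corner c (p + 3) = U.star → h Dart.tail = w := by
    intro w p hw c0 c1 c2 c3
    have hpz := zmod_four_cases p
    have hp23 : p + 2 ≠ p + 3 := by
      simp only [Ne, add_right_inj]; decide
    by_contra ht
    by_cases hm : U.edge (Dart.half c p) = Dart.half c (p + 1)
    · have hm' : U.edge (Dart.half c (p + 1)) = Dart.half c p := by rw [← hm, U.edge_edge]
      have hm2 : ∀ i, U.edge (Dart.half c (p + 2)) ≠ Dart.half c i := by
        intro i hi
        obtain ⟨j, hj⟩ := U.not_closed_at c
        have hi3 : U.edge (Dart.half c (p + 2)) = Dart.half c (p + 3) := by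
          rcases hpz i with rfl | rfl | rfl | rfl
          · rw [U.edge_eq_iff, hm] at hi
            simp [z12.symm] at hi
          · rw [U.edge_eq_iff, hm'] at hi
            simp [z2] at hi
          · exact absurd hi (U.edge_ne _)
          · exact hi
        rcases hpz j with rfl | rfl | rfl | rfl
        · exact hj (by rw [hm]; rfl)
        · exact hj (by rw [hm']; rfl)
        · exact hj (by rw [hi3]; rfl)
        · exact hj (by rw [← hi3, U.edge_edge]; rfl)
      have hm3 : ∀ i, U.edge (Dart.half c (p + 3)) ≠ Dart.half c i := by
        intro i hi
        rcases hpz i with rfl | rfl | rfl | rfl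
        · rw [U.edge_eq_iff, hm] at hi
          injection hi with _ hi
          exact absurd (add_left_cancel hi) (by decide)
        · rw [U.edge_eq_iff, hm'] at hi
          injection hi with _ hi
          exact absurd (add_eq_left.1 hi) (by decide)
        · exact hm2 _ (U.edge_eq_iff.1 hi).symm
        · exact absurd hi (U.edge_ne _)
      have := hU.region_eq_of_two_cut (A := Dart.At {c}) (fun d => Dart.at_turn _ d) id id
        (b := Dart.half c (p + 2)) (h := Dart.half c (p + 3)) (by simpa using hp23) (fun y => by
          constructor
          · rintro ⟨hy1, hy2⟩
            rcases y with _ | _ | ⟨c', i⟩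
            · exact hy1.elim
            · exact hy1.elim
            · obtain rfl : c' = c := hy1
              rcases hpz i with rfl | rfl | rfl | rfl
              · exact absurd (by rw [hm]; rfl) hy2
              · exact absurd (by rw [hm']; rfl) hy2
              · exact Or.inl rfl
              · exact Or.inr rfl
          · rintro (rfl | rfl)
            · refine ⟨rfl, fun h => ?_⟩
              rcases hx : U.edge (Dart.half c (p + 2)) with _ | _ | ⟨c', i⟩ <;> rw [hx] at h
              · exact h
              · exact h
              · obtain rfl : c' = c := h
                exact hm2 _ hx
            · refine ⟨rfl, fun h => ?_⟩
              rcases hx : U.edge (Dart.half c (p + 3)) with _ | _ | ⟨c', i⟩ <;> rw [hx] at h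
              · exact h
              · exact h
              · obtain rfl : c' = c := h
                exact hm3 _ hx)
      rw [U.region_edge_half] at this
      refine c2 (this.trans ?_)
      rw [show p + 2 - 1 = p + 1 by ring, c1]
    · have hlev : ∀ i j, U.edge (Dart.half c i) = Dart.half c j → (i = p ∨ i = p + 1) → False := by
        intro i j hij hi
        have h4 : h (Dart.half c j) = w := by rw [← hij, hhe]; exact (hw i).2 hi
        have hne : i ≠ j := fun e => U.edge_ne _ (hij.trans (by rw [e]))
        rcases hi with rfl | rfl <;> rcases (hw j).1 h4 with rfl | rfl
        · exact hne rfl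
        · exact hm hij
        · exact hm (U.edge_eq_iff.1 hij).symm
        · exact hne rfl
      have hnot : ∀ i, (i = p ∨ i = p + 1) → ¬ Dart.At {c} (U.edge (Dart.half c i)) := by
        intro i hi h
        rcases hx : U.edge (Dart.half c i) with _ | _ | ⟨c', j⟩ <;> rw [hx] at h
        · exact h
        · exact h
        · obtain rfl : c' = c := h
          exact hlev i j hx hi
      have hturnA : ∀ d, (¬ Dart.At {c} (Dart.turn C d) ∧ h (Dart.turn C d) = w) ↔
          (¬ Dart.At {c} d ∧ h d = w) := fun d => by
        rw [Dart.at_turn]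
        exact and_congr_right fun hd => by rw [hturn d hd]
      have hcut : ∀ y, (¬ Dart.At {c} y ∧ h y = w) ∧ ¬ (¬ Dart.At {c} (U.edge y) ∧ h (U.edge y) = w)
          ↔ y = U.edge (Dart.half c p) ∨ y = U.edge (Dart.half c (p + 1)) := by
        intro y
        constructor
        · rintro ⟨⟨hy1, hy2⟩, hy3⟩
          rw [hhe] at hy3
          have hy4 : Dart.At {c} (U.edge y) := by tauto
          rcases hx : U.edge y with _ | _ | ⟨c', j⟩ <;> rw [hx] at hy4
          · exact hy4.elim
          · exact hy4.elim
          · obtain rfl : c' = c := hy4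
            have := (hw j).1 (by rw [← hx, hhe, hy2])
            rw [U.edge_eq_iff] at hx
            rcases this with rfl | rfl
            exacts [Or.inl hx, Or.inr hx]
        · rintro (rfl | rfl)
          · refine ⟨⟨hnot _ (Or.inl rfl), ?_⟩, fun h => h.1 (by rw [U.edge_edge]; rfl)⟩
            rw [hhe]; exact (hw _).2 (Or.inl rfl)
          · refine ⟨⟨hnot _ (Or.inr rfl), ?_⟩, fun h => h.1 (by rw [U.edge_edge]; rfl)⟩
            rw [hhe]; exact (hw _).2 (Or.inr rfl)
      have hbh : U.edge (Dart.half c p) ≠ U.edge (Dart.half c (p + 1)) := fun e => by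
        simpa [z1] using U.edge.injective e
      have hpar := U.tail_iff_head_of_two _ hturnA _ _ hbh hcut
      have := hU.region_eq_of_two_cut hturnA (fun h => ht h.2) (fun h => ht (hpar.2 h).2) hbh hcut
      rw [U.edge_edge, U.region_edge_half] at this
      refine c0 (this.symm.trans ?_)
      rw [show p - 1 = p + 3 by rw [sub_eq_add_neg]; rfl, c3]
  have hkz := zmod_four_cases k
  have k4 : k + 3 + 1 = k := by rw [add_assoc, show (3 + 1 : ZMod 4) = 0 from rfl, add_zero]
  have k5 : k + 3 + 2 = k + 1 := by rw [add_assoc]; rfl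
  have k6 : k + 3 + 3 = k + 2 := by rw [add_assoc]; rfl
  have k7 : k + 1 + 3 = k := by rw [add_assoc, show (1 + 3 : ZMod 4) = 0 from rfl, add_zero]
  have k8 : k + 1 + 2 = k + 3 := by rw [add_assoc]; rfl
  have a1 := hside (h (Dart.half c k)) (k + 3) (fun i => by
    rw [k4]
    rcases hkz i with rfl | rfl | rfl | rfl
    · simp
    · constructor
      · intro e; linarith
      · rintro (e | e)
        · exact absurd (add_left_cancel e) (by decide)
        · exact absurd (add_eq_left.1 e) (by decide)
    · constructor
      · intro e; linarith
      · rintro (e | e)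
        · exact absurd (add_left_cancel e) (by decide)
        · exact absurd (add_eq_left.1 e) (by decide)
    · exact ⟨fun _ => Or.inl rfl, fun _ => by linarith⟩) h3 (by rw [k4, h0]) (by rwa [k5])
    (by rw [k6, h2])
  have a2 := hside (h (Dart.half c (k + 1))) (k + 1) (fun i => by
    rw [q2]
    rcases hkz i with rfl | rfl | rfl | rfl
    · constructor
      · intro e; linarith
      · rintro (e | e)
        · exact absurd (left_eq_add.1 e) (by decide)
        · exact absurd (left_eq_add.1 e) (by decide)
    · simp
    · exact ⟨fun _ => Or.inr rfl, fun _ => by linarith⟩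
    · constructor
      · intro e; linarith
      · rintro (e | e)
        · exact absurd (add_left_cancel e) (by decide)
        · exact absurd (add_left_cancel e) (by decide)) h1 (by rw [q2, h2]) (by rwa [k8])
    (by rw [k7, h0])
  linarith

/-- In a simple universe that is not a curl, the starred region does not lie in three corners of a
crossing. -/
theorem IsSimple.not_three_star [Finite C] (hU : U.IsSimple) (hcurl : ¬ U.IsCurl) {c : C} {k : ZMod 4}
    (h0 : U.corner c k = U.star) (h1 : U.corner c (k + 1) = U.star)
    (h2 : U.corner c (k + 2) = U.star) : False := by
  have hend : ∀ i, U.corner c i = U.star → U.corner c (i + 1) = U.star →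
      U.edge (Dart.half c (i + 1)) = Dart.tail ∨ U.edge (Dart.half c (i + 1)) = Dart.head := by
    intro i hi hi'
    rcases hU.1.bridge (d := Dart.half c (i + 1)) (by
      rw [U.region_edge_half, add_sub_cancel_right, hi]; exact hi') with h | h
    · simp at h
    · exact h
  have q2 : k + 1 + 1 = k + 2 := by ring
  have q3 : k + 2 + 1 = k + 3 := by ring
  have hk1 := hend k h0 h1
  have hk2 := hend (k + 1) h1 (by rw [q2, h2])
  rw [q2] at hk2
  have n12 : U.edge (Dart.half c (k + 1)) ≠ U.edge (Dart.half c (k + 2)) := fun e => by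
    have := U.edge.injective e
    injection this with _ this
    exact absurd (add_left_cancel this) (by decide)
  have hkz := zmod_four_cases k
  have hends : ∀ x, x = Dart.tail ∨ x = Dart.head →
      x = U.edge (Dart.half c (k + 1)) ∨ x = U.edge (Dart.half c (k + 2)) := by
    rcases hk1 with e1 | e1 <;> rcases hk2 with e2 | e2 <;> rw [e1, e2] at n12 ⊢
    · exact absurd rfl n12
    · exact fun _ h => h
    · exact fun _ h => h.symm
    · exact absurd rfl n12
  have h3 : U.corner c (k + 3) ≠ U.star := by
    intro h3
    have hk3 := hend (k + 2) h2 (by rw [q3, h3])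
    rw [q3] at hk3
    rcases hends _ hk3 with e | e
    all_goals
      have := U.edge.injective e
      injection this with _ this
      exact absurd (add_left_cancel this) (by decide)
  have hnend : ∀ i, (i = k ∨ i = k + 3) →
      ¬ (U.edge (Dart.half c i) = Dart.tail ∨ U.edge (Dart.half c i) = Dart.head) := by
    intro i hi h
    rcases hends _ h with e | e <;> have e := U.edge.injective e <;> injection e with _ e <;>
      rcases hi with rfl | rfl
    · exact absurd (left_eq_add.1 e) (by decide)
    · exact absurd (add_left_cancel e) (by decide)
    · exact absurd (left_eq_add.1 e) (by decide)
    · exact absurd (add_left_cancel e) (by decide)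
  by_cases hm : U.edge (Dart.half c k) = Dart.half c (k + 3)
  -- nothing else is connected to `c` and the endpoints
  · have key : ∀ d, Dart.At {c} d ∨ d = Dart.tail ∨ d = Dart.head := by
      refine U.dart_induction (Or.inr (Or.inl rfl)) ?_ ?_
      · rintro y (hy | hy)
        · rcases y with _ | _ | ⟨c', i⟩
          · exact hy.elim
          · exact hy.elim
          · obtain rfl : c' = c := hy
            rcases hkz i with rfl | rfl | rfl | rfl
            · left; rw [hm]; rfl
            · exact Or.inr hk1
            · exact Or.inr hk2
            · left; rw [← hm, U.edge_edge]; rfl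
        · left
          rcases hends y hy with rfl | rfl <;> rw [U.edge_edge] <;> rfl
      · rintro y (hy | rfl | rfl)
        · left; rwa [Dart.at_turn]
        · right; left; rfl
        · right; right; rfl
    refine hcurl ⟨Nat.card_eq_one_iff_unique.2 ⟨⟨fun a b => ?_⟩, ⟨c⟩⟩, ?_⟩
    · have : ∀ a, a = c := fun a => by
        rcases key (Dart.half a 0) with h | h | h
        · exact h
        · cases h
        · cases h
      rw [this a, this b]
    · unfold IsKnotType
      rcases hends Dart.head (Or.inr rfl) with e | e <;> rw [e, U.region_edge_half]
      · rwa [add_sub_cancel_right]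
      · rwa [show k + 2 - 1 = k + 1 by ring]
  · have hnot : ∀ i, (i = k ∨ i = k + 3) → ¬ Dart.At {c} (U.edge (Dart.half c i)) := by
      intro i hi h
      rcases hx : U.edge (Dart.half c i) with _ | _ | ⟨c', j⟩ <;> rw [hx] at h
      · exact h
      · exact h
      · obtain rfl : c' = c := h
        have hx' := (U.edge_eq_iff.1 hx).symm
        have hne : i ≠ j := fun e => U.edge_ne _ (hx.trans (by rw [e]))
        rcases hkz j with rfl | rfl | rfl | rfl
        · rcases hi with rfl | rfl
          · exact hne rfl
          · exact hm hx'
        · rw [hx'] at hk1; simp at hk1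
        · rw [hx'] at hk2; simp at hk2
        · rcases hi with rfl | rfl
          · exact hm hx
          · exact hne rfl
    have := hU.region_eq_of_two_cut
      (A := fun y => ¬ Dart.At {c} y ∧ ¬ (y = Dart.tail ∨ y = Dart.head))
      (fun y => by rcases y with _ | _ | ⟨c', i⟩ <;> simp) (by simp) (by simp)
      (b := U.edge (Dart.half c k)) (h := U.edge (Dart.half c (k + 3)))
      (fun e => by
        have := U.edge.injective e
        injection this with _ this
        exact absurd (left_eq_add.1 this) (by decide)) (fun y => by
        constructor
        · rintro ⟨⟨hy1, hy2⟩, hy3⟩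
          by_cases hy4 : U.edge y = Dart.tail ∨ U.edge y = Dart.head
          · rcases hends _ hy4 with e | e <;> rw [U.edge.injective e] at hy1 <;>
              exact absurd rfl hy1
          · have hy5 : Dart.At {c} (U.edge y) := by tauto
            rcases hx : U.edge y with _ | _ | ⟨c', j⟩ <;> rw [hx] at hy5
            · exact hy5.elim
            · exact hy5.elim
            · obtain rfl : c' = c := hy5
              rw [U.edge_eq_iff] at hx
              rcases hkz j with rfl | rfl | rfl | rfl
              · exact Or.inl hx
              · rw [← hx] at hk1; exact absurd hk1 hy2
              · rw [← hx] at hk2; exact absurd hk2 hy2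
              · exact Or.inr hx
        · rintro (rfl | rfl) <;> rw [U.edge_edge]
          · exact ⟨⟨hnot _ (Or.inl rfl), hnend _ (Or.inl rfl)⟩, fun h => h.1 rfl⟩
          · exact ⟨⟨hnot _ (Or.inr rfl), hnend _ (Or.inr rfl)⟩, fun h => h.1 rfl⟩)
    rw [U.edge_edge, U.region_edge_half] at this
    refine h3 ?_
    rw [show k + 3 = k - 1 by rw [sub_eq_add_neg]; rfl, this]
    exact h0

/-- At a boundary crossing of a simple universe that is not a curl, the starred region lies in one
corner, or in two adjacent ones at the edge leading to an endpoint. -/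
theorem IsSimple.star_corners [Finite C] (hU : U.IsSimple) (hcurl : ¬ U.IsCurl) {c : C}
    (hc : U.IsBoundaryCrossing c) :
    (∃ k, ∀ i, U.corner c i = U.star ↔ i = k) ∨
    ∃ k, (∀ i, U.corner c i = U.star ↔ i = k - 1 ∨ i = k) ∧
      (U.edge (Dart.half c k) = Dart.tail ∨ U.edge (Dart.half c k) = Dart.head) := by
  obtain ⟨k, h0⟩ := hc
  have hkz := zmod_four_cases k
  have hbeta : ∀ k, U.corner c (k - 1) = U.star → U.corner c k = U.star →
      U.edge (Dart.half c k) = Dart.tail ∨ U.edge (Dart.half c k) = Dart.head := by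
    intro k hk hk'
    rcases hU.1.bridge (d := Dart.half c k) (by
      rw [U.region_edge_half, hk]; exact hk') with h | h
    · simp at h
    · exact h
  have k4 : k + 3 + 1 = k := by rw [add_assoc, show (3 + 1 : ZMod 4) = 0 from rfl, add_zero]
  have k3 : k - 1 = k + 3 := by rw [sub_eq_add_neg]; rfl
  by_cases h1 : U.corner c (k + 1) = U.star <;> by_cases h2 : U.corner c (k + 2) = U.star <;>
    by_cases h3 : U.corner c (k + 3) = U.star
  · exact (hU.not_three_star hcurl h0 h1 h2).elim
  · exact (hU.not_three_star hcurl h0 h1 h2).elim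
  · exact (hU.not_three_star hcurl h3 (by rwa [k4]) (by rwa [add_assoc,
      show (3 + 2 : ZMod 4) = 1 from rfl])).elim
  · right
    refine ⟨k + 1, fun i => ?_, hbeta _ (by rwa [add_sub_cancel_right]) h1⟩
    rw [add_sub_cancel_right]
    rcases hkz i with rfl | rfl | rfl | rfl
    · simp [h0]
    · simp [h1]
    · simp [h2]; decide
    · simp [h3]; decide
  · exact (hU.not_three_star hcurl h2 (by rwa [add_assoc, show (2 + 1 : ZMod 4) = 3 from rfl])
      (by rwa [add_assoc, show (2 + 2 : ZMod 4) = 0 from rfl, add_zero])).elim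
  · exact (hU.not_opposite_star h0 h1 h2 h3).elim
  · right
    refine ⟨k, fun i => ?_, hbeta _ (by rwa [k3]) h0⟩
    rw [k3]
    rcases hkz i with rfl | rfl | rfl | rfl
    · simp [h0]
    · simp [h1]; decide
    · simp [h2]; decide
    · simp [h3]
  · left
    refine ⟨k, fun i => ?_⟩
    rcases hkz i with rfl | rfl | rfl | rfl
    · simp [h0]
    · simpa [h1] using (by decide : (1 : ZMod 4) ≠ 0)
    · simp [h2]; decide
    · simp [h3]; decide

end LinkoidUniverse

/-! ### Pairing the fixed points of an involution -/

/-- `d'` is the first point fixed by `σ` that is reached from `d` by applying `e`, and then `σ`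
and `e` in turn. -/
def IsRun {D : Type*} (e σ : Equiv.Perm D) (d d' : D) : Prop :=
  ∃ n, 0 < n ∧ ((e * σ) ^ n) d = d' ∧ ∀ m, 0 < m → m < n → σ (((e * σ) ^ m) d) ≠ ((e * σ) ^ m) d

section Run

variable {D : Type*} {e σ : Equiv.Perm D}

/-- Conjugation by `σ` reverses `e * σ`. -/
theorem involution_pow_apply (he : ∀ x, e (e x) = x) (hσ : ∀ x, σ (σ x) = x) (n : ℕ) (x : D) :
    σ (((e * σ) ^ n) x) = ((e * σ) ^ n)⁻¹ (σ x) := by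
  have h : SemiconjBy σ (e * σ) (e * σ)⁻¹ := by
    have h1 : e⁻¹ = e := inv_eq_of_mul_eq_one_left (Equiv.ext he)
    have h2 : σ⁻¹ = σ := inv_eq_of_mul_eq_one_left (Equiv.ext hσ)
    rw [SemiconjBy, mul_inv_rev, h1, h2, mul_assoc]
  have := congrArg (fun f : Equiv.Perm D => f x) (h.pow_right n).eq
  rwa [inv_pow] at this

theorem exists_isRun [Finite D] {d : D} (hd : σ d = d) : ∃ d', σ d' = d' ∧ IsRun e σ d d' := by
  classical
  have hex : ∃ n, 0 < n ∧ σ (((e * σ) ^ n) d) = ((e * σ) ^ n) d :=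
    ⟨orderOf (e * σ), orderOf_pos _, by rw [pow_orderOf_eq_one]; exact hd⟩
  obtain ⟨h1, h2⟩ := Nat.find_spec hex
  exact ⟨_, h2, Nat.find hex, h1, rfl, fun m h3 h4 h5 => Nat.find_min hex h4 ⟨h3, h5⟩⟩

theorem IsRun.unique {d a b : D} (ha : σ a = a) (hb : σ b = b) (h : IsRun e σ d a)
    (h' : IsRun e σ d b) : a = b := by
  obtain ⟨n, h1, h2, h3⟩ := h
  obtain ⟨m, h4, h5, h6⟩ := h'
  rcases lt_trichotomy n m with hnm | rfl | hnm
  · exact absurd (by rw [h2, ha]) (h6 n h1 hnm)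
  · rw [← h2, ← h5]
  · exact absurd (by rw [h5, hb]) (h3 m h4 hnm)

theorem IsRun.symm (he : ∀ x, e (e x) = x) (hσ : ∀ x, σ (σ x) = x) {d d' : D} (hd : σ d = d)
    (hd' : σ d' = d') (h : IsRun e σ d d') : IsRun e σ d' d := by
  obtain ⟨n, h1, h2, h3⟩ := h
  have hback : ∀ m, m ≤ n → ((e * σ) ^ m) d' = σ (((e * σ) ^ (n - m)) d) := by
    intro m hm
    have h4 := involution_pow_apply he hσ m d'
    rw [hd'] at h4
    have h5 : ((e * σ) ^ (n - m)) d = ((e * σ) ^ m)⁻¹ d' := by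
      rw [Equiv.Perm.eq_inv_iff_eq, ← Equiv.Perm.mul_apply, ← pow_add, Nat.add_sub_cancel' hm, h2]
    rw [h5, ← h4, hσ]
  refine ⟨n, h1, by rw [hback n le_rfl, Nat.sub_self, pow_zero, Equiv.Perm.one_apply, hd], ?_⟩
  intro m h4 h5 h6
  rw [hback m h5.le, hσ] at h6
  exact h3 (n - m) (by omega) (by omega) h6.symm

theorem IsRun.ne (he : ∀ x, e (e x) = x) (hσ : ∀ x, σ (σ x) = x) (hne : ∀ x, e x ≠ x) {d : D}
    (hd : σ d = d) : ¬ IsRun e σ d d := by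
  rintro ⟨n, h1, h2, h3⟩
  -- a closed run would be symmetric about a point fixed by `σ` or by `e`
  have hpal : ∀ m, m ≤ n → σ (((e * σ) ^ m) d) = ((e * σ) ^ (n - m)) d := by
    intro m hm
    rw [involution_pow_apply he hσ, hd, Equiv.Perm.inv_eq_iff_eq, ← Equiv.Perm.mul_apply, ← pow_add,
      Nat.add_sub_cancel' hm, h2]
  rcases Nat.even_or_odd' n with ⟨m, rfl | rfl⟩
  · refine h3 m (by omega) (by omega) ?_
    rw [hpal m (by omega), show 2 * m - m = m by omega]
  · have h4 := hpal m (by omega)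
    rw [show 2 * m + 1 - m = m + 1 by omega, pow_succ', Equiv.Perm.mul_apply,
      Equiv.Perm.mul_apply] at h4
    exact hne _ h4.symm

/-- Fixed points of `σ` in one orbit are connected by runs. -/
theorem IsRun.induction {Z : D → Prop}
    (hZ : ∀ d d', σ d = d → σ d' = d' → IsRun e σ d d' → Z d → Z d') {d d' : D} (hd : σ d = d)
    (hd' : σ d' = d') (n : ℕ) (h : ((e * σ) ^ n) d = d') (h0 : Z d) : Z d' := by
  classical
  induction n using Nat.strong_induction_on generalizing d with
  | _ n ih =>
    rcases Nat.eq_zero_or_pos n with rfl | hn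
    · rwa [← h]
    have hex : ∃ m, 0 < m ∧ σ (((e * σ) ^ m) d) = ((e * σ) ^ m) d := ⟨n, hn, by rw [h, hd']⟩
    obtain ⟨h1, h2⟩ := Nat.find_spec hex
    have hle : Nat.find hex ≤ n := Nat.find_min' hex ⟨hn, by rw [h, hd']⟩
    refine ih (n - Nat.find hex) (by omega) h2 ?_ (hZ d _ hd h2
      ⟨Nat.find hex, h1, rfl, fun m h3 h4 h5 => Nat.find_min hex h4 ⟨h3, h5⟩⟩ h0)
    rw [← Equiv.Perm.mul_apply, ← pow_add, Nat.sub_add_cancel hle, h]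

end Run

namespace LinkoidUniverse

variable {C : Type u} {U : LinkoidUniverse C}

/-! ### The rim of a simple universe -/

/-- A simple universe cannot be cut into two parts along edges which all bound the starred region on
exactly one side. -/
theorem IsSimple.not_cut_along_star [Finite C] (hU : U.IsSimple) {g : Dart C → Prop}
    (hg : ∀ d, g (Dart.turn C d) ↔ g d) (h0 : ¬ g Dart.tail)
    (hcut : ∀ d, g d → ¬ g (U.edge d) → (U.region d = U.star ↔ U.region (U.edge d) ≠ U.star))
    (d : Dart C) : ¬ g d := by
  refine U.dart_induction (Z := fun d => ¬ g d) h0 (fun d hd hd' => ?_) (fun d hd => by rwa [hg]) d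
  have hc := hcut (U.edge d) hd' (by rwa [U.edge_edge])
  rw [U.edge_edge] at hc
  by_cases hs : U.region d = U.star
  · obtain ⟨y, hy, h1, h2⟩ := U.exists_return hg (d := U.edge d) hd' (by rwa [U.edge_edge])
    have hsd : U.region (U.edge d) ≠ U.star := fun h => hc.1 h hs
    have hy' : U.region (U.edge y) = U.star := by
      rw [hcut (U.edge y) h2 (by rwa [U.edge_edge]), U.edge_edge, hy]; exact hsd
    exact h1 (hU.eq_of_adjacent_star hsd hy (by rw [U.edge_edge, hs]) hy' ▸ hd')
  · have he := hc.2 hs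
    obtain ⟨y, hy, h1, h2⟩ := U.exists_return (T := fun d => ¬ g d) (fun d => not_congr (hg d))
      (d := d) hd (not_not.2 hd')
    have hy' : U.region (U.edge y) = U.star := by
      by_contra hy'
      exact (hy ▸ hs) ((hcut y (not_not.1 h1) h2).2 hy')
    exact h1 (hU.eq_of_adjacent_star hs hy he hy' ▸ hd)

theorem isInterior_half (c : C) (i : ZMod 4) :
    U.IsInterior (Dart.half c i) ↔ U.corner c i ≠ U.star ∧ U.corner c (i - 1) ≠ U.star := by
  rw [IsInterior, region_edge_half]
  rfl

theorem isInterior_edge (d : Dart C) : U.IsInterior (U.edge d) ↔ U.IsInterior d := by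
  rw [IsInterior, IsInterior, edge_edge, and_comm]

/-- A region on the rim: it is not starred and has an edge in common with the starred region. -/
def IsRim (R : U.Region) : Prop :=
  R ≠ U.star ∧ ∃ x, U.region x = R ∧ U.region (U.edge x) = U.star

theorem isRim_of_next {c : C} {i : ZMod 4} (h : U.corner c (i + 1) ≠ U.star)
    (h' : U.corner c i = U.star) : IsRim (U.corner c (i + 1)) :=
  ⟨h, Dart.half c (i + 1), rfl, by rw [region_edge_half, add_sub_cancel_right, h']⟩

theorem isRim_of_prev {c : C} {i : ZMod 4} (h : U.corner c (i - 1) ≠ U.star)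
    (h' : U.corner c i = U.star) : IsRim (U.corner c (i - 1)) :=
  ⟨h, U.edge (Dart.half c i), by rw [region_edge_half], by rw [edge_edge]; exact h'⟩

/-- Two half-edges at a boundary crossing that the smoothing reconnects with each other. -/
def Joined (U : LinkoidUniverse C) (x y : Dart C) : Prop :=
  ∃ c i j, x = Dart.half c i ∧ y = Dart.half c j ∧ U.IsBoundaryCrossing c ∧ i ≠ j ∧
    U.IsInterior x ∧ U.IsInterior y

theorem Joined.symm {x y : Dart C} (h : U.Joined x y) : U.Joined y x := by
  obtain ⟨c, i, j, h1, h2, h3, h4, h5, h6⟩ := h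
  exact ⟨c, j, i, h2, h1, h3, h4.symm, h6, h5⟩

/-- Half-edges are only joined at crossings where the starred region lies in one corner; there they are
the two which do not bound this corner. -/
theorem IsSimple.joined [Finite C] (hU : U.IsSimple) (hcurl : ¬ U.IsCurl) {x y : Dart C}
    (h : U.Joined x y) : ∃ c k, (∀ i, U.corner c i = U.star ↔ i = k) ∧
      ((x = Dart.half c (k + 2) ∧ y = Dart.half c (k + 3)) ∨
        (x = Dart.half c (k + 3) ∧ y = Dart.half c (k + 2))) := by
  obtain ⟨c, i, j, rfl, rfl, hc, hij, hi, hj⟩ := h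
  rw [isInterior_half] at hi hj
  rcases hU.star_corners hcurl hc with ⟨k, hk⟩ | ⟨k, hk, -⟩
  · refine ⟨c, k, hk, ?_⟩
    simp only [Ne, hk] at hi hj
    have : ∀ k i : ZMod 4, ¬ i = k → ¬ i - 1 = k → i = k + 2 ∨ i = k + 3 := by decide
    rcases this k i hi.1 hi.2 with rfl | rfl <;> rcases this k j hj.1 hj.2 with rfl | rfl
    · exact absurd rfl hij
    · exact Or.inl ⟨rfl, rfl⟩
    · exact Or.inr ⟨rfl, rfl⟩
    · exact absurd rfl hij
  · simp only [Ne, hk] at hi hj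
    have : ∀ k i j : ZMod 4, (¬ (i = k - 1 ∨ i = k) ∧ ¬ (i - 1 = k - 1 ∨ i - 1 = k)) →
        (¬ (j = k - 1 ∨ j = k) ∧ ¬ (j - 1 = k - 1 ∨ j - 1 = k)) → i = j := by decide
    exact absurd (this k i j hi hj) hij

/-- The reconnection of half-edges at the smoothed boundary crossings. -/
theorem IsSimple.exists_joining [Finite C] (hU : U.IsSimple) (hcurl : ¬ U.IsCurl) :
    ∃ σ : Equiv.Perm (Dart C), (∀ x, σ (σ x) = x) ∧ (∀ x, σ x ≠ x → U.Joined x (σ x)) ∧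
      ∀ x y, U.Joined x y → σ x = y := by
  classical
  have huniq : ∀ x y z, U.Joined x y → U.Joined x z → y = z := by
    intro x y z hy hz
    obtain ⟨c, k, hk, h1⟩ := hU.joined hcurl hy
    obtain ⟨c', k', hk', h2⟩ := hU.joined hcurl hz
    have hcc : c = c' := by
      rcases h1 with ⟨rfl, -⟩ | ⟨rfl, -⟩ <;> rcases h2 with ⟨h2, -⟩ | ⟨h2, -⟩ <;> injection h2
    subst hcc
    obtain rfl : k = k' := (hk' k).1 ((hk k).2 rfl)
    have h23 : (Dart.half c (k + 2)) ≠ Dart.half c (k + 3) := fun e => by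
      injection e with _ e
      exact absurd (add_left_cancel e) (by decide)
    rcases h1 with ⟨rfl, rfl⟩ | ⟨rfl, rfl⟩ <;> rcases h2 with ⟨e, rfl⟩ | ⟨e, rfl⟩
    · rfl
    · exact absurd e h23
    · exact absurd e.symm h23
    · rfl
  let f : Dart C → Dart C := fun x => if h : ∃ y, U.Joined x y then h.choose else x
  have hf1 : ∀ x y, U.Joined x y → f x = y := fun x y h => by
    have hex : ∃ y, U.Joined x y := ⟨y, h⟩
    rw [show f x = hex.choose from dif_pos hex]
    exact huniq _ _ _ hex.choose_spec h
  have hf2 : ∀ x, (¬ ∃ y, U.Joined x y) → f x = x := fun x h => dif_neg h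
  have hf : Function.Involutive f := by
    intro x
    by_cases h : ∃ y, U.Joined x y
    · obtain ⟨y, hy⟩ := h
      rw [hf1 x y hy, hf1 y x hy.symm]
    · rw [hf2 x h, hf2 x h]
  refine ⟨hf.toPerm, hf, fun x hx => ?_, hf1⟩
  by_contra hcon
  refine hx (hf2 x ?_)
  rintro ⟨y, hy⟩
  exact hcon (by rw [← hf1 x y hy] at hy; exact hy)

end LinkoidUniverse

namespace LinkoidUniverse

variable {C : Type u} {U : LinkoidUniverse C}

/-! ### The mid-line -/

/-- The crossing next to an endpoint that lies in the starred region. -/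
theorem IsSimple.end_corners [Finite C] [Nonempty C] (hU : U.IsSimple) (hcurl : ¬ U.IsCurl)
    {x : Dart C} (hx : x = Dart.tail ∨ x = Dart.head) (hs : U.region x = U.star) :
    ∃ c k, U.edge x = Dart.half c k ∧ ∀ i, U.corner c i = U.star ↔ i = k - 1 ∨ i = k := by
  rcases he : U.edge x with _ | _ | ⟨c, k⟩
  · rcases hx with rfl | rfl
    · exact absurd he (U.edge_ne _)
    · exact absurd (U.edge_eq_iff.1 he).symm U.edge_tail_ne_head
  · rcases hx with rfl | rfl
    · exact absurd he U.edge_tail_ne_head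
    · exact absurd he (U.edge_ne _)
  · refine ⟨c, k, rfl, ?_⟩
    have h1 : U.corner c k = U.star := by
      rw [corner, ← he, ← hs]
      rcases hx with rfl | rfl
      exacts [U.region_edge_tail, U.region_edge_head]
    have h2 : U.corner c (k - 1) = U.star := by
      rw [← U.region_edge_half, ← he, edge_edge, hs]
    rcases hU.star_corners hcurl ⟨k, h1⟩ with ⟨k', hk'⟩ | ⟨k', hk', -⟩
    · have e1 := (hk' _).1 h1
      have e2 := (hk' _).1 h2
      have : ∀ k k' : ZMod 4, k = k' → k - 1 = k' → False := by decide
      exact (this _ _ e1 e2).elim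
    · have e1 := (hk' _).1 h1
      have e2 := (hk' _).1 h2
      have : ∀ k k' : ZMod 4, (k = k' - 1 ∨ k = k') → (k - 1 = k' - 1 ∨ k - 1 = k') → k = k' := by
        decide
      obtain rfl := this _ _ e1 e2
      exact hk'

theorem midlineDart_half (c : {c : C // ¬ U.IsBoundaryCrossing c}) (i : ZMod 4) :
    U.midlineDart (Dart.half c i) = Dart.half c.1 i := rfl

/-- The mid-line begins next to the tail. -/
theorem IsSimple.midlineDart_tail [Finite C] [Nonempty C] (hU : U.IsSimple) (hcurl : ¬ U.IsCurl) :
    ∃ c k, U.midlineDart Dart.tail = Dart.half c (k + 2) ∧ U.edge Dart.tail = Dart.half c k ∧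
      ∀ i, U.corner c i = U.star ↔ i = k - 1 ∨ i = k := by
  obtain ⟨c, k, h1, h2⟩ := hU.end_corners hcurl (Or.inl rfl) rfl
  exact ⟨c, k, by rw [midlineDart, h1]; rfl, h1, h2⟩

/-- The mid-line ends at the head, or next to it if the head is exterior. -/
theorem IsSimple.midlineDart_head [Finite C] [Nonempty C] (hU : U.IsSimple) (hcurl : ¬ U.IsCurl) :
    (U.region Dart.head ≠ U.star ∧ U.midlineDart Dart.head = Dart.head) ∨
    ∃ c k, U.midlineDart Dart.head = Dart.half c (k + 2) ∧ U.edge Dart.head = Dart.half c k ∧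
      ∀ i, U.corner c i = U.star ↔ i = k - 1 ∨ i = k := by
  by_cases hs : U.region Dart.head = U.star
  · obtain ⟨c, k, h1, h2⟩ := hU.end_corners hcurl (Or.inr rfl) hs
    exact Or.inr ⟨c, k, by rw [midlineDart, if_pos hs, h1]; rfl, h1, h2⟩
  · exact Or.inl ⟨hs, by rw [midlineDart, if_neg hs]⟩

theorem IsSimple.midlineDart_cases [Finite C] [Nonempty C] (hU : U.IsSimple) (hcurl : ¬ U.IsCurl)
    (d : Dart {c : C // ¬ U.IsBoundaryCrossing c}) :
    (∃ c i, d = Dart.half c i ∧ U.midlineDart d = Dart.half c.1 i) ∨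
    (U.region Dart.head ≠ U.star ∧ U.midlineDart d = Dart.head) ∨
    ∃ c k, U.midlineDart d = Dart.half c (k + 2) ∧
      ∀ i, U.corner c i = U.star ↔ i = k - 1 ∨ i = k := by
  rcases d with _ | _ | ⟨c, i⟩
  · obtain ⟨c, k, h1, -, h2⟩ := hU.midlineDart_tail hcurl
    exact Or.inr (Or.inr ⟨c, k, h1, h2⟩)
  · rcases hU.midlineDart_head hcurl with h | ⟨c, k, h1, -, h2⟩
    · exact Or.inr (Or.inl h)
    · exact Or.inr (Or.inr ⟨c, k, h1, h2⟩)
  · exact Or.inl ⟨c, i, rfl, rfl⟩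

theorem IsSimple.isInterior_midlineDart [Finite C] [Nonempty C] (hU : U.IsSimple)
    (hcurl : ¬ U.IsCurl) (d : Dart {c : C // ¬ U.IsBoundaryCrossing c}) :
    U.IsInterior (U.midlineDart d) := by
  rcases hU.midlineDart_cases hcurl d with ⟨c, i, -, h⟩ | ⟨h1, h⟩ | ⟨c, k, h, h2⟩ <;> rw [h]
  · exact (isInterior_half _ _).2 ⟨fun h => c.2 ⟨_, h⟩, fun h => c.2 ⟨_, h⟩⟩
  · exact ⟨h1, by rwa [region_edge_head]⟩
  · rw [isInterior_half, Ne, Ne, h2, h2]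
    generalize k = a
    revert a; decide

theorem IsSimple.not_joined_midlineDart [Finite C] [Nonempty C] (hU : U.IsSimple)
    (hcurl : ¬ U.IsCurl) (d : Dart {c : C // ¬ U.IsBoundaryCrossing c}) (y : Dart C) :
    ¬ U.Joined (U.midlineDart d) y := by
  intro hj
  rcases hU.midlineDart_cases hcurl d with ⟨c, i, -, h⟩ | ⟨h1, h⟩ | ⟨c, k, h, h2⟩ <;> rw [h] at hj
  · obtain ⟨c', i', j', h1, -, h2, -⟩ := hj
    injection h1 with h1
    exact c.2 (h1 ▸ h2)
  · obtain ⟨c', i', j', h1, -⟩ := hj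
    cases h1
  · obtain ⟨c', k', h3, h4⟩ := hU.joined hcurl hj
    have hcc : c = c' := by
      rcases h4 with ⟨h4, -⟩ | ⟨h4, -⟩ <;> injection h4
    subst hcc
    have e1 := (h3 _).1 ((h2 (k - 1)).2 (Or.inl rfl))
    have e2 := (h3 _).1 ((h2 k).2 (Or.inr rfl))
    exact absurd (e1.trans e2.symm) (by simpa using (by decide : (1 : ZMod 4) ≠ 0))

theorem IsSimple.midlineDart_injective [Finite C] [Nonempty C] (hU : U.IsSimple)
    (hcurl : ¬ U.IsCurl) : Function.Injective U.midlineDart := by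
  obtain ⟨c, k, h1, h2, h3⟩ := hU.midlineDart_tail hcurl
  have hbd : U.IsBoundaryCrossing c := ⟨k, (h3 k).2 (Or.inr rfl)⟩
  have n1 : ∀ c' i', U.midlineDart Dart.tail ≠ U.midlineDart (Dart.half c' i') := by
    intro c' i' e
    rw [h1, midlineDart_half] at e
    injection e with e
    exact c'.2 (e ▸ hbd)
  have n2 : ∀ c' i', U.midlineDart Dart.head ≠ U.midlineDart (Dart.half c' i') := by
    intro c' i' e
    rcases hU.midlineDart_head hcurl with ⟨-, h⟩ | ⟨c, k, h1, -, h3⟩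
    · rw [h] at e; cases e
    · rw [h1, midlineDart_half] at e
      injection e with e
      exact c'.2 (e ▸ ⟨k, (h3 k).2 (Or.inr rfl)⟩)
  have n3 : U.midlineDart Dart.tail ≠ U.midlineDart Dart.head := by
    intro e
    rcases hU.midlineDart_head hcurl with ⟨-, h⟩ | ⟨c', k', h1', h2', -⟩
    · rw [h1, h] at e; cases e
    · rw [h1, h1'] at e
      injection e with e e'
      have := U.edge.injective ((h2.trans (by rw [e, add_right_cancel e'])).trans h2'.symm)
      cases this
  rintro (_ | _ | ⟨a, i⟩) (_ | _ | ⟨b, j⟩) e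
  · rfl
  · exact absurd e n3
  · exact absurd e (n1 _ _)
  · exact absurd e.symm n3
  · rfl
  · exact absurd e (n2 _ _)
  · exact absurd e.symm (n1 _ _)
  · exact absurd e.symm (n2 _ _)
  · rw [midlineDart_half, midlineDart_half] at e
    injection e with e e'
    rw [Subtype.ext e, e']

/-- Interior half-edges at which a run stops belong to the mid-line. -/
theorem IsSimple.exists_midlineDart [Finite C] [Nonempty C] (hU : U.IsSimple) (hcurl : ¬ U.IsCurl)
    {x : Dart C} (hx : U.IsInterior x) (hj : ∀ y, ¬ U.Joined x y) :
    ∃ d, U.midlineDart d = x ∧ ∀ c i, x = Dart.half c i → U.IsBoundaryCrossing c →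
      d = Dart.tail ∨ d = Dart.head := by
  rcases x with _ | _ | ⟨c, i⟩
  · exact absurd rfl hx.1
  · exact ⟨Dart.head, by rw [midlineDart, if_neg hx.1], fun _ _ h => by cases h⟩
  by_cases hc : U.IsBoundaryCrossing c
  · rcases hU.star_corners hcurl hc with ⟨k, hk⟩ | ⟨k, hk, he⟩
    · refine absurd ⟨c, i, if i = k + 2 then k + 3 else k + 2, rfl, rfl, hc, ?_, hx, ?_⟩ (hj _)
      · split_ifs with h
        · rw [h]
          exact fun e => absurd (add_left_cancel e) (by decide)
        · exact h
      · rw [isInterior_half, Ne, Ne, hk, hk]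
        split_ifs <;> generalize k = a <;> revert a <;> decide
    · rw [isInterior_half, Ne, Ne, hk, hk] at hx
      have : ∀ i k : ZMod 4, ¬ (i = k - 1 ∨ i = k) → ¬ (i - 1 = k - 1 ∨ i - 1 = k) → i = k + 2 := by
        decide
      obtain rfl := this _ _ hx.1 hx.2
      rcases he with he | he
      · refine ⟨Dart.tail, ?_, fun _ _ _ _ => Or.inl rfl⟩
        rw [midlineDart, ← he, edge_edge]
        rfl
      · refine ⟨Dart.head, ?_, fun _ _ _ _ => Or.inr rfl⟩
        have hs : U.region Dart.head = U.star := by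
          rw [← he, region_edge_half, hk]
          exact Or.inl rfl
        rw [midlineDart, if_pos hs, ← he, edge_edge]
        rfl
  · refine ⟨Dart.half ⟨c, hc⟩ i, rfl, fun c' i' h h' => ?_⟩
    injection h with h
    exact absurd (h ▸ h') hc

/-! ### Regions along the runs -/

/-- A deep region: neither starred nor on the rim. -/
def IsDeep (R : U.Region) : Prop := R ≠ U.star ∧ ¬ IsRim R

/-- A deep region at a boundary crossing lies opposite to the starred region. -/
theorem IsSimple.deep_corner [Finite C] (hU : U.IsSimple) (hcurl : ¬ U.IsCurl) {c : C} {i : ZMod 4}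
    (hc : U.IsBoundaryCrossing c) (hR : IsDeep (U.corner c i)) :
    U.Joined (Dart.half c i) (Dart.half c (i + 1)) := by
  have next : ∀ j, U.corner c j = U.star → i ≠ j + 1 := by
    rintro j hj rfl
    exact hR.2 (isRim_of_next hR.1 hj)
  have prev : ∀ j, U.corner c j = U.star → i ≠ j - 1 := by
    rintro j hj rfl
    exact hR.2 (isRim_of_prev hR.1 hj)
  rcases hU.star_corners hcurl hc with ⟨k, hk⟩ | ⟨k, hk, -⟩
  · have h1 := next k ((hk k).2 rfl)
    have h2 := prev k ((hk k).2 rfl)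
    have h3 : ¬ i = k := fun h => hR.1 ((hk i).2 h)
    refine ⟨c, i, i + 1, rfl, rfl, hc, by simpa using (by decide : (1 : ZMod 4) ≠ 0), ?_, ?_⟩
    · rw [isInterior_half, Ne, Ne, hk, hk]
      exact ⟨h3, fun h => h1 (by rw [← h, sub_add_cancel])⟩
    · rw [isInterior_half, Ne, Ne, hk, hk, add_sub_cancel_right]
      exact ⟨fun h => h2 (by rw [← h, add_sub_cancel_right]), h3⟩
  · have h1 := next k ((hk k).2 (Or.inr rfl))
    have h2 := prev (k - 1) ((hk _).2 (Or.inl rfl))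
    have h3 : ¬ (i = k - 1 ∨ i = k) := fun h => hR.1 ((hk i).2 h)
    have : ∀ i k : ZMod 4, i ≠ k + 1 → i ≠ k - 1 - 1 → ¬ (i = k - 1 ∨ i = k) → False := by decide
    exact (this _ _ h1 h2 h3).elim

/-- Passing a smoothed crossing, one keeps the deep regions on both sides. -/
theorem IsSimple.deep_iff_of_joined [Finite C] (hU : U.IsSimple) (hcurl : ¬ U.IsCurl) {x y : Dart C}
    (h : U.Joined x y) {R : U.Region} (hR : IsDeep R) :
    (U.region x = R ↔ U.region (U.edge y) = R) ∧ (U.region (U.edge x) = R ↔ U.region y = R) := by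
  obtain ⟨c, k, hk, h⟩ := hU.joined hcurl h
  have k0 : U.corner c k = U.star := (hk k).2 rfl
  have k3 : k + 3 = k - 1 := by rw [sub_eq_add_neg]; rfl
  have k2 : k + 2 - 1 = k + 1 := by ring
  have k1 : k + 3 - 1 = k + 2 := by ring
  have r1 : IsRim (U.corner c (k + 1)) := isRim_of_next (fun h => absurd ((hk _).1 h)
    (by simpa using (by decide : (1 : ZMod 4) ≠ 0))) k0
  have r3 : IsRim (U.corner c (k + 3)) := by
    rw [k3]
    exact isRim_of_prev (fun h => absurd ((hk _).1 h)
      (by simpa using (by decide : (1 : ZMod 4) ≠ 0))) k0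
  have hne : ∀ {Q : U.Region}, IsRim Q → Q ≠ R := fun hQ e => hR.2 (e ▸ hQ)
  rcases h with ⟨rfl, rfl⟩ | ⟨rfl, rfl⟩ <;> rw [region_edge_half, region_edge_half, k2, k1]
  · exact ⟨Iff.rfl, iff_of_false (hne r1) (hne r3)⟩
  · exact ⟨iff_of_false (hne r3) (hne r1), Iff.rfl⟩

theorem IsSimple.deep_iff_of_runs [Finite C] (hU : U.IsSimple) (hcurl : ¬ U.IsCurl) {d d' : Dart C}
    (h : U.Runs d d') {R : U.Region} (hR : IsDeep R) :
    (U.region d = R ↔ U.region (U.edge d') = R) ∧ (U.region (U.edge d) = R ↔ U.region d' = R) := by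
  induction h with
  | along => rw [edge_edge]; exact ⟨Iff.rfl, Iff.rfl⟩
  | pass c i j _ hc hij hi hj ih =>
    have := hU.deep_iff_of_joined hcurl ⟨c, i, j, rfl, rfl, hc, hij, hi, hj⟩ hR
    rw [edge_edge]
    exact ⟨ih.1.trans this.2, ih.2.trans this.1⟩

theorem IsSimple.not_deep_tail [Finite C] [Nonempty C] (hU : U.IsSimple) (hcurl : ¬ U.IsCurl) :
    ¬ IsDeep (U.region (U.midlineDart Dart.tail)) := by
  obtain ⟨c, k, h, -, hk⟩ := hU.midlineDart_tail hcurl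
  intro hR
  rw [h] at hR
  have := hU.deep_corner hcurl ⟨k, (hk k).2 (Or.inr rfl)⟩ hR
  rw [← h] at this
  exact hU.not_joined_midlineDart hcurl _ _ this

theorem IsSimple.deep_iff_of_end [Finite C] [Nonempty C] (hU : U.IsSimple) (hcurl : ¬ U.IsCurl)
    {d : Dart {c : C // ¬ U.IsBoundaryCrossing c}} (hd : d = Dart.tail ∨ d = Dart.head)
    {R : U.Region} (hR : IsDeep R) :
    U.region (U.midlineDart d) = R ↔ U.region (U.edge (U.midlineDart d)) = R := by
  rcases hU.midlineDart_cases hcurl d with ⟨c, i, rfl, -⟩ | ⟨h1, h⟩ | ⟨c, k, h, hk⟩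
  · simp at hd
  · rw [h, region_edge_head]
  · have hc : U.IsBoundaryCrossing c := ⟨k, (hk k).2 (Or.inr rfl)⟩
    have hend := hU.not_joined_midlineDart hcurl d
    refine iff_of_false ?_ ?_
    · rintro rfl
      rw [h] at hend hR
      exact hend _ (hU.deep_corner hcurl hc hR)
    · rintro rfl
      rw [h] at hend hR
      rw [region_edge_half] at hR
      have := (hU.deep_corner hcurl hc hR).symm
      rw [sub_add_cancel] at this
      exact hend _ this

end LinkoidUniverse

namespace LinkoidUniverse

variable {C : Type u} {U : LinkoidUniverse C}

/-! ### Connectedness and regions of the mid-line -/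

section Joining

variable {σ : Equiv.Perm (Dart C)}

theorem isInterior_joining (hσ : ∀ x, σ x ≠ x → U.Joined x (σ x)) {x : Dart C}
    (hx : U.IsInterior x) : U.IsInterior (σ x) := by
  by_cases h : σ x = x
  · rwa [h]
  · obtain ⟨c, i, j, -, -, -, -, -, h6⟩ := hσ x h
    exact h6

theorem isInterior_pow (hσ : ∀ x, σ x ≠ x → U.Joined x (σ x)) {x : Dart C} (hx : U.IsInterior x)
    (n : ℕ) : U.IsInterior (((U.edge * σ) ^ n) x) := by
  induction n with
  | zero => exact hx
  | succ n ih =>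
    rw [pow_succ', Equiv.Perm.mul_apply, Equiv.Perm.mul_apply, isInterior_edge]
    exact isInterior_joining hσ ih

/-- The run along the reconnected edges, as an iteration, is a run of the universe. -/
theorem runs_of_isRun (hσ : ∀ x, σ x ≠ x → U.Joined x (σ x)) {d d' : Dart C} (hd : σ d = d)
    (h : IsRun U.edge σ d d') : U.Runs d d' := by
  obtain ⟨n, h1, rfl, h3⟩ := h
  induction n with
  | zero => exact absurd h1 (lt_irrefl _)
  | succ n ih =>
    rcases Nat.eq_zero_or_pos n with rfl | hn
    · rw [pow_succ', Equiv.Perm.mul_apply, pow_zero, Equiv.Perm.one_apply, Equiv.Perm.mul_apply, hd]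
      exact Runs.along d
    · have hr := ih hn fun m h4 h5 => h3 m h4 (by omega)
      obtain ⟨c, i, j, e1, e2, hc, hij, hi, hj⟩ := hσ _ (h3 n hn (by omega))
      rw [pow_succ', Equiv.Perm.mul_apply, Equiv.Perm.mul_apply, e2]
      exact Runs.pass d c i j (e1 ▸ hr) hc hij (e1 ▸ hi) (e2 ▸ hj)

/-- A set of vertices of the mid-line that contains the endpoints and is closed under runs contains
everything, and all joined half-edges lie on runs of the mid-line. Otherwise the
simple universe could be cut apart along edges which bound the starred region on one side. -/
theorem IsSimple.midline_connected [Finite C] [Nonempty C] (hU : U.IsSimple) (hcurl : ¬ U.IsCurl)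
    (hσσ : ∀ x, σ (σ x) = x) (hσ : ∀ x, σ x ≠ x → U.Joined x (σ x))
    (hσ' : ∀ x y, U.Joined x y → σ x = y)
    {Z : Dart {c : C // ¬ U.IsBoundaryCrossing c} → Prop} (h0 : Z Dart.tail) (hh : Z Dart.head)
    (ht : ∀ d, Z (Dart.turn _ d) ↔ Z d)
    (hrun : ∀ d d', IsRun U.edge σ (U.midlineDart d) (U.midlineDart d') → Z d → Z d') :
    (∀ d, Z d) ∧ ∀ x y, U.Joined x y → ∃ d, (U.edge * σ).SameCycle (U.midlineDart d) x := by
  classical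
  have hZhalf : ∀ c i j, Z (Dart.half c i) ↔ Z (Dart.half c j) := fun c i j =>
    iff_of_eq (Dart.half_eq_of_turn (fun d => propext (ht d)) c i j)
  have hfix : ∀ x, σ x = x ↔ ∀ y, ¬ U.Joined x y := by
    intro x
    constructor
    · rintro hx y hy
      have := hσ' x y hy
      obtain ⟨c, i, j, rfl, rfl, -, hij, -⟩ := hy
      rw [hx] at this
      injection this with _ this
      exact hij this
    · intro hx
      by_contra h
      exact hx _ (hσ x h)
  have hmid : ∀ d, σ (U.midlineDart d) = U.midlineDart d := fun d =>
    (hfix _).2 (hU.not_joined_midlineDart hcurl d)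
  let Reach : Dart C → Prop := fun y => ∃ d, Z d ∧ (U.edge * σ).SameCycle (U.midlineDart d) y
  have hRσ : ∀ y, Reach y → Reach (σ y) := by
    rintro y ⟨d, hd, h⟩
    obtain ⟨n, -, rfl⟩ := h.exists_pow_eq'
    refine ⟨d, hd, ?_⟩
    rw [involution_pow_apply U.edge_edge hσσ, hmid, ← zpow_natCast, ← zpow_neg]
    exact ⟨_, rfl⟩
  have hRe : ∀ y, Reach (U.edge y) ↔ Reach y := by
    have h1 : ∀ y, Reach y → Reach (U.edge y) := by
      intro y hy
      obtain ⟨d, hd, h⟩ := hRσ y hy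
      refine ⟨d, hd, ?_⟩
      have := Equiv.Perm.sameCycle_apply_right.2 h
      rwa [Equiv.Perm.mul_apply, hσσ] at this
    exact fun y => ⟨fun h => by simpa only [edge_edge] using h1 _ h, h1 y⟩
  have hRmid : ∀ d, Reach (U.midlineDart d) ↔ Z d := by
    refine fun d => ⟨?_, fun hd => ⟨d, hd, Equiv.Perm.SameCycle.refl _ _⟩⟩
    rintro ⟨d', hd', h⟩
    obtain ⟨n, -, hn⟩ := h.exists_pow_eq'
    obtain ⟨b, hb, hZb⟩ := IsRun.induction (Z := fun y => ∃ b, U.midlineDart b = y ∧ Z b)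
      (fun a a' ha ha' hr => by
        rintro ⟨b, rfl, hb⟩
        have hi : U.IsInterior a' := by
          obtain ⟨n, -, rfl, -⟩ := hr
          exact isInterior_pow hσ (hU.isInterior_midlineDart hcurl b) n
        obtain ⟨b', rfl, -⟩ := hU.exists_midlineDart hcurl hi ((hfix _).1 ha')
        exact ⟨b', rfl, hrun _ _ hr hb⟩) (hmid d') (hmid d) n hn ⟨d', rfl, hd'⟩
    rwa [← hU.midlineDart_injective hcurl hb]
  -- the vertices that are not reached
  let G : C → Prop := fun c => (∃ h : ¬ U.IsBoundaryCrossing c, ¬ Z (Dart.half ⟨c, h⟩ 0)) ∨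
    ∃ i y, U.Joined (Dart.half c i) y ∧ ¬ Reach (Dart.half c i)
  let g : Dart C → Prop := fun d => Dart.At {c | G c} d
  have hgint : ∀ x, U.IsInterior x → (g x ↔ ¬ Reach x) := by
    rintro (_ | _ | ⟨c, i⟩) hx
    · exact absurd rfl hx.1
    · refine iff_of_false id (not_not.2 ?_)
      rw [← show U.midlineDart Dart.head = Dart.head by rw [midlineDart, if_neg hx.1], hRmid]
      exact hh
    change G c ↔ _
    by_cases hc : U.IsBoundaryCrossing c
    · constructor
      · rintro (⟨h, -⟩ | ⟨i', y, hj, hr⟩) hR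
        · exact h hc
        by_cases hii : i = i'
        · exact hr (hii ▸ hR)
        · have : U.Joined (Dart.half c i) (Dart.half c i') := by
            obtain ⟨c', i'', j, h1, h2, h3, h4, h5, h6⟩ := hj
            exact ⟨c, i, i', rfl, rfl, hc, hii, hx, h5⟩
          exact hr (hσ' _ _ this ▸ hRσ _ hR)
      · intro hR
        by_cases hj : ∃ y, U.Joined (Dart.half c i) y
        · obtain ⟨y, hj⟩ := hj
          exact Or.inr ⟨i, y, hj, hR⟩
        · obtain ⟨d, hd, hd'⟩ := hU.exists_midlineDart hcurl hx (fun y hy => hj ⟨y, hy⟩)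
          rw [← hd, hRmid] at hR
          rcases hd' c i rfl hc with rfl | rfl
          · exact absurd h0 hR
          · exact absurd hh hR
    · rw [show Dart.half c i = U.midlineDart (Dart.half ⟨c, hc⟩ i) from rfl, hRmid, hZhalf _ i 0]
      constructor
      · rintro (⟨_, h⟩ | ⟨i', y, ⟨c', i'', j, h1, h2, h3, -⟩, -⟩)
        · exact h
        · injection h1 with h1
          exact absurd (h1 ▸ h3) hc
      · exact fun h => Or.inl ⟨hc, h⟩
  have hg0 : ∀ d, ¬ g d := by
    refine hU.not_cut_along_star (fun d => Dart.at_turn _ d) id fun d hd hd' => ?_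
    by_contra hcon
    by_cases hi : U.IsInterior d
    · rw [hgint _ ((isInterior_edge d).2 hi), hRe, ← hgint _ hi] at hd'
      exact hd' hd
    -- now the edge has the starred region on both sides, so it leads to an exterior endpoint
    have hs : U.region d = U.star ∧ U.region (U.edge d) = U.star := by
      unfold IsInterior at hi
      tauto
    rcases hU.1.bridge (hs.1.trans hs.2.symm) with (rfl | rfl) | he
    · exact hd
    · exact hd
    · obtain ⟨c, k, h1, h2⟩ := hU.end_corners hcurl he hs.2
      rw [edge_edge] at h1
      rw [h1] at hd
      rcases hd with ⟨h, -⟩ | ⟨i, y, hj, -⟩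
      · exact h ⟨k, (h2 k).2 (Or.inr rfl)⟩
      · obtain ⟨c', k', h3, h4⟩ := hU.joined hcurl hj
        have hcc : c = c' := by
          rcases h4 with ⟨h4, -⟩ | ⟨h4, -⟩ <;> injection h4
        subst hcc
        have e1 := (h3 _).1 ((h2 (k - 1)).2 (Or.inl rfl))
        have e2 := (h3 _).1 ((h2 k).2 (Or.inr rfl))
        exact absurd (e1.trans e2.symm) (by simpa using (by decide : (1 : ZMod 4) ≠ 0))
  constructor
  · rintro (_ | _ | ⟨c, i⟩)
    · exact h0
    · exact hh
    · rw [hZhalf _ i 0]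
      by_contra h
      exact hg0 (Dart.half c.1 0) (Or.inl ⟨c.2, h⟩)
  · intro x y hj
    have hx : U.IsInterior x := by
      obtain ⟨_, _, _, -, -, -, -, h, -⟩ := hj
      exact h
    obtain ⟨d, -, h⟩ : Reach x := by
      by_contra h
      exact hg0 x ((hgint x hx).2 h)
    exact ⟨d, h⟩

end Joining

/-- Every deep region borders on the mid-line. -/
theorem IsSimple.exists_midlineDart_of_deep [Finite C] [Nonempty C] (hU : U.IsSimple)
    (hcurl : ¬ U.IsCurl) {R : U.Region} (hR : IsDeep R) :
    ∃ d, U.region (U.midlineDart d) = R ∨ U.region (U.edge (U.midlineDart d)) = R := by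
  obtain ⟨σ, hσσ, hσ, hσ'⟩ := hU.exists_joining hcurl
  obtain ⟨y, rfl⟩ := U.region_surjective R
  rcases y with _ | _ | ⟨c, i⟩
  · exact absurd rfl hR.1
  · exact ⟨Dart.head, Or.inl (by rw [midlineDart, if_neg hR.1])⟩
  by_cases hc : U.IsBoundaryCrossing c
  · have hj := hU.deep_corner hcurl hc hR
    obtain ⟨d, hd⟩ := (hU.midline_connected hcurl hσσ hσ hσ' (Z := fun _ => True) trivial trivial
      (fun _ => Iff.rfl) (fun _ _ _ _ => trivial)).2 _ _ hj
    refine ⟨d, ?_⟩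
    obtain ⟨n, -, hn⟩ := hd.symm.exists_pow_eq'
    rw [← hn]
    clear hn
    induction n with
    | zero => exact Or.inl rfl
    | succ n ih =>
      rw [pow_succ', Equiv.Perm.mul_apply, Equiv.Perm.mul_apply, edge_edge, or_comm]
      by_cases hf : σ (((U.edge * σ) ^ n) (Dart.half c i)) = ((U.edge * σ) ^ n) (Dart.half c i)
      · rwa [hf]
      · have := hU.deep_iff_of_joined hcurl (hσ _ hf) hR
        rw [← this.1, ← this.2, or_comm]
        exact ih
  · exact ⟨Dart.half ⟨c, hc⟩ i, Or.inl rfl⟩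

theorem IsSimple.exists_siteRule [Finite C] (hU : U.IsSimple) (hcurl : ¬ U.IsCurl) (t : Sense) {c : C}
    (hc : U.IsBoundaryCrossing c) : ∃ i, U.SiteRule t c i := by
  have h10 : ∀ t : Sense, t.step ≠ 0 := by rintro (_ | _) <;> simp only [Sense.step] <;> decide
  rcases hU.star_corners hcurl hc with ⟨k, hk⟩ | ⟨k, hk, -⟩
  · refine ⟨k + t.step, fun h => ?_, by rw [add_sub_cancel_right, hk]⟩
    rw [hk] at h
    exact h10 t (by simpa using h)
  · cases t with
    | clockwise =>
      refine ⟨k - 2, ?_, ?_⟩ <;> simp only [Sense.step, Ne, hk] <;> generalize k = a <;> revert a <;>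
        decide
    | counterclockwise =>
      refine ⟨k + 1, ?_, ?_⟩ <;> simp only [Sense.step, Ne, hk] <;> generalize k = a <;> revert a <;>
        decide

/-- The markers at the boundary crossings lie on the rim. -/
theorem SiteRule.isRim {t : Sense} {c : C} {i : ZMod 4} (h : U.SiteRule t c i) :
    IsRim (U.corner c i) := by
  cases t with
  | clockwise =>
    have h1 := h.1
    rw [← add_sub_cancel_right i 1] at h1 ⊢
    refine isRim_of_prev h1 ?_
    have h2 := h.2
    rwa [Sense.step, sub_neg_eq_add] at h2
  | counterclockwise =>
    have h1 := h.1
    rw [← sub_add_cancel i 1] at h1 ⊢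
    exact isRim_of_next h1 h.2

/-- The markers at different boundary crossings lie in different regions. -/
theorem IsSimple.siteRule_injective [Finite C] (hU : U.IsSimple) {t : Sense} {c c' : C}
    {i i' : ZMod 4} (h : U.SiteRule t c i) (h' : U.SiteRule t c' i')
    (e : U.corner c i = U.corner c' i') : Dart.half c i = Dart.half c' i' := by
  cases t with
  | clockwise =>
    have hx : ∀ c i, U.SiteRule Sense.clockwise c i →
        U.region (U.edge (Dart.half c (i + 1))) = U.corner c i ∧
        U.region (U.edge (U.edge (Dart.half c (i + 1)))) = U.star := fun c i h => by
      rw [region_edge_half, add_sub_cancel_right, edge_edge]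
      have h2 := h.2
      rw [Sense.step, sub_neg_eq_add] at h2
      exact ⟨rfl, h2⟩
    have := hU.eq_of_adjacent_star (by rw [(hx c i h).1]; exact h.1)
      (by rw [(hx c' i' h').1, (hx c i h).1, e]) (hx c i h).2 (hx c' i' h').2
    have := U.edge.injective this
    injection this with h1 h2
    rw [h1, add_right_cancel h2]
  | counterclockwise =>
    exact hU.eq_of_adjacent_star h.1 e.symm (by rw [region_edge_half]; exact h.2)
      (by rw [region_edge_half]; exact h'.2)

/-- There are at least as many deep regions as there are crossings on the mid-line. -/
theorem IsSimple.card_deep [Finite C] (hU : U.IsSimple) (hcurl : ¬ U.IsCurl) :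
    Nat.card {c : C // ¬ U.IsBoundaryCrossing c} ≤ Nat.card {R : U.Region // IsDeep R} := by
  classical
  choose! i hi using fun c (hc : U.IsBoundaryCrossing c) =>
    hU.exists_siteRule hcurl Sense.counterclockwise hc
  -- the starred region, the regions on the rim and the deep ones
  have hsurj : Function.Surjective (fun a : Unit ⊕ {c : C // U.IsBoundaryCrossing c} ⊕
      {R : U.Region // IsDeep R} => a.elim (fun _ => U.star)
        (Sum.elim (fun c => U.corner c.1 (i c.1)) Subtype.val)) := by
    intro R
    by_cases h1 : R = U.star
    · exact ⟨Sum.inl (), h1.symm⟩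
    by_cases h2 : IsRim R
    · obtain ⟨-, x, rfl, hx⟩ := h2
      rcases x with _ | _ | ⟨c, k⟩
      · exact absurd rfl h1
      · exact absurd ((U.region_edge_head).symm.trans hx) h1
      · rw [region_edge_half] at hx
        have hc : U.IsBoundaryCrossing c := ⟨_, hx⟩
        refine ⟨Sum.inr (Sum.inl ⟨c, hc⟩), ?_⟩
        change U.corner c (i c) = U.corner c k
        have h3 := hi c hc
        have : ∀ j, U.SiteRule Sense.counterclockwise c j →
            ∀ j', U.SiteRule Sense.counterclockwise c j' → j = j' := by
          rintro j ⟨a1, a2⟩ j' ⟨b1, b2⟩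
          simp only [Sense.step] at a2 b2
          rcases hU.star_corners hcurl hc with ⟨m, hm⟩ | ⟨m, hm, -⟩
          · rw [hm] at a2 b2
            exact sub_left_injective (a2.trans b2.symm)
          · rw [Ne, hm] at a1 b1
            rw [hm] at a2 b2
            have key : ∀ j m : ZMod 4, ¬ (j = m - 1 ∨ j = m) → (j - 1 = m - 1 ∨ j - 1 = m) →
                j = m + 1 := by decide
            rw [key _ _ a1 a2, key _ _ b1 b2]
        rw [this _ h3 k ⟨h1, hx⟩]
    · exact ⟨Sum.inr (Sum.inr ⟨R, h1, h2⟩), rfl⟩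
  have h1 := Nat.card_le_card_of_surjective _ hsurj
  rw [Nat.card_sum, Nat.card_sum, U.card_region, Nat.card_unique (α := Unit)] at h1
  have h2 : Nat.card C = Nat.card {c : C // U.IsBoundaryCrossing c} +
      Nat.card {c : C // ¬ U.IsBoundaryCrossing c} := by
    rw [← Nat.card_sum]
    exact Nat.card_congr (Equiv.sumCompl U.IsBoundaryCrossing).symm
  omega

open Classical in
/-- A deep region, or `none` for the other regions. -/
noncomputable def deepLabel (R : U.Region) : Option {R : U.Region // IsDeep R} :=
  if h : IsDeep R then some ⟨R, h⟩ else none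

theorem deepLabel_of_deep {R : U.Region} (h : IsDeep R) : deepLabel R = some ⟨R, h⟩ := dif_pos h

theorem deepLabel_of_not_deep {R : U.Region} (h : ¬ IsDeep R) : deepLabel R = none := dif_neg h

theorem deepLabel_eq {R R' : U.Region} (h : ∀ Q, IsDeep Q → (R = Q ↔ R' = Q)) :
    deepLabel R = deepLabel R' := by
  by_cases hR : IsDeep R
  · rw [(h R hR).1 rfl]
  · have hR' : ¬ IsDeep R' := fun h' => hR ((h R' h').2 rfl ▸ h')
    rw [deepLabel_of_not_deep hR, deepLabel_of_not_deep hR']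

/-- The deep regions on both sides are kept along the edges of the mid-line. -/
theorem IsSimple.deepLabel_facePerm [Finite C] [Nonempty C] (hU : U.IsSimple) (hcurl : ¬ U.IsCurl)
    {e : Equiv.Perm (Dart {c : C // ¬ U.IsBoundaryCrossing c})}
    (he : ∀ d, U.Runs (U.midlineDart d) (U.midlineDart (e d)))
    (d : Dart {c : C // ¬ U.IsBoundaryCrossing c}) :
    deepLabel (U.region (U.midlineDart (facePerm e d))) =
      deepLabel (U.region (U.midlineDart d)) := by
  refine deepLabel_eq fun Q hQ => ?_
  have h1 := (hU.deep_iff_of_runs hcurl (he d) hQ).1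
  rw [h1]
  change U.region (U.midlineDart ((Dart.turn _)⁻¹ (e d))) = Q ↔ _
  generalize e d = x
  rcases x with _ | _ | ⟨c, i⟩
  · exact hU.deep_iff_of_end hcurl (Or.inl rfl) hQ
  · exact hU.deep_iff_of_end hcurl (Or.inr rfl) hQ
  · rw [midlineDart_half, region_edge_half]
    rfl

theorem IsSimple.deepLabel_surjective [Finite C] [Nonempty C] (hU : U.IsSimple) (hcurl : ¬ U.IsCurl)
    {e : Equiv.Perm (Dart {c : C // ¬ U.IsBoundaryCrossing c})}
    (he : ∀ d, U.Runs (U.midlineDart d) (U.midlineDart (e d))) :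
    Function.Surjective fun d => deepLabel (U.region (U.midlineDart d)) := by
  rintro (_ | ⟨R, hR⟩)
  · exact ⟨Dart.tail, deepLabel_of_not_deep (hU.not_deep_tail hcurl)⟩
  · obtain ⟨d, rfl | h⟩ := hU.exists_midlineDart_of_deep hcurl hR
    · exact ⟨d, deepLabel_of_deep hR⟩
    · refine ⟨e d, ?_⟩
      have := ((hU.deep_iff_of_runs hcurl (he d) hR).2.1 h)
      subst this
      exact deepLabel_of_deep hR

end LinkoidUniverse

namespace LinkoidUniverse

variable {C : Type u} {U : LinkoidUniverse C}

/-! ### The shell of a simple universe -/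

/-- A simple universe that is not a curl has a mid-line. -/
theorem IsSimple.exists_isMidline [Finite C] [Nonempty C] (hU : U.IsSimple) (hcurl : ¬ U.IsCurl) :
    ∃ M, U.IsMidline M := by
  obtain ⟨σ, hσσ, hσ, hσ'⟩ := hU.exists_joining hcurl
  have hmid : ∀ d, σ (U.midlineDart d) = U.midlineDart d := fun d => by
    by_contra h
    exact hU.not_joined_midlineDart hcurl d _ (hσ _ h)
  obtain ⟨e, hee, hne, he⟩ := exists_edge_of_relation
    (fun d d' => IsRun U.edge σ (U.midlineDart d) (U.midlineDart d'))
    (fun d => by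
      obtain ⟨x, hx, hr⟩ := exists_isRun (e := U.edge) (hmid d)
      have hi : U.IsInterior x := by
        obtain ⟨n, -, rfl, -⟩ := hr
        exact isInterior_pow hσ (hU.isInterior_midlineDart hcurl d) n
      obtain ⟨d', rfl, -⟩ := hU.exists_midlineDart hcurl hi fun y hy => by
        have := hσ' x y hy
        obtain ⟨c, i, j, rfl, rfl, -, hij, -⟩ := hy
        rw [hx] at this
        injection this with _ this
        exact hij this
      exact ⟨d', hr⟩)
    (fun d d' h => h.symm U.edge_edge hσσ (hmid d) (hmid d'))
    (fun d a b ha hb => hU.midlineDart_injective hcurl (ha.unique (hmid a) (hmid b) hb))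
    (fun d => IsRun.ne U.edge_edge hσσ U.edge_ne (hmid d))
  have hruns : ∀ d, U.Runs (U.midlineDart d) (U.midlineDart (e d)) := fun d =>
    runs_of_isRun hσ (hmid d) (he d)
  have hconn : IsConnectedEdge e := by
    intro Z h0 hZe hZt
    refine (hU.midline_connected hcurl hσσ hσ hσ' h0
      ((tail_iff_head_of_closed e hee hne Z (turn_iff_of_imp hZt) hZe).1 h0)
      (turn_iff_of_imp hZt) fun d d' hr hd => ?_).1
    rw [hU.midlineDart_injective hcurl (hr.unique (hmid _) (hmid _) (he d))]
    exact hZe d hd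
  have hcard := hU.card_deep hcurl
  obtain ⟨M, rfl⟩ := exists_universe hee hne hconn _ (hU.deepLabel_facePerm hcurl hruns)
    (hU.deepLabel_surjective hcurl hruns) (by rw [Finite.card_option]; omega)
  exact ⟨M, hruns⟩

/-- The regions of the mid-line are the deep regions, and one region that contains the circle of the
shell. -/
theorem IsMidline.isPiece [Finite C] [Nonempty C] (hU : U.IsSimple) (hcurl : ¬ U.IsCurl)
    {M : LinkoidUniverse {c : C // ¬ U.IsBoundaryCrossing c}} (hM : U.IsMidline M) :
    U.IsPiece M Subtype.val ∧ ∀ c i, M.corner c i ≠ M.star → IsDeep (U.corner c.1 i) := by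
  have hcard := hU.card_deep hcurl
  have hl := hU.deepLabel_facePerm hcurl hM
  have heq : ∀ d d', M.region d = M.region d' ↔
      deepLabel (U.region (U.midlineDart d)) = deepLabel (U.region (U.midlineDart d')) :=
    fun d d' => ⟨fun h => M.eq_of_region_eq
      (f := fun d => deepLabel (U.region (U.midlineDart d))) hl h, fun h =>
      region_eq_of_label_eq M (fun d => deepLabel (U.region (U.midlineDart d))) hl
        (hU.deepLabel_surjective hcurl hM) (by rw [Finite.card_option]; omega) h⟩
  have hdeep : ∀ c i, M.corner c i ≠ M.star → IsDeep (U.corner c.1 i) := by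
    intro c i h
    by_contra hd
    refine h ((heq _ Dart.tail).2 ?_)
    rw [deepLabel_of_not_deep (hU.not_deep_tail hcurl)]
    exact deepLabel_of_not_deep hd
  refine ⟨fun c i h => ⟨(hdeep c i h).1, fun c' i' => ?_⟩, hdeep⟩
  have hd := hdeep c i h
  rw [corner, corner, heq, midlineDart_half, midlineDart_half]
  change deepLabel (U.corner c.1 i) = deepLabel (U.corner c'.1 i') ↔ _
  refine ⟨fun e => ?_, fun e => by rw [e]⟩
  rw [deepLabel_of_deep hd] at e
  by_cases hd' : IsDeep (U.corner c'.1 i')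
  · rw [deepLabel_of_deep hd'] at e
    exact congrArg Subtype.val (Option.some_injective _ e)
  · rw [deepLabel_of_not_deep hd'] at e
    cases e

/-- Extreme states of a shell: a marker on the boundary cannot be moved back, for this would bring it
into the starred region. -/
theorem IsMidline.isExtreme [Finite C] [Nonempty C] (hU : U.IsSimple) (hcurl : ¬ U.IsCurl)
    {M : LinkoidUniverse {c : C // ¬ U.IsBoundaryCrossing c}} (hM : U.IsMidline M) {t : Sense}
    {s : Marking C} (hs : ∀ c, U.IsBoundaryCrossing c → U.SiteRule t c (s c))
    (hsM : M.IsExtreme t fun c => s c.1) : U.IsExtreme t s := by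
  obtain ⟨hP, hdeep⟩ := hM.isPiece hU hcurl
  have hd : ∀ c, ¬ U.IsBoundaryCrossing c → IsDeep (U.corner c (s c)) := fun c hc =>
    hdeep ⟨c, hc⟩ _ (hsM.1.1 ⟨c, hc⟩)
  have hstate : U.IsState s := by
    refine U.isState_of_injective (fun c => ?_) fun c c' e => ?_
    · by_cases hc : U.IsBoundaryCrossing c
      · exact (hs c hc).1
      · exact (hd c hc).1
    · by_cases hc : U.IsBoundaryCrossing c <;> by_cases hc' : U.IsBoundaryCrossing c'
      · have := hU.siteRule_injective (hs c hc) (hs c' hc') e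
        injection this
      · exact absurd (e ▸ (hs c hc).isRim) (hd c' hc').2
      · exact absurd (e ▸ (hs c' hc').isRim) (hd c hc).2
      · exact congrArg Subtype.val (hsM.1.injective (c := ⟨c, hc⟩) (c' := ⟨c', hc'⟩)
          (((hP ⟨c, hc⟩ _ (hsM.1.1 ⟨c, hc⟩)).2 ⟨c', hc'⟩ _).2 e))
  refine ⟨hstate, ?_⟩
  rintro s' ⟨-, hs', hmove⟩
  have hback : ∀ c, s' c = s c + t.reverse.step → ¬ U.IsBoundaryCrossing c := by
    intro c h hc
    refine hs'.1 c ?_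
    rw [h, Sense.step_reverse, ← sub_eq_add_neg]
    exact (hs c hc).2
  rcases hmove with ⟨c₁, c₂, hne, h1, h2, h3, h4, h5⟩ | ⟨c, h1, h3, h4⟩
  · exact hP.not_doubleMove Subtype.val_injective hsM (d₁ := ⟨c₁, hback c₁ h1⟩)
      (d₂ := ⟨c₂, hback c₂ h2⟩) hne h1 h2 h3 h4 h5
  · exact hP.not_headMove Subtype.val_injective hsM (d := ⟨c, hback c h1⟩) h1 h3 h4

theorem IsSimple.card_midline_lt [Finite C] [Nonempty C] (hU : U.IsSimple) (hcurl : ¬ U.IsCurl) :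
    Nat.card {c : C // ¬ U.IsBoundaryCrossing c} < Nat.card C := by
  obtain ⟨c, k, -, hk⟩ := hU.end_corners hcurl (Or.inl rfl) rfl
  exact Finite.card_subtype_lt (x := c) (not_not.2 ⟨k, (hk k).2 (Or.inr rfl)⟩)

end LinkoidUniverse

namespace LinkoidUniverse

variable {C : Type u} {U : LinkoidUniverse C}

/-! ### Curls -/

/-- In a curl the starred region lies in at least three corners, and the fourth one lies inside the
loop. -/
theorem IsCurl.star_corners (hU : U.IsCurl) (c : C) : ∃ a b : ZMod 4, a ≠ b ∧
    ∀ i, (i = a ∨ i = a - 1 ∨ i = b ∨ i = b - 1) → U.corner c i = U.star := by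
  have hsub : Subsingleton C := (Nat.card_eq_one_iff_unique.1 hU.1).1
  have : Nonempty C := ⟨c⟩
  have key : ∀ x : Dart C, x = Dart.tail ∨ x = Dart.head → ∃ a, U.edge x = Dart.half c a ∧
      U.corner c a = U.star ∧ U.corner c (a - 1) = U.star := by
    intro x hx
    have hs : U.region x = U.star ∧ U.region (U.edge x) = U.star := by
      rcases hx with rfl | rfl
      · exact ⟨rfl, U.region_edge_tail⟩
      · exact ⟨hU.2, U.region_edge_head.trans hU.2⟩
    have hne : U.edge x ≠ Dart.tail ∧ U.edge x ≠ Dart.head := by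
      rcases hx with rfl | rfl
      · exact ⟨U.edge_ne _, U.edge_tail_ne_head⟩
      · exact ⟨fun e => U.edge_tail_ne_head (U.edge_eq_iff.1 e).symm, U.edge_ne _⟩
    rcases he : U.edge x with _ | _ | ⟨c', a⟩
    · exact absurd he hne.1
    · exact absurd he hne.2
    · obtain rfl := Subsingleton.elim c' c
      refine ⟨a, rfl, ?_, ?_⟩
      · rw [corner, ← he, hs.2]
      · rw [← U.region_edge_half, ← he, edge_edge, hs.1]
  obtain ⟨a, ha, h1, h2⟩ := key _ (Or.inl rfl)
  obtain ⟨b, hb, h3, h4⟩ := key _ (Or.inr rfl)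
  refine ⟨a, b, fun e => ?_, ?_⟩
  · have := U.edge.injective (ha.trans (by rw [e, hb]))
    cases this
  · rintro i (rfl | rfl | rfl | rfl)
    exacts [h1, h2, h3, h4]

theorem IsCurl.exists_corner [Finite C] (hU : U.IsCurl) :
    ∃ s : Marking C, ∀ c, U.corner c (s c) ≠ U.star := by
  have hsub : Subsingleton C := (Nat.card_eq_one_iff_unique.1 hU.1).1
  have hreg := U.card_region
  rw [hU.1] at hreg
  have : Nontrivial U.Region := (Finite.one_lt_card_iff_nontrivial).1 (by omega)
  obtain ⟨R, hR⟩ := exists_ne U.star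
  obtain ⟨y, rfl⟩ := U.region_surjective R
  rcases y with _ | _ | ⟨c, i⟩
  · exact absurd rfl hR
  · exact absurd hU.2 hR
  · exact ⟨fun _ => i, fun c' => Subsingleton.elim c c' ▸ hR⟩

theorem IsCurl.isExtreme [Finite C] (hU : U.IsCurl) (t : Sense) {s : Marking C}
    (hs : ∀ c, U.corner c (s c) ≠ U.star) : U.IsExtreme t s := by
  have hsub : Subsingleton C := (Nat.card_eq_one_iff_unique.1 hU.1).1
  refine ⟨U.isState_of_injective hs fun c c' _ => Subsingleton.elim c c', ?_⟩
  rintro s' ⟨-, hs', ⟨c₁, c₂, hne, -⟩ | ⟨c, h1, -, -⟩⟩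
  · exact hne (Subsingleton.elim _ _)
  · obtain ⟨a, b, hab, h⟩ := hU.star_corners c
    have n1 := mt (h (s c)) (hs c)
    have n2 := mt (h (s' c)) (hs'.1 c)
    rw [h1] at n2
    generalize s c = x at n1 n2
    have h3 : ∀ x a b : ZMod 4, a ≠ b → ¬ (x = a ∨ x = a - 1 ∨ x = b ∨ x = b - 1) →
        ¬ (x + 1 = a ∨ x + 1 = a - 1 ∨ x + 1 = b ∨ x + 1 = b - 1) → False := by decide
    cases t with
    | clockwise => exact h3 x a b hab n1 n2
    | counterclockwise =>
      rw [show x + Sense.counterclockwise.reverse.step = x - 1 from (sub_eq_add_neg _ _).symm] at n2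
      refine h3 (x - 1) a b hab n2 ?_
      rwa [sub_add_cancel]

end LinkoidUniverse

/-! ### The shelling algorithm -/

namespace ShellComposition

variable {C : Type u} {U : LinkoidUniverse C}

/-- The markers placed by the shelling algorithm form an extreme state. -/
theorem isExtreme_of_places (t : Sense) (D : ShellComposition U) (hC : Finite C) {s : Marking C}
    (hs : D.Places t s) : U.IsExtreme t s := by
  induction D with
  | empty U h =>
    refine ⟨U.isState_of_injective (fun c => (h.false c).elim) fun c => (h.false c).elim, ?_⟩
    rintro s' ⟨-, -, ⟨c, -⟩ | ⟨c, -⟩⟩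
    exacts [h.false c, h.false c]
  | curl U h => exact h.isExtreme t hs
  | shell U M hne hU hcurl hM D ih =>
    exact hM.isExtreme hU hcurl hs.1 (ih inferInstance hs.2)
  | composite U S U₁ U₂ h1 h2 h D₁ D₂ ih₁ ih₂ =>
    obtain ⟨p1, p2, p3⟩ := h.isPiece
    exact LinkoidUniverse.isExtreme_of_pieces p1 p2 p3 (ih₁ inferInstance hs.1)
      (ih₂ inferInstance hs.2)
  | rider U S U₁ e U₂ h1 h2 h D₁ D₂ ih₁ ih₂ =>
    obtain ⟨p1, p2, p3⟩ := h.isPiece h2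
    exact LinkoidUniverse.isExtreme_of_pieces p1 p2 p3 (ih₁ inferInstance hs.1)
      (ih₂ inferInstance hs.2)

theorem exists_places (t : Sense) (D : ShellComposition U) (hC : Finite C) :
    ∃ s, D.Places t s := by
  classical
  have glue : ∀ {C : Type u} (S : Set C) (s₁ : Marking S) (s₂ : Marking ↥(Sᶜ)),
      ∃ s : Marking C, (fun c : S => s c.1) = s₁ ∧ (fun c : ↥(Sᶜ) => s c.1) = s₂ :=
    fun S s₁ s₂ => ⟨fun c => if h : c ∈ S then s₁ ⟨c, h⟩ else s₂ ⟨c, h⟩,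
      funext fun c => dif_pos c.2, funext fun c => dif_neg c.2⟩
  induction D with
  | empty U h => exact ⟨fun _ => 0, trivial⟩
  | curl U h => exact h.exists_corner
  | @shell C U M hne hU hcurl hM D ih =>
    obtain ⟨s, hs⟩ := ih inferInstance
    choose! i hi using fun c (hc : U.IsBoundaryCrossing c) => hU.exists_siteRule hcurl t hc
    refine ⟨fun c => if h : U.IsBoundaryCrossing c then i c else s ⟨c, h⟩, fun c hc => ?_, ?_⟩
    · simpa only [dif_pos hc] using hi c hc
    · have : (fun c : {c : C // ¬ U.IsBoundaryCrossing c} =>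
          if h : U.IsBoundaryCrossing c.1 then i c.1 else s ⟨c.1, h⟩) = s :=
        funext fun c => dif_neg c.2
      rwa [this]
  | composite U S U₁ U₂ h1 h2 h D₁ D₂ ih₁ ih₂ =>
    obtain ⟨s₁, hs₁⟩ := ih₁ inferInstance
    obtain ⟨s₂, hs₂⟩ := ih₂ inferInstance
    obtain ⟨s, rfl, rfl⟩ := glue S s₁ s₂
    exact ⟨s, hs₁, hs₂⟩
  | rider U S U₁ e U₂ h1 h2 h D₁ D₂ ih₁ ih₂ =>
    obtain ⟨s₁, hs₁⟩ := ih₁ inferInstance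
    obtain ⟨s₂, hs₂⟩ := ih₂ inferInstance
    obtain ⟨s, rfl, rfl⟩ := glue S s₁ s₂
    exact ⟨s, hs₁, hs₂⟩

/-- The shelling algorithm can be carried out on every universe. -/
theorem exists_of_card (n : ℕ) : ∀ {C : Type u} [Finite C] (U : LinkoidUniverse C), Nat.card C = n →
    Nonempty (ShellComposition U) := by
  induction n using Nat.strong_induction_on with
  | _ n ih =>
    intro C _ U hn
    rcases isEmpty_or_nonempty C with hC | hC
    · exact ⟨.empty U hC⟩
    by_cases hcurl : U.IsCurl
    · exact ⟨.curl U hcurl⟩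
    have hlt : ∀ S : Set C, S.Nonempty → Sᶜ.Nonempty → Nat.card S < n ∧ Nat.card ↥(Sᶜ) < n := by
      intro S h1 h2
      have h3 := LinkoidUniverse.card_eq_add_compl S
      have := h1.to_subtype
      have := h2.to_subtype
      have h4 : 0 < Nat.card S := Nat.card_pos
      have h5 : 0 < Nat.card ↥(Sᶜ) := Nat.card_pos
      omega
    by_cases hprime : U.IsPrime
    · by_cases hrider : U.HasRider
      · obtain ⟨S, U₁, e, U₂, h1, h2, h⟩ := hrider
        obtain ⟨D₁⟩ := ih _ (hlt S h1 h2).1 U₁ rfl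
        obtain ⟨D₂⟩ := ih _ (hlt S h1 h2).2 U₂ rfl
        exact ⟨.rider U S U₁ e U₂ h1 h2 h D₁ D₂⟩
      · have hU : U.IsSimple := ⟨hprime, hrider⟩
        obtain ⟨M, hM⟩ := hU.exists_isMidline hcurl
        obtain ⟨D⟩ := ih _ (hn ▸ hU.card_midline_lt hcurl) M rfl
        exact ⟨.shell U M hC hU hcurl hM D⟩
    · obtain ⟨S, U₁, U₂, h1, h2, h⟩ := not_not.1 hprime
      obtain ⟨D₁⟩ := ih _ (hlt S h1 h2).1 U₁ rfl
      obtain ⟨D₂⟩ := ih _ (hlt S h1 h2).2 U₂ rfl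
      exact ⟨.composite U S U₁ U₂ h1 h2 h D₁ D₂⟩

end ShellComposition

theorem mainTheorem1 {C : Type*} [Finite C] (U : LinkoidUniverse C) :
    (∃! s, U.IsClocked s) ∧ (∃! s, U.IsCounterClocked s) ∧
    Nonempty (ShellComposition U) ∧
    (∀ (D : ShellComposition U) (s : Marking C),
      (D.Places Sense.clockwise s ↔ U.IsClocked s) ∧
      (D.Places Sense.counterclockwise s ↔ U.IsCounterClocked s)) ∧
    (∃! j, U.IsClockedTrail j) ∧ (∃! j, U.IsCounterClockedTrail j) ∧
    (∀ (D : ShellComposition U) (s : Marking C),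
      (D.Places Sense.clockwise s → U.IsClockedTrail (smoothing s)) ∧
      (D.Places Sense.counterclockwise s → U.IsCounterClockedTrail (smoothing s))) := by
  have hC : Finite C := inferInstance
  obtain ⟨D⟩ := ShellComposition.exists_of_card _ U rfl
  obtain ⟨s₁, h₁⟩ := D.exists_places Sense.clockwise hC
  obtain ⟨s₂, h₂⟩ := D.exists_places Sense.counterclockwise hC
  have e₁ : U.IsClocked s₁ := D.isExtreme_of_places _ hC h₁
  have e₂ : U.IsCounterClocked s₂ := D.isExtreme_of_places _ hC h₂
  have t₁ : ∀ s, U.IsClocked s → U.IsClockedTrail (smoothing s) := fun s hs =>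
    ⟨U.isTrail_smoothing hs.1, s, hs, rfl⟩
  have t₂ : ∀ s, U.IsCounterClocked s → U.IsCounterClockedTrail (smoothing s) := fun s hs =>
    ⟨U.isTrail_smoothing hs.1, s, hs, rfl⟩
  refine ⟨⟨s₁, e₁, fun s hs => U.isClocked_unique hs e₁⟩,
    ⟨s₂, e₂, fun s hs => U.isCounterClocked_unique hs e₂⟩, ⟨D⟩, fun D s => ⟨⟨?_, ?_⟩, ⟨?_, ?_⟩⟩,
    ⟨smoothing s₁, t₁ _ e₁, ?_⟩, ⟨smoothing s₂, t₂ _ e₂, ?_⟩, fun D s => ⟨fun hs => ?_, fun hs => ?_⟩⟩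
  · exact D.isExtreme_of_places Sense.clockwise hC
  · intro hs
    obtain ⟨s', h⟩ := D.exists_places Sense.clockwise hC
    rwa [U.isClocked_unique hs (D.isExtreme_of_places Sense.clockwise hC h)]
  · exact D.isExtreme_of_places Sense.counterclockwise hC
  · intro hs
    obtain ⟨s', h⟩ := D.exists_places Sense.counterclockwise hC
    rwa [U.isCounterClocked_unique hs (D.isExtreme_of_places Sense.counterclockwise hC h)]
  · rintro _ ⟨-, s, hs, rfl⟩
    rw [U.isClocked_unique hs e₁]
  · rintro _ ⟨-, s, hs, rfl⟩
    rw [U.isCounterClocked_unique hs e₂]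
  · exact t₁ s (D.isExtreme_of_places Sense.clockwise hC hs)
  · exact t₂ s (D.isExtreme_of_places Sense.counterclockwise hC hs)
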